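/- Let $M$ be a smooth manifold (finite dimensional, Hausdorff, second countable). A Nijenhuis operator on $M$ is a $(1,1)$ tensor $N : TM \to TM$ with $[NX,NY] + N^2[X,Y] - N[NX,Y] - N[X,NY] = 0$ for all vector fields $X, Y$; it defines a Lie algebroid $(TM)_N$, namely the vector bundle $TM$ with anchor $N$ and bracket $[X,Y]_N = [NX,Y]+[X,NY]-N[X,Y]$. For a vector bundle $A \to M$ let $A[1]$ be the graded manifold with functions $C^\infty(A[1]) = \Gamma(\Lambda^\bullet A^*)$. For a section $a$ of $A$ let $a^\uparrow$ be the degree $-1$ vector field on $A[1]$ given by contraction with $a$, and for a vector bundle map $U : TM \to A$ let $U^\uparrow$ be the $(1,1)$ tensor of internal degree $-1$ on $A[1]$ with $U^\uparrow(X) = (U\sigma_X)^\uparrow$ for every degree $0$ vector field $X$ on $A[1]$ acting on $C^\infty(M)$ as the vector field $\sigma_X$. An almost tangent structure on $A[1]$ is a $(1,1)$ tensor $V$ with $\ker V = \operatorname{im} V$; it is integrable if $[V,V]^{\mathrm{fn}}=0$, where $[-,-]^{\mathrm{fn}}$ is the Frölicher–Nijenhuis bracket. Every almost tangent structure of internal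 degree $-1$ on $A[1]$ is integrable. Let $A \Rightarrow M$ be a Lie algebroid with anchor $\rho_A$, and let $d_A$ be its de Rham differential, a degree $1$ vector field on $A[1]$. Then $A$ is isomorphic (over the identity of $M$) to $(TM)_N$ for some Nijenhuis operator $N$ on $M$ if and only if there is an almost tangent structure $V$ of internal degree $-1$ on $A[1]$ such that $$[[d_A, V]^{\mathrm{fn}}, V]^{\mathrm{fn}} = 0 .$$ In this case there is a unique vector bundle map $U : TM \to A$ with $U^\uparrow = V$; it is an isomorphism of vector bundles, $N = \rho_A \circ U$ is a Nijenhuis operator, $U : (TM)_N \to A$ is an isomorphism of Lie algebroids, and under the identification $T[1]M \cong A[1]$ induced by $U$ the tensor $[d_A, V]^{\mathrm{fn}}$ is the shifted tangent lift of $N$, i.e. the $(1,1)$ tensor $T$ of internal degree $0$ on $T[1]M$ such that $T(Z^\uparrow) = (NZ)^\uparrow$ and $(\mathcal L_{Z^\uparrow}T)(X) = \big([Z,N\sigma_X]-N[Z,\sigma_X]\big)^\uparrow$ for all vector fields $Z$ on $M$ and all degree $0$ vector fields $X$ on $T[1]M$, and such that $T(X)$ acts on $C^\infty(M)$ as $N\sigma_X$.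 -/

import Mathlib

open scoped Manifold ContDiff Bundle Topology

noncomputable section

namespace ShiftedBundle

/-! ### The grading of an exterior algebra, indexed by the integers -/

section Exterior

variable {W : Type*} [AddCommGroup W] [Module ℝ W]

/-- The homogeneous elements of degree `j` of the exterior algebra (zero for negative `j`). -/
def grd (W : Type*) [AddCommGroup W] [Module ℝ W] (j : ℤ) : Submodule ℝ (ExteriorAlgebra ℝ W) :=
  if 0 ≤ j then ⋀[ℝ]^j.toNat W else ⊥

theorem grd_natCast (n : ℕ) : grd W (n : ℤ) = ⋀[ℝ]^n W := by simp [grd]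

theorem grd_neg {j : ℤ} (hj : j < 0) : grd W j = ⊥ := by simp [grd, not_le.mpr hj]

/-- An element of degree `j` is zero, or `j` is a natural number. -/
theorem grd_cases {j : ℤ} {a : ExteriorAlgebra ℝ W} (ha : a ∈ grd W j) :
    a = 0 ∨ ∃ n : ℕ, j = n ∧ a ∈ ⋀[ℝ]^n W := by
  rcases lt_or_ge j 0 with hj | hj
  · left; simpa [grd_neg hj] using ha
  · right
    obtain ⟨n, rfl⟩ := Int.eq_ofNat_of_zero_le hj
    exact ⟨n, rfl, by rwa [grd_natCast] at ha⟩

theorem grd_mul {i j : ℤ} {a b : ExteriorAlgebra ℝ W} (ha : a ∈ grd W i) (hb : b ∈ grd W j) :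
    a * b ∈ grd W (i + j) := by
  rcases grd_cases ha with rfl | ⟨m, rfl, ha'⟩
  · simp
  rcases grd_cases hb with rfl | ⟨n, rfl, hb'⟩
  · simp
  rw [← Nat.cast_add, grd_natCast, ExteriorAlgebra.exteriorPower, pow_add]
  exact Submodule.mul_mem_mul ha' hb'

theorem ι_mul_comm_of_mem {n : ℕ} {b : ExteriorAlgebra ℝ W} (hb : b ∈ ⋀[ℝ]^n W) (v : W) :
    ExteriorAlgebra.ι ℝ v * b = (-1 : ℝ) ^ n • (b * ExteriorAlgebra.ι ℝ v) := by
  induction hb using Submodule.pow_induction_on_left' with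
  | algebraMap r => simp [Algebra.commutes]
  | add x y i hx hy ihx ihy => rw [mul_add, ihx, ihy, add_mul, smul_add]
  | mem_mul m hm i x hx ih =>
    obtain ⟨w, rfl⟩ := hm
    have h : ExteriorAlgebra.ι ℝ v * ExteriorAlgebra.ι ℝ w =
        -(ExteriorAlgebra.ι ℝ w * ExteriorAlgebra.ι ℝ v) :=
      eq_neg_of_add_eq_zero_left (ExteriorAlgebra.ι_add_mul_swap v w)
    rw [← mul_assoc, h, neg_mul, mul_assoc, ih, Nat.succ_eq_add_one, pow_succ, mul_smul_comm,
      mul_assoc]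
    simp

theorem mul_comm_of_mem {m n : ℕ} {a b : ExteriorAlgebra ℝ W} (ha : a ∈ ⋀[ℝ]^m W)
    (hb : b ∈ ⋀[ℝ]^n W) : a * b = (-1 : ℝ) ^ (m * n) • (b * a) := by
  induction ha using Submodule.pow_induction_on_left' with
  | algebraMap r => simp [Algebra.commutes]
  | add x y i hx hy ihx ihy => rw [mul_add, add_mul, ihx, ihy, smul_add]
  | mem_mul v hv i x hx ih =>
    obtain ⟨w, rfl⟩ := hv
    rw [mul_assoc, ih, mul_smul_comm, ← mul_assoc, ι_mul_comm_of_mem hb, smul_mul_assoc, smul_smul,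
      ← pow_add, mul_assoc, Nat.succ_mul]

/-- Graded commutativity. -/
theorem grd_comm {i j : ℤ} {a b : ExteriorAlgebra ℝ W} (ha : a ∈ grd W i) (hb : b ∈ grd W j) :
    a * b = (-1 : ℝ) ^ (i * j) • (b * a) := by
  rcases grd_cases ha with rfl | ⟨m, rfl, ha'⟩
  · simp
  rcases grd_cases hb with rfl | ⟨n, rfl, hb'⟩
  · simp
  rw [mul_comm_of_mem ha' hb', ← Nat.cast_mul, zpow_natCast]

/-- Contraction of an element of the exterior algebra of the dual space with a vector. -/
def contract {V : Type*} [AddCommGroup V] [Module ℝ V] (v : V) :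
    ExteriorAlgebra ℝ (Module.Dual ℝ V) →ₗ[ℝ] ExteriorAlgebra ℝ (Module.Dual ℝ V) :=
  CliffordAlgebra.contractLeft (Q := 0) (Module.Dual.eval ℝ V v)

section Contract

variable {V : Type*} [AddCommGroup V] [Module ℝ V] (v : V)

theorem contract_ι_mul (ξ : Module.Dual ℝ V) (b : ExteriorAlgebra ℝ (Module.Dual ℝ V)) :
    contract v (ExteriorAlgebra.ι ℝ ξ * b) = ξ v • b - ExteriorAlgebra.ι ℝ ξ * contract v b :=
  CliffordAlgebra.contractLeft_ι_mul _ ξ b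

theorem contract_algebraMap (r : ℝ) :
    contract v (algebraMap ℝ (ExteriorAlgebra ℝ (Module.Dual ℝ V)) r) = 0 :=
  CliffordAlgebra.contractLeft_algebraMap _ _ r

theorem contract_ι (ξ : Module.Dual ℝ V) :
    contract v (ExteriorAlgebra.ι ℝ ξ) = algebraMap ℝ _ (ξ v) :=
  CliffordAlgebra.contractLeft_ι (Q := 0) _ ξ

theorem contract_mul_of_mem {m : ℕ} {a : ExteriorAlgebra ℝ (Module.Dual ℝ V)}
    (ha : a ∈ ⋀[ℝ]^m (Module.Dual ℝ V)) (b : ExteriorAlgebra ℝ (Module.Dual ℝ V)) :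
    contract v (a * b) = contract v a * b + (-1 : ℝ) ^ m • (a * contract v b) := by
  induction ha using Submodule.pow_induction_on_left' with
  | algebraMap r =>
    rw [contract_algebraMap, ← Algebra.smul_def, map_smul, ← Algebra.smul_def]; simp
  | add x y i hx hy ihx ihy => rw [add_mul, map_add, ihx, ihy, map_add, add_mul, add_mul, smul_add]
                               abel
  | mem_mul w hw i x hx ih =>
    obtain ⟨ξ, rfl⟩ := hw
    rw [mul_assoc, contract_ι_mul, ih, contract_ι_mul, Nat.succ_eq_add_one, pow_succ, mul_add,
      sub_mul, mul_smul_comm, smul_mul_assoc, mul_assoc, mul_assoc]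
    simp only [mul_neg, mul_one, neg_smul]
    abel

theorem contract_mul_of_grd {m : ℤ} {a : ExteriorAlgebra ℝ (Module.Dual ℝ V)}
    (ha : a ∈ grd (Module.Dual ℝ V) m) (b : ExteriorAlgebra ℝ (Module.Dual ℝ V)) :
    contract v (a * b) = contract v a * b + (-1 : ℝ) ^ (-1 * m) • (a * contract v b) := by
  rcases grd_cases ha with rfl | ⟨n, rfl, h⟩
  · simp
  · rw [contract_mul_of_mem v h, neg_one_mul, zpow_neg, zpow_natCast]
    rcases neg_one_pow_eq_or ℝ n with e | e <;> simp [e]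

theorem contract_mem {j : ℤ} {a : ExteriorAlgebra ℝ (Module.Dual ℝ V)}
    (ha : a ∈ grd (Module.Dual ℝ V) j) : contract v a ∈ grd (Module.Dual ℝ V) (j - 1) := by
  rcases grd_cases ha with rfl | ⟨m, rfl, ha'⟩
  · simp
  clear ha
  induction ha' using Submodule.pow_induction_on_left' with
  | algebraMap r => rw [contract_algebraMap]; exact Submodule.zero_mem _
  | add x y i hx hy ihx ihy => rw [map_add]; exact Submodule.add_mem _ ihx ihy
  | mem_mul w hw i x hx ih =>
    obtain ⟨ξ, rfl⟩ := hw
    have e : ((i.succ : ℕ) : ℤ) - 1 = i := by push_cast; ring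
    rw [contract_ι_mul, e]
    refine Submodule.sub_mem _ (Submodule.smul_mem _ _ (by rwa [grd_natCast])) ?_
    have h1 : ExteriorAlgebra.ι ℝ ξ ∈ grd (Module.Dual ℝ V) 1 := by
      rw [← Nat.cast_one, grd_natCast, ExteriorAlgebra.exteriorPower, pow_one]
      exact LinearMap.mem_range_self _ _
    have := grd_mul h1 ih
    rwa [add_sub_cancel] at this

theorem contract_mul (a b : ExteriorAlgebra ℝ (Module.Dual ℝ V)) :
    contract v (a * b) = contract v a * b + CliffordAlgebra.involute a * contract v b := by
  induction a using CliffordAlgebra.left_induction (Q := (0 : QuadraticForm ℝ (Module.Dual ℝ V))) with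
  | algebraMap r =>
    erw [contract_algebraMap]
    erw [← Algebra.smul_def]
    rw [map_smul, AlgHom.commutes]
    erw [← Algebra.smul_def]
    simp
  | add x y hx hy => rw [add_mul, map_add, hx, hy, map_add, map_add, add_mul, add_mul]; abel
  | ι_mul x ξ hx =>
    rw [mul_assoc]
    erw [contract_ι_mul, contract_ι_mul]
    rw [hx, map_mul, CliffordAlgebra.involute_ι]
    erw [mul_add, sub_mul, smul_mul_assoc, mul_assoc, mul_assoc, neg_mul]
    rw [sub_add_eq_sub_sub, sub_eq_add_neg (_ - _)]

end Contract

end Exterior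

/-! ### Sections, smooth bundle maps, Lie algebroids

`M` is a smooth manifold modelled on the finite dimensional space `E`; a smooth vector bundle
over `M` with typical fibre `F` is a family `A : M → Type*` of vector spaces with Mathlib's
bundle structure. -/

section Base

variable (E : Type*) [NormedAddCommGroup E] [NormedSpace ℝ E]
  {M : Type*} [TopologicalSpace M] [ChartedSpace E M]
  (F : Type*) [NormedAddCommGroup F] [NormedSpace ℝ F]
  (A : M → Type*) [∀ x, AddCommGroup (A x)] [∀ x, Module ℝ (A x)]
  [∀ x, TopologicalSpace (A x)] [TopologicalSpace (Bundle.TotalSpace F A)]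
  [FiberBundle F A]

/-- Smooth sections `Γ(A)` of a vector bundle. -/
abbrev Sec : Type _ := Cₛ^∞⟮𝓘(ℝ, E); F, A⟯

variable (M) in
/-- The tangent bundle of `M`. -/
abbrev TM (x : M) : Type _ := TangentSpace 𝓘(ℝ, E) x

variable (M) in
/-- Smooth functions on `M`. -/
abbrev Smooth : Type _ := C^∞⟮𝓘(ℝ, E), M; 𝓘(ℝ, ℝ), ℝ⟯

variable {E} in
/-- The derivative of a real function `f` at `x` in the direction of `v`. -/
def dirDeriv (f : M → ℝ) (x : M) (v : TM E M x) : ℝ := mfderiv 𝓘(ℝ, E) 𝓘(ℝ, ℝ) f x v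

variable {E F A} in
/-- The product of a section with a smooth function. -/
def fsmul [VectorBundle ℝ F A] (f : Smooth E M) (a : Sec E F A) : Sec E F A :=
  ⟨fun x => f x • a x, f.contMDiff.smul_section a.contMDiff⟩

end Base

section BundleMaps

variable (E : Type*) [NormedAddCommGroup E] [NormedSpace ℝ E]
  {M : Type*} [TopologicalSpace M] [ChartedSpace E M]
  (F : Type*) [NormedAddCommGroup F] [NormedSpace ℝ F]
  (A : M → Type*) [∀ x, AddCommGroup (A x)] [∀ x, Module ℝ (A x)]
  [∀ x, TopologicalSpace (A x)] [TopologicalSpace (Bundle.TotalSpace F A)]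
  [FiberBundle F A]
  (F' : Type*) [NormedAddCommGroup F'] [NormedSpace ℝ F']
  (B : M → Type*) [∀ x, AddCommGroup (B x)] [∀ x, Module ℝ (B x)]
  [∀ x, TopologicalSpace (B x)] [TopologicalSpace (Bundle.TotalSpace F' B)]
  [FiberBundle F' B]

/-- Smooth vector bundle maps `A → B` over the identity of `M`: families of linear maps between
the fibres which take smooth sections to smooth sections. -/
structure BundleMap where
  /-- the linear map on the fibre over `x` -/
  toFun : ∀ x, A x →ₗ[ℝ] B x
  smooth' : ∀ s : Sec E F A, ContMDiff 𝓘(ℝ, E) (𝓘(ℝ, E).prod 𝓘(ℝ, F')) ∞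
    fun x => Bundle.TotalSpace.mk' F' x (toFun x (s x))

namespace BundleMap

variable {E F A F' B}

/-- The map induced on smooth sections. -/
def onSec (U : BundleMap E F A F' B) (s : Sec E F A) : Sec E F' B :=
  ⟨fun x => U.toFun x (s x), U.smooth' s⟩

/-- `U` is a vector bundle isomorphism. -/
def IsIso (U : BundleMap E F A F' B) : Prop := ∀ x, Function.Bijective (U.toFun x)

/-- Composition of bundle maps. -/
def comp {F'' : Type*} [NormedAddCommGroup F''] [NormedSpace ℝ F'']
    {C : M → Type*} [∀ x, AddCommGroup (C x)] [∀ x, Module ℝ (C x)]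
    [∀ x, TopologicalSpace (C x)] [TopologicalSpace (Bundle.TotalSpace F'' C)]
    [FiberBundle F'' C]
    (W : BundleMap E F' B F'' C) (U : BundleMap E F A F' B) : BundleMap E F A F'' C where
  toFun x := W.toFun x ∘ₗ U.toFun x
  smooth' s := W.smooth' (U.onSec s)

theorem onSec_add [VectorBundle ℝ F A] [VectorBundle ℝ F' B] (U : BundleMap E F A F' B)
    (s t : Sec E F A) : U.onSec (s + t) = U.onSec s + U.onSec t := by
  ext x; exact map_add (U.toFun x) _ _

theorem onSec_neg [VectorBundle ℝ F A] [VectorBundle ℝ F' B] (U : BundleMap E F A F' B)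
    (s : Sec E F A) : U.onSec (-s) = -U.onSec s := by
  ext x; exact map_neg (U.toFun x) _

theorem onSec_sub [VectorBundle ℝ F A] [VectorBundle ℝ F' B] (U : BundleMap E F A F' B)
    (s t : Sec E F A) : U.onSec (s - t) = U.onSec s - U.onSec t := by
  ext x; exact map_sub (U.toFun x) _ _

theorem onSec_smul [VectorBundle ℝ F A] [VectorBundle ℝ F' B] (U : BundleMap E F A F' B)
    (r : ℝ) (s : Sec E F A) : U.onSec (r • s) = r • U.onSec s := by
  ext x; exact map_smul (U.toFun x) _ _

end BundleMap

end BundleMaps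

set_option linter.unusedSectionVars false

section VectorFields

variable {E : Type*} [NormedAddCommGroup E] [NormedSpace ℝ E] [FiniteDimensional ℝ E]
  {M : Type*} [TopologicalSpace M] [ChartedSpace E M] [IsManifold 𝓘(ℝ, E) ∞ M]

/-- The Lie bracket of smooth vector fields on `M`. -/
def vfBracket (X Y : Sec E E (TM E M)) : Sec E E (TM E M) :=
  haveI : CompleteSpace E := FiniteDimensional.complete ℝ E
  haveI : IsManifold 𝓘(ℝ, E) ((⊤ : ℕ∞) + 1) M := inferInstanceAs (IsManifold 𝓘(ℝ, E) ∞ M)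
  haveI : IsManifold 𝓘(ℝ, E) (minSmoothness ℝ 2) M := by
    rw [minSmoothness_of_isRCLikeNormedField]; infer_instance
  ⟨VectorField.mlieBracket 𝓘(ℝ, E) X Y, fun x =>
    ContMDiffAt.mlieBracket_vectorField (m := ⊤) (n := ⊤) X.contMDiff.contMDiffAt
      Y.contMDiff.contMDiffAt (by simp)⟩

theorem Sec.mdiffAt (X : Sec E E (TM E M)) (x : M) :
    MDifferentiableAt 𝓘(ℝ, E) (𝓘(ℝ, E).prod 𝓘(ℝ, E))
      (fun y => Bundle.TotalSpace.mk' E y (X y)) x :=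
  X.contMDiff.contMDiffAt.mdifferentiableAt (by simp)

theorem vfBracket_skew (X Y : Sec E E (TM E M)) : vfBracket X Y = -vfBracket Y X := by
  ext x
  exact VectorField.mlieBracket_swap_apply

theorem vfBracket_add (X Y Z : Sec E E (TM E M)) :
    vfBracket X (Y + Z) = vfBracket X Y + vfBracket X Z := by
  have : CompleteSpace E := FiniteDimensional.complete ℝ E
  ext x
  exact VectorField.mlieBracket_add_right (Y.mdiffAt x) (Z.mdiffAt x)

theorem vfBracket_smul (r : ℝ) (X Y : Sec E E (TM E M)) :
    vfBracket X (r • Y) = r • vfBracket X Y := by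
  have : CompleteSpace E := FiniteDimensional.complete ℝ E
  ext x
  exact VectorField.mlieBracket_const_smul_right (Y.mdiffAt x)

theorem vfBracket_jacobi (X Y Z : Sec E E (TM E M)) :
    vfBracket X (vfBracket Y Z) = vfBracket (vfBracket X Y) Z + vfBracket Y (vfBracket X Z) := by
  have : CompleteSpace E := FiniteDimensional.complete ℝ E
  have : IsManifold 𝓘(ℝ, E) (minSmoothness ℝ 3) M := by
    rw [minSmoothness_of_isRCLikeNormedField]; infer_instance
  have h : minSmoothness ℝ 2 ≤ (∞ : WithTop ℕ∞) := by
    rw [minSmoothness_of_isRCLikeNormedField]; exact WithTop.coe_le_coe.mpr le_top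
  ext x
  exact VectorField.leibniz_identity_mlieBracket_apply (X.contMDiff.contMDiffAt.of_le h)
    (Y.contMDiff.contMDiffAt.of_le h) (Z.contMDiff.contMDiffAt.of_le h)

theorem vfBracket_fsmul (f : Smooth E M) (X Y : Sec E E (TM E M)) (x : M) :
    vfBracket X (fsmul f Y) x = f x • vfBracket X Y x + dirDeriv f x (X x) • Y x := by
  have : CompleteSpace E := FiniteDimensional.complete ℝ E
  rw [add_comm]
  exact VectorField.mlieBracket_smul_right (f.contMDiff.contMDiffAt.mdifferentiableAt (by simp))
    (Y.mdiffAt x)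

end VectorFields

section Algebroids

variable (E : Type*) [NormedAddCommGroup E] [NormedSpace ℝ E]
  {M : Type*} [TopologicalSpace M] [ChartedSpace E M] [IsManifold 𝓘(ℝ, E) ∞ M]
  (F : Type*) [NormedAddCommGroup F] [NormedSpace ℝ F]
  (A : M → Type*) [∀ x, AddCommGroup (A x)] [∀ x, Module ℝ (A x)]
  [∀ x, TopologicalSpace (A x)] [TopologicalSpace (Bundle.TotalSpace F A)]
  [FiberBundle F A] [VectorBundle ℝ F A]

/-- A Lie algebroid structure on the vector bundle `A`: an anchor `ρ : A → TM` and a Lie bracket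
on `Γ(A)` with `[a, f b] = f [a, b] + (ρ(a) f) b`. -/
structure LieAlgebroid where
  /-- the anchor -/
  anchor : BundleMap E F A E (TM E M)
  /-- the Lie bracket on sections -/
  bracket : Sec E F A → Sec E F A → Sec E F A
  bracket_add : ∀ a b c, bracket a (b + c) = bracket a b + bracket a c
  bracket_smul : ∀ (r : ℝ) a b, bracket a (r • b) = r • bracket a b
  bracket_skew : ∀ a b, bracket a b = -bracket b a
  jacobi : ∀ a b c, bracket a (bracket b c) = bracket (bracket a b) c + bracket b (bracket a c)
  leibniz : ∀ (f : Smooth E M) (a b : Sec E F A) (x : M),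
    bracket a (fsmul f b) x = f x • bracket a b x + dirDeriv f x (anchor.toFun x (a x)) • b x

variable {E F A}

/-- `U : A → B` is an isomorphism of Lie algebroids over the identity of `M`. -/
def IsLieAlgebroidIso {F' : Type*} [NormedAddCommGroup F'] [NormedSpace ℝ F']
    {B : M → Type*} [∀ x, AddCommGroup (B x)] [∀ x, Module ℝ (B x)]
    [∀ x, TopologicalSpace (B x)] [TopologicalSpace (Bundle.TotalSpace F' B)]
    [FiberBundle F' B] [VectorBundle ℝ F' B]
    (LA : LieAlgebroid E F A) (LB : LieAlgebroid E F' B) (U : BundleMap E F A F' B) : Prop :=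
  U.IsIso ∧ (∀ x v, LB.anchor.toFun x (U.toFun x v) = LA.anchor.toFun x v) ∧
    ∀ a b, U.onSec (LA.bracket a b) = LB.bracket (U.onSec a) (U.onSec b)

end Algebroids

section Nijenhuis

variable {E : Type*} [NormedAddCommGroup E] [NormedSpace ℝ E] [FiniteDimensional ℝ E]
  {M : Type*} [TopologicalSpace M] [ChartedSpace E M] [IsManifold 𝓘(ℝ, E) ∞ M]

/-- The `(1,1)` tensor `N` is a Nijenhuis operator: its Nijenhuis torsion vanishes. -/
def IsNijenhuis (N : BundleMap E E (TM E M) E (TM E M)) : Prop :=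
  ∀ X Y, vfBracket (N.onSec X) (N.onSec Y) + N.onSec (N.onSec (vfBracket X Y))
    - N.onSec (vfBracket (N.onSec X) Y) - N.onSec (vfBracket X (N.onSec Y)) = 0

/-- The bracket `[X, Y]_N = [N X, Y] + [X, N Y] - N [X, Y]`. -/
def nijBracket (N : BundleMap E E (TM E M) E (TM E M)) (X Y : Sec E E (TM E M)) :
    Sec E E (TM E M) :=
  vfBracket (N.onSec X) Y + vfBracket X (N.onSec Y) - N.onSec (vfBracket X Y)

theorem nijBracket_skew (N : BundleMap E E (TM E M) E (TM E M)) (X Y : Sec E E (TM E M)) :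
    nijBracket N X Y = -nijBracket N Y X := by
  rw [nijBracket, nijBracket, vfBracket_skew (N.onSec X), vfBracket_skew X (N.onSec Y),
    vfBracket_skew X Y, N.onSec_neg]
  abel

theorem vfBracket_add_left (X Y Z : Sec E E (TM E M)) :
    vfBracket (X + Y) Z = vfBracket X Z + vfBracket Y Z := by
  rw [vfBracket_skew, vfBracket_add, vfBracket_skew Z X, vfBracket_skew Z Y]; abel

theorem vfBracket_neg (X Y : Sec E E (TM E M)) : vfBracket X (-Y) = -vfBracket X Y := by
  have := vfBracket_smul (-1 : ℝ) X Y
  simpa using this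

theorem vfBracket_sub (X Y Z : Sec E E (TM E M)) :
    vfBracket X (Y - Z) = vfBracket X Y - vfBracket X Z := by
  rw [sub_eq_add_neg, vfBracket_add, vfBracket_neg, ← sub_eq_add_neg]

theorem vfBracket_sub_left (X Y Z : Sec E E (TM E M)) :
    vfBracket (X - Y) Z = vfBracket X Z - vfBracket Y Z := by
  rw [vfBracket_skew, vfBracket_sub, vfBracket_skew Z X, vfBracket_skew Z Y]; abel

theorem onSec_nijBracket {N : BundleMap E E (TM E M) E (TM E M)} (hN : IsNijenhuis N)
    (X Y : Sec E E (TM E M)) :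
    N.onSec (nijBracket N X Y) = vfBracket (N.onSec X) (N.onSec Y) := by
  have := hN X Y
  rw [nijBracket, N.onSec_sub, N.onSec_add]
  rw [sub_sub, sub_eq_zero] at this
  rw [← this]; abel

theorem nijBracket_jacobi {N : BundleMap E E (TM E M) E (TM E M)} (hN : IsNijenhuis N)
    (X Y Z : Sec E E (TM E M)) :
    nijBracket N X (nijBracket N Y Z) =
      nijBracket N (nijBracket N X Y) Z + nijBracket N Y (nijBracket N X Z) := by
  have expand : ∀ X Y Z, nijBracket N X (nijBracket N Y Z) =
      vfBracket (N.onSec X) (vfBracket (N.onSec Y) Z)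
      + vfBracket (N.onSec X) (vfBracket Y (N.onSec Z))
      + vfBracket X (vfBracket (N.onSec Y) (N.onSec Z))
      - N.onSec (vfBracket X (vfBracket (N.onSec Y) Z))
      - N.onSec (vfBracket X (vfBracket Y (N.onSec Z)))
      - N.onSec (vfBracket (N.onSec X) (vfBracket Y Z))
      + N.onSec (N.onSec (vfBracket X (vfBracket Y Z))) := by
    intro X Y Z
    have h := hN X (vfBracket Y Z)
    rw [nijBracket, onSec_nijBracket hN, nijBracket]
    simp only [vfBracket_add, vfBracket_sub, N.onSec_add, N.onSec_sub]
    rw [← sub_eq_zero, ← neg_eq_zero, ← h]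
    abel
  rw [nijBracket_skew N (nijBracket N X Y) Z, expand, expand, expand]
  have j1 := vfBracket_jacobi (N.onSec X) (N.onSec Y) Z
  have j2 := vfBracket_jacobi (N.onSec X) Y (N.onSec Z)
  have j3 := vfBracket_jacobi X (N.onSec Y) (N.onSec Z)
  have j4 := vfBracket_jacobi X (N.onSec Y) Z
  have j5 := vfBracket_jacobi X Y (N.onSec Z)
  have j6 := vfBracket_jacobi (N.onSec X) Y Z
  have j7 := vfBracket_jacobi X Y Z
  rw [vfBracket_skew (vfBracket _ _) Z] at j1 j4 j6 j7
  rw [vfBracket_skew (vfBracket _ _) (N.onSec Z)] at j2 j3 j5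
  rw [j1, j2, j3, j4, j5, j6, j7]
  simp only [N.onSec_add, N.onSec_neg]
  abel

/-- The Lie algebroid `(TM)_N` of a Nijenhuis operator `N`. -/
def nijenhuisAlgebroid (N : BundleMap E E (TM E M) E (TM E M)) (hN : IsNijenhuis N) :
    LieAlgebroid E E (TM E M) where
  anchor := N
  bracket := nijBracket N
  bracket_add X Y Z := by
    simp only [nijBracket, vfBracket_add, N.onSec_add]; abel
  bracket_smul r X Y := by
    simp only [nijBracket, vfBracket_smul, N.onSec_smul, smul_add, smul_sub]
  bracket_skew := nijBracket_skew N
  jacobi := nijBracket_jacobi hN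
  leibniz f X Y x := by
    have e : N.onSec (fsmul f Y) = fsmul f (N.onSec Y) := by
      ext y; exact map_smul (N.toFun y) _ _
    have h1 := vfBracket_fsmul f (N.onSec X) Y x
    have h2 := vfBracket_fsmul f X (N.onSec Y) x
    have h3 : N.onSec (vfBracket X (fsmul f Y)) x =
        f x • N.onSec (vfBracket X Y) x + dirDeriv f x (X x) • N.onSec Y x := by
      change N.toFun x (vfBracket X (fsmul f Y) x) = _
      rw [vfBracket_fsmul, map_add, map_smul, map_smul]; rfl
    rw [nijBracket, nijBracket, e]
    change vfBracket (N.onSec X) (fsmul f Y) x + vfBracket X (fsmul f (N.onSec Y)) x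
      - N.onSec (vfBracket X (fsmul f Y)) x = f x • (vfBracket (N.onSec X) Y x
        + vfBracket X (N.onSec Y) x - N.onSec (vfBracket X Y) x) + _
    rw [h1, h2, h3, smul_sub, smul_add]
    change _ + dirDeriv f x (N.toFun x (X x)) • Y x + _ - _ = _
    abel

end Nijenhuis

/-! ### The graded manifold `A[1]`: functions

The fibre at `x` of the bundle `Λ(A^*)` is `ExteriorAlgebra ℝ (Module.Dual ℝ (A x))`. -/

section Shifted

variable (E : Type*) [NormedAddCommGroup E] [NormedSpace ℝ E]
  {M : Type*} [TopologicalSpace M] [ChartedSpace E M]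
  (F : Type*) [NormedAddCommGroup F] [NormedSpace ℝ F]
  (A : M → Type*) [∀ x, AddCommGroup (A x)] [∀ x, Module ℝ (A x)]
  [∀ x, TopologicalSpace (A x)] [TopologicalSpace (Bundle.TotalSpace F A)]
  [FiberBundle F A]

/-- Smooth sections of the dual bundle `A^*`: families of linear forms on the fibres which are
smooth on every smooth section of `A`. -/
structure CoSec where
  /-- the linear form on the fibre over `x` -/
  toFun : ∀ x, Module.Dual ℝ (A x)
  smooth' : ∀ s : Sec E F A, ContMDiff 𝓘(ℝ, E) 𝓘(ℝ, ℝ) ∞ fun x => toFun x (s x)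

/-- The algebra of sections of `Λ(A^*)` generated by smooth functions on `M` (degree `0`) and
smooth sections of `A^*` (degree `1`). -/
def generated : Subalgebra ℝ (∀ x, ExteriorAlgebra ℝ (Module.Dual ℝ (A x))) :=
  Algebra.adjoin ℝ
    ({φ | ∃ f : Smooth E M, φ = fun x => algebraMap ℝ _ (f x)} ∪
      {φ | ∃ ξ : CoSec E F A, φ = fun x => ExteriorAlgebra.ι ℝ (ξ.toFun x)})

/-- The algebra of smooth sections of `Λ(A^*)`: a section of `Λ(A^*)` is
smooth if it locally agrees with a polynomial expression in smooth functions on `M` and smooth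
sections of `A^*`. -/
def fnAlgebra : Subalgebra ℝ (∀ x, ExteriorAlgebra ℝ (Module.Dual ℝ (A x))) where
  carrier := {φ | ∀ x₀, ∃ η ∈ generated E F A, ∀ᶠ x in 𝓝 x₀, φ x = η x}
  mul_mem' {φ φ'} h h' x₀ := by
    obtain ⟨η, hη, e⟩ := h x₀
    obtain ⟨η', hη', e'⟩ := h' x₀
    exact ⟨η * η', mul_mem hη hη', by
      filter_upwards [e, e'] with x h h'
      rw [Pi.mul_apply, Pi.mul_apply, h, h']⟩
  add_mem' {φ φ'} h h' x₀ := by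
    obtain ⟨η, hη, e⟩ := h x₀
    obtain ⟨η', hη', e'⟩ := h' x₀
    exact ⟨η + η', add_mem hη hη', by
      filter_upwards [e, e'] with x h h'
      rw [Pi.add_apply, Pi.add_apply, h, h']⟩
  algebraMap_mem' r x₀ := ⟨_, Subalgebra.algebraMap_mem _ r, Filter.Eventually.of_forall
    fun _ => rfl⟩

/-- The graded algebra `C^∞(A[1]) = Γ(Λ(A^*))` of functions on `A[1]`. -/
def Fn : Type _ := fnAlgebra E F A

instance : Ring (Fn E F A) := inferInstanceAs (Ring (fnAlgebra E F A))

instance : Algebra ℝ (Fn E F A) := inferInstanceAs (Algebra ℝ (fnAlgebra E F A))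

variable {E F A}

/-- The value of a function on `A[1]` at a point of `M`, an element of `Λ(A_x^*)`. -/
def Fn.at (φ : Fn E F A) (x : M) : ExteriorAlgebra ℝ (Module.Dual ℝ (A x)) := φ.1 x

theorem Fn.ext {φ η : Fn E F A} (h : ∀ x, φ.at x = η.at x) : φ = η := Subtype.ext (funext h)

theorem generated_le : generated E F A ≤ fnAlgebra E F A :=
  fun η hη _ => ⟨η, hη, Filter.Eventually.of_forall fun _ => rfl⟩

variable (F A) in
/-- A smooth function on `M` as a function of degree `0` on `A[1]`. -/
def Fn.ofSmooth (f : Smooth E M) : Fn E F A :=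
  ⟨fun x => algebraMap ℝ _ (f x),
    generated_le (Algebra.subset_adjoin (Or.inl ⟨f, rfl⟩))⟩

/-- A smooth section of `A^*` as a (fibre linear) function of degree `1` on `A[1]`. -/
def Fn.ofCoSec (ξ : CoSec E F A) : Fn E F A :=
  ⟨fun x => ExteriorAlgebra.ι ℝ (ξ.toFun x),
    generated_le (Algebra.subset_adjoin (Or.inr ⟨ξ, rfl⟩))⟩

variable (E F A) in
/-- The functions on `A[1]` of degree `j`. -/
def FnDeg (j : ℤ) : Submodule ℝ (Fn E F A) where
  carrier := {φ | ∀ x, φ.at x ∈ grd (Module.Dual ℝ (A x)) j}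
  add_mem' h h' x := add_mem (h x) (h' x)
  zero_mem' _ := zero_mem _
  smul_mem' r _ h x := Submodule.smul_mem _ r (h x)

theorem FnDeg_mul {i j : ℤ} {φ η : Fn E F A} (h : φ ∈ FnDeg E F A i) (h' : η ∈ FnDeg E F A j) :
    φ * η ∈ FnDeg E F A (i + j) := by
  intro x
  exact grd_mul (h x) (h' x)

theorem FnDeg_comm {i j : ℤ} {φ η : Fn E F A} (h : φ ∈ FnDeg E F A i) (h' : η ∈ FnDeg E F A j) :
    φ * η = (-1 : ℝ) ^ (i * j) • (η * φ) := by
  refine Fn.ext fun x => ?_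
  exact grd_comm (h x) (h' x)

/-! ### The graded manifold `A[1]`: vector fields -/

theorem sgn_add (a b : ℤ) : (-1 : ℝ) ^ (a + b) = (-1 : ℝ) ^ a * (-1 : ℝ) ^ b :=
  zpow_add₀ (by norm_num) a b

theorem sgn_mul_self (a : ℤ) : (-1 : ℝ) ^ a * (-1 : ℝ) ^ a = 1 := by
  rw [← mul_zpow]; norm_num

variable (E F A) in
/-- The vector fields of degree `k` on `A[1]`: graded derivations of degree `k` of `C^∞(A[1])`. -/
def VF (k : ℤ) : Submodule ℝ (Module.End ℝ (Fn E F A)) where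
  carrier := {X | (∀ m, ∀ φ ∈ FnDeg E F A m, X φ ∈ FnDeg E F A (m + k)) ∧
    ∀ m, ∀ φ ∈ FnDeg E F A m, ∀ η, X (φ * η) = X φ * η + (-1 : ℝ) ^ (k * m) • (φ * X η)}
  add_mem' {X Y} hX hY := ⟨fun m φ hφ => add_mem (hX.1 m φ hφ) (hY.1 m φ hφ), fun m φ hφ η => by
    rw [LinearMap.add_apply, LinearMap.add_apply, LinearMap.add_apply, hX.2 m φ hφ, hY.2 m φ hφ,
      add_mul, mul_add, smul_add]
    abel⟩
  zero_mem' := ⟨fun m φ _ => zero_mem _, fun m φ _ η => by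
    rw [LinearMap.zero_apply, LinearMap.zero_apply, LinearMap.zero_apply, zero_mul, mul_zero,
      smul_zero, add_zero]⟩
  smul_mem' r X hX := ⟨fun m φ hφ => Submodule.smul_mem _ r (hX.1 m φ hφ), fun m φ hφ η => by
    rw [LinearMap.smul_apply, LinearMap.smul_apply, LinearMap.smul_apply, hX.2 m φ hφ, smul_add,
      smul_mul_assoc, mul_smul_comm, smul_comm]⟩

theorem vf_mem {k m : ℤ} (X : VF E F A k) {φ : Fn E F A} (h : φ ∈ FnDeg E F A m) :
    X.1 φ ∈ FnDeg E F A (m + k) := X.2.1 m φ h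

theorem vf_leibniz {k m : ℤ} (X : VF E F A k) {φ : Fn E F A} (h : φ ∈ FnDeg E F A m)
    (η : Fn E F A) : X.1 (φ * η) = X.1 φ * η + (-1 : ℝ) ^ (k * m) • (φ * X.1 η) := X.2.2 m φ h η

theorem mul_leibniz_aux {R : Type*} [Ring R] [Algebra ℝ R] {X : Module.End ℝ R} {s t : ℝ}
    {f φ η : R} (e : f * φ = t • (φ * f)) (h : X (φ * η) = X φ * η + s • (φ * X η)) :
    f * X (φ * η) = f * X φ * η + (t * s) • (φ * (f * X η)) := by
  rw [h, mul_add, mul_smul_comm, ← mul_assoc, ← mul_assoc, e, smul_mul_assoc, smul_smul,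
    mul_comm s, mul_assoc φ]

/-- The product `f X` of a vector field of degree `k` with a function of degree `m`. -/
def vfMul {m k : ℤ} (f : Fn E F A) (hf : f ∈ FnDeg E F A m) (X : VF E F A k) : VF E F A (m + k) :=
  ⟨LinearMap.mulLeft ℝ f ∘ₗ X.1, fun j φ hφ => by
      have := FnDeg_mul hf (X.2.1 j φ hφ)
      rwa [show m + (j + k) = j + (m + k) by ring] at this, fun j φ hφ η => by
      rw [add_mul, sgn_add]
      exact mul_leibniz_aux (FnDeg_comm hf hφ) (X.2.2 j φ hφ η)⟩

theorem br_leibniz_aux {R : Type*} [Ring R] [Algebra ℝ R] {X Y : Module.End ℝ R}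
    {s t u : ℝ} (hu : u * u = 1) {φ η : R}
    (hX : ∀ η, X (φ * η) = X φ * η + s • (φ * X η))
    (hY : ∀ η, Y (φ * η) = Y φ * η + t • (φ * Y η))
    (hXY : X (Y φ * η) = X (Y φ) * η + (s * u) • (Y φ * X η))
    (hYX : Y (X φ * η) = Y (X φ) * η + (t * u) • (X φ * Y η)) :
    X (Y (φ * η)) - u • Y (X (φ * η)) =
      (X (Y φ) - u • Y (X φ)) * η + (s * t) • (φ * (X (Y η) - u • Y (X η))) := by
  rw [hY, hX, map_add, map_add, map_smul, map_smul, hXY, hYX, hX, hY]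
  simp only [smul_add, smul_smul, sub_mul, mul_sub, smul_sub, smul_mul_assoc, mul_smul_comm]
  rw [show u * (t * u) = t by linear_combination t * hu, show u * s = s * u by ring,
    show u * (s * t) = s * t * u by ring, mul_comm t s]
  abel

/-- The graded commutator `X Y - (-1)^(k l) Y X` of vector fields of degree `k` and `l`. -/
def vfBr {k l : ℤ} (X : VF E F A k) (Y : VF E F A l) : VF E F A (k + l) :=
  ⟨X.1 ∘ₗ Y.1 - (-1 : ℝ) ^ (k * l) • (Y.1 ∘ₗ X.1), fun m φ hφ => by
    refine sub_mem ?_ (Submodule.smul_mem _ _ ?_)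
    · have := X.2.1 _ _ (Y.2.1 m φ hφ)
      rwa [show m + l + k = m + (k + l) by ring] at this
    · have := Y.2.1 _ _ (X.2.1 m φ hφ)
      rwa [show m + k + l = m + (k + l) by ring] at this, fun m φ hφ η => by
    have h1 := X.2.2 _ _ (Y.2.1 m φ hφ) η
    have h2 := Y.2.2 _ _ (X.2.1 m φ hφ) η
    rw [mul_add, sgn_add] at h1 h2
    rw [mul_comm l k] at h2
    rw [add_mul, sgn_add]
    exact br_leibniz_aux (sgn_mul_self (k * l)) (X.2.2 m φ hφ) (Y.2.2 m φ hφ) h1 h2⟩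

theorem br_mul_aux {R : Type*} [Ring R] [Algebra ℝ R] {X Y : Module.End ℝ R} {s u : ℝ} {f φ : R}
    (hX : X (f * Y φ) = X f * Y φ + s • (f * X (Y φ))) :
    X (f * Y φ) - (s * u) • (f * Y (X φ)) =
      X f * Y φ + s • (f * (X (Y φ) - u • Y (X φ))) := by
  rw [hX, mul_sub, smul_sub, mul_smul_comm, smul_smul]; abel

/-- `[X, f Y] = X(f) Y + (-1)^(k m) f [X, Y]`. -/
theorem vfBr_mul {k l m : ℤ} (X : VF E F A k) (Y : VF E F A l) {f : Fn E F A}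
    (hf : f ∈ FnDeg E F A m) :
    (vfBr X (vfMul f hf Y)).1 = (vfMul (X.1 f) (vf_mem X hf) Y).1
      + (-1 : ℝ) ^ (k * m) • (vfMul f hf (vfBr X Y)).1 := by
  apply LinearMap.ext
  intro φ
  have := br_mul_aux (u := (-1 : ℝ) ^ (k * l)) (X.2.2 m f hf (Y.1 φ))
  rw [← sgn_add, ← mul_add] at this
  exact this

theorem br_add_aux {R : Type*} [AddCommGroup R] [Module ℝ R] (X Y Z : Module.End ℝ R) (u : ℝ) :
    X ∘ₗ (Y + Z) - u • ((Y + Z) ∘ₗ X) = (X ∘ₗ Y - u • (Y ∘ₗ X)) + (X ∘ₗ Z - u • (Z ∘ₗ X)) := by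
  rw [LinearMap.comp_add, LinearMap.add_comp, smul_add]; abel

theorem vfBr_add {k l : ℤ} (X : VF E F A k) (Y Z : VF E F A l) :
    vfBr X (Y + Z) = vfBr X Y + vfBr X Z :=
  Subtype.ext (br_add_aux X.1 Y.1 Z.1 _)

theorem br_smul_aux {R : Type*} [AddCommGroup R] [Module ℝ R] (r : ℝ) (X Y : Module.End ℝ R)
    (u : ℝ) : X ∘ₗ (r • Y) - u • ((r • Y) ∘ₗ X) = r • (X ∘ₗ Y - u • (Y ∘ₗ X)) := by
  rw [LinearMap.comp_smul, LinearMap.smul_comp, smul_sub, smul_comm]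

theorem vfBr_smul {k l : ℤ} (r : ℝ) (X : VF E F A k) (Y : VF E F A l) :
    vfBr X (r • Y) = r • vfBr X Y :=
  Subtype.ext (br_smul_aux r X.1 Y.1 _)

/-- A vector field of degree `k`, regarded as one of degree `l = k`. -/
def vfCast {k l : ℤ} (h : k = l) : VF E F A k →ₗ[ℝ] VF E F A l :=
  Submodule.inclusion (le_of_eq (congrArg _ h))

theorem vfBr_cast {q k l : ℤ} (h : k = l) (Q : VF E F A q) (X : VF E F A k) :
    (vfBr Q (vfCast h X)).1 = (vfBr Q X).1 := by subst h; rfl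

/-! ### `(1,1)` tensors on `A[1]` and the Frölicher-Nijenhuis bracket -/

variable (E F A) in
/-- A `(1,1)` tensor (vector valued `1`-form) of internal degree `p` on `A[1]`: a `C^∞(A[1])`-linear
map of degree `p` on vector fields, `T (f X) = (-1)^(p |f|) f T(X)`. -/
structure Tensor (p : ℤ) where
  /-- the action on vector fields of degree `k` -/
  toFun : ∀ k, VF E F A k →ₗ[ℝ] VF E F A (k + p)
  map_mul : ∀ {m k : ℤ} (f : Fn E F A) (hf : f ∈ FnDeg E F A m) (X : VF E F A k),
    (toFun (m + k) (vfMul f hf X)).1 = (-1 : ℝ) ^ (p * m) • (vfMul f hf (toFun k X)).1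

theorem Tensor.congr {p k l : ℤ} (T : Tensor E F A p) (h : k = l) (X : VF E F A k)
    (Y : VF E F A l) (e : X.1 = Y.1) : (T.toFun k X).1 = (T.toFun l Y).1 := by
  subst h
  rw [Subtype.ext e]

theorem fnVec_aux {V : Type*} [AddCommGroup V] [Module ℝ V] (a b c : V) {s t u : ℝ}
    (hu : u * u = 1) : t • (a + s • b) - u • ((t * u) • a + s • (t • c)) =
      (s * t) • (b - u • c) := by
  simp only [smul_add, smul_smul, smul_sub]
  rw [show u * (t * u) = t by linear_combination t * hu, show u * (s * t) = s * t * u by ring,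
    mul_comm t s]
  abel

theorem smul_aux {V : Type*} [AddCommGroup V] [Module ℝ V] (r u : ℝ) (a b : V) :
    r • a - u • (r • b) = r • (a - u • b) := by rw [smul_sub, smul_comm]

/-- The linear map `X ↦ [Q, T X] - (-1)^(q p) T [Q, X]` on vector fields of degree `k`. -/
def fnVecMap {q p : ℤ} (Q : VF E F A q) (T : Tensor E F A p) (k : ℤ) :
    VF E F A k →ₗ[ℝ] VF E F A (k + (q + p)) where
  toFun X := vfCast (show q + (k + p) = k + (q + p) by ring) (vfBr Q (T.toFun k X))
    - (-1 : ℝ) ^ (q * p) •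
      vfCast (show q + k + p = k + (q + p) by ring) (T.toFun (q + k) (vfBr Q X))
  map_add' X Y := by
    rw [vfBr_add, map_add, map_add, vfBr_add, map_add, map_add, smul_add]; abel
  map_smul' r X := by
    rw [vfBr_smul, map_smul, map_smul, vfBr_smul, map_smul, map_smul]
    exact smul_aux (V := VF E F A (k + (q + p))) r _ _ _

theorem vfMul_sub_smul {m k : ℤ} {f : Fn E F A} (hf : f ∈ FnDeg E F A m) (X Y : VF E F A k)
    (u : ℝ) : (vfMul f hf (X - u • Y)).1 = (vfMul f hf X).1 - u • (vfMul f hf Y).1 := by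
  apply LinearMap.ext
  intro φ
  change f * (X.1 φ - u • Y.1 φ) = f * X.1 φ - u • (f * Y.1 φ)
  rw [mul_sub, mul_smul_comm]

/-- The Frölicher-Nijenhuis bracket `[Q, T] = L_Q T` of a vector field `Q` of degree `q` and a
`(1,1)` tensor `T` of internal degree `p`: `(L_Q T)(X) = [Q, T X] - (-1)^(q p) T [Q, X]`. -/
def fnVec {q p : ℤ} (Q : VF E F A q) (T : Tensor E F A p) : Tensor E F A (q + p) where
  toFun := fnVecMap Q T
  map_mul {m k} f hf X := by
    have e1 : (vfBr Q (T.toFun (m + k) (vfMul f hf X))).1 = (-1 : ℝ) ^ (p * m) •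
        ((vfMul (Q.1 f) (vf_mem Q hf) (T.toFun k X)).1
          + (-1 : ℝ) ^ (q * m) • (vfMul f hf (vfBr Q (T.toFun k X))).1) := by
      have h : T.toFun (m + k) (vfMul f hf X) = (-1 : ℝ) ^ (p * m) •
        vfCast (show m + (k + p) = m + k + p by ring) (vfMul f hf (T.toFun k X)) :=
        Subtype.ext (T.map_mul f hf X)
      rw [h, vfBr_smul, ← vfBr_mul, Submodule.coe_smul, vfBr_cast]
    have e2 : vfBr Q (vfMul f hf X) =
        vfCast (show m + q + k = q + (m + k) by ring) (vfMul (Q.1 f) (vf_mem Q hf) X) +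
        (-1 : ℝ) ^ (q * m) • vfCast (show m + (q + k) = q + (m + k) by ring)
          (vfMul f hf (vfBr Q X)) := Subtype.ext (vfBr_mul Q X hf)
    have e3 : (T.toFun (q + (m + k)) (vfBr Q (vfMul f hf X))).1 =
        ((-1 : ℝ) ^ (p * m) * (-1 : ℝ) ^ (q * p)) • (vfMul (Q.1 f) (vf_mem Q hf) (T.toFun k X)).1
        + (-1 : ℝ) ^ (q * m) • ((-1 : ℝ) ^ (p * m) •
          (vfMul f hf (T.toFun (q + k) (vfBr Q X))).1) := by
      rw [mul_comm q p, ← sgn_add, ← mul_add, ← T.map_mul, ← T.map_mul, e2, map_add, map_smul,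
        Submodule.coe_add, Submodule.coe_smul]
      rw [T.congr (show q + (m + k) = m + q + k by ring) (vfCast _ _)
          (vfMul (Q.1 f) (vf_mem Q hf) X) rfl,
        T.congr (show q + (m + k) = m + (q + k) by ring) (vfCast _ _) (vfMul f hf (vfBr Q X)) rfl]
    have e4 : (vfMul f hf (fnVecMap Q T k X)).1 = (vfMul f hf (vfBr Q (T.toFun k X))).1
        - (-1 : ℝ) ^ (q * p) • (vfMul f hf (T.toFun (q + k) (vfBr Q X))).1 :=
      vfMul_sub_smul hf (vfCast (show q + (k + p) = k + (q + p) by ring) (vfBr Q (T.toFun k X)))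
      (vfCast (show q + k + p = k + (q + p) by ring) (T.toFun (q + k) (vfBr Q X))) _
    have e5 : (fnVecMap Q T (m + k) (vfMul f hf X)).1 =
      (vfBr Q (T.toFun (m + k) (vfMul f hf X))).1
      - (-1 : ℝ) ^ (q * p) • (T.toFun (q + (m + k)) (vfBr Q (vfMul f hf X))).1 := rfl
    rw [e5, e4, e3, e1, add_mul, sgn_add]
    exact fnVec_aux _ _ _ (sgn_mul_self (q * p))

/-- The Frölicher-Nijenhuis bracket of two `(1,1)` tensors `T`, `S` of internal degrees `p`, `s`, as
a vector valued `2`-form evaluated at vector fields `X`, `Y` of degrees `k`, `l`. This is the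
formula
`[T, S](X, Y) = [T X, S Y] - [T Y, S X] - S [T X, Y] + S [T Y, X] - T [S X, Y] + T [S Y, X]`
`  + T S [X, Y] + S T [X, Y]`
with the Koszul signs of the internal degrees. -/
def fnTensor {p s : ℤ} (T : Tensor E F A p) (S : Tensor E F A s) (k l : ℤ)
    (X : VF E F A k) (Y : VF E F A l) : Module.End ℝ (Fn E F A) :=
  (-1 : ℝ) ^ (s * k) • (vfBr (T.toFun k X) (S.toFun l Y)).1
  - (-1 : ℝ) ^ (l * (s + k)) • (vfBr (T.toFun l Y) (S.toFun k X)).1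
  - (-1 : ℝ) ^ (p * s) • (S.toFun _ (vfBr (T.toFun k X) Y)).1
  + (-1 : ℝ) ^ (p * s + k * l) • (S.toFun _ (vfBr (T.toFun l Y) X)).1
  - (T.toFun _ (vfBr (S.toFun k X) Y)).1
  + (-1 : ℝ) ^ (k * l) • (T.toFun _ (vfBr (S.toFun l Y) X)).1
  + (T.toFun _ (S.toFun _ (vfBr X Y))).1
  + (-1 : ℝ) ^ (p * s) • (S.toFun _ (T.toFun _ (vfBr X Y))).1

/-- The Frölicher-Nijenhuis bracket `[T, S]` vanishes. -/
def FnCommute {p s : ℤ} (T : Tensor E F A p) (S : Tensor E F A s) : Prop :=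
  ∀ k l X Y, fnTensor T S k l X Y = 0

/-- `V` is an almost tangent structure: `ker V = im V`. -/
def Tensor.IsAlmostTangent {p : ℤ} (V : Tensor E F A p) : Prop :=
  ∀ k (X : VF E F A k), V.toFun k X = 0 ↔ ∃ j, ∃ Y : VF E F A j, j + p = k ∧ (V.toFun j Y).1 = X.1

/-! ### Lifts of sections, bundle maps and `(1,1)` tensors to `A[1]` -/

theorem involute_generated {η : ∀ x, ExteriorAlgebra ℝ (Module.Dual ℝ (A x))}
    (h : η ∈ generated E F A) :
    (fun x => (CliffordAlgebra.involute (η x) : ExteriorAlgebra ℝ (Module.Dual ℝ (A x))))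
      ∈ generated E F A := by
  induction h using Algebra.adjoin_induction with
  | mem φ hφ =>
    rcases hφ with ⟨f, rfl⟩ | ⟨ξ, rfl⟩
    · refine Algebra.subset_adjoin (Or.inl ⟨f, ?_⟩)
      funext x; exact AlgHom.commutes _ _
    · have : (fun x => ExteriorAlgebra.ι ℝ (ξ.toFun x)) ∈ generated E F A :=
        Algebra.subset_adjoin (Or.inr ⟨ξ, rfl⟩)
      have := neg_mem this
      convert this using 1
      funext x; exact CliffordAlgebra.involute_ι _
  | algebraMap r =>
    convert Subalgebra.algebraMap_mem (generated E F A) r using 1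
    funext x; exact AlgHom.commutes _ _
  | add a b _ _ iha ihb => convert add_mem iha ihb using 1; funext x; exact map_add _ _ _
  | mul a b _ _ iha ihb => convert mul_mem iha ihb using 1; funext x; exact map_mul _ _ _

theorem contract_generated (a : Sec E F A) {η : ∀ x, ExteriorAlgebra ℝ (Module.Dual ℝ (A x))}
    (h : η ∈ generated E F A) : (fun x => contract (a x) (η x)) ∈ generated E F A := by
  induction h using Algebra.adjoin_induction with
  | mem φ hφ =>
    rcases hφ with ⟨f, rfl⟩ | ⟨ξ, rfl⟩
    · convert zero_mem (generated E F A) using 1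
      funext x; exact contract_algebraMap _ _
    · refine Algebra.subset_adjoin (Or.inl ⟨⟨_, ξ.smooth' a⟩, ?_⟩)
      funext x; exact contract_ι _ _
  | algebraMap r =>
    convert zero_mem (generated E F A) using 1
    funext x; exact contract_algebraMap _ _
  | add a b _ _ iha ihb => convert add_mem iha ihb using 1; funext x; exact map_add _ _ _
  | mul φ η hφ _ iha ihb =>
    convert add_mem (mul_mem iha ‹η ∈ _›) (mul_mem (involute_generated hφ) ihb) using 1
    funext x; exact contract_mul _ _ _

/-- The vertical lift `a^↑` of a section `a` of `A`: the vector field of degree `-1` on `A[1]`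
contracting with `a`. -/
def vert (a : Sec E F A) : VF E F A (-1) :=
  ⟨{ toFun := fun φ => ⟨fun x => contract (a x) (φ.at x), fun x₀ => by
        obtain ⟨η, hη, e⟩ := φ.2 x₀
        exact ⟨_, contract_generated a hη, by filter_upwards [e] with x h; rw [Fn.at, h]⟩⟩
     map_add' := fun φ η => Fn.ext fun x => map_add (contract (a x)) _ _
     map_smul' := fun r φ => Fn.ext fun x => map_smul (contract (a x)) _ _ },
    fun m φ hφ => by
      intro x
      exact contract_mem _ (hφ x), fun m φ hφ η => by
      refine Fn.ext fun x => ?_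
      exact contract_mul_of_grd _ (hφ x) _⟩

variable [IsManifold 𝓘(ℝ, E) ∞ M]

/-- The vector field `X` of degree `0` on `A[1]` has symbol `Y`: it acts on functions on `M` as the
vector field `Y`. -/
def HasSymbol (X : Module.End ℝ (Fn E F A)) (Y : Sec E E (TM E M)) : Prop :=
  ∀ (f : Smooth E M) (x : M),
    (X (Fn.ofSmooth F A f)).at x = algebraMap ℝ _ (dirDeriv f x (Y x))

/-- `V = U^↑` is the `(1,1)` tensor of internal degree `-1` on `A[1]` defined by the bundle map
`U : TM → A`: `V(X) = U(Y)^↑` whenever `X` is a vector field of degree `0` with symbol `Y`. -/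
def IsCoreLift (U : BundleMap E E (TM E M) F A) (V : Tensor E F A (-1)) : Prop :=
  ∀ (X : VF E F A 0) (Y : Sec E E (TM E M)), HasSymbol X.1 Y →
    (V.toFun 0 X).1 = (vert (U.onSec Y)).1

/-- `T` is the `(1,1)` tensor of internal degree `0` on `A[1]` determined by the triple
`(D, ℓ, N)`: it acts on `M` as `N`, and `T a^↑ = ℓ(a)^↑`, `L_{a^↑} T = D(a)^↑` for all sections `a`
of `A`. -/
def HasTriple (D : Sec E F A → Sec E E (TM E M) → Sec E F A) (ℓ : BundleMap E F A F A)
    (N : BundleMap E E (TM E M) E (TM E M)) (T : Tensor E F A 0) : Prop :=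
  (∀ (X : VF E F A 0) (Y : Sec E E (TM E M)), HasSymbol X.1 Y →
    HasSymbol (T.toFun 0 X).1 (N.onSec Y)) ∧
  (∀ a, (T.toFun (-1) (vert a)).1 = (vert (ℓ.onSec a)).1) ∧
  ∀ a (X : VF E F A 0) (Y : Sec E E (TM E M)), HasSymbol X.1 Y →
    ((fnVec (vert a) T).toFun 0 X).1 = (vert (D a Y)).1

end Shifted

section Tangent

variable {E : Type*} [NormedAddCommGroup E] [NormedSpace ℝ E] [FiniteDimensional ℝ E]
  {M : Type*} [TopologicalSpace M] [ChartedSpace E M] [IsManifold 𝓘(ℝ, E) ∞ M]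

/-- `T` is the shifted tangent lift on `T[1]M` of the `(1,1)` tensor `N` on `M`: the `(1,1)` tensor
of internal degree `0` with triple `(L_(-) N, N, N)`, where `(L_Z N)(Y) = [Z, N Y] - N [Z, Y]`. -/
def IsShiftedTangentLift (N : BundleMap E E (TM E M) E (TM E M)) (T : Tensor E E (TM E M) 0) :
    Prop :=
  HasTriple (fun Z Y => vfBracket Z (N.onSec Y) - N.onSec (vfBracket Z Y)) N N T

end Tangent

/-! ### Maps of shifted vector bundles -/

section Pullback

variable {E : Type*} [NormedAddCommGroup E] [NormedSpace ℝ E]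
  {M : Type*} [TopologicalSpace M] [ChartedSpace E M]
  {F : Type*} [NormedAddCommGroup F] [NormedSpace ℝ F]
  {A : M → Type*} [∀ x, AddCommGroup (A x)] [∀ x, Module ℝ (A x)]
  [∀ x, TopologicalSpace (A x)] [TopologicalSpace (Bundle.TotalSpace F A)]
  [FiberBundle F A]
  {F' : Type*} [NormedAddCommGroup F'] [NormedSpace ℝ F']
  {B : M → Type*} [∀ x, AddCommGroup (B x)] [∀ x, Module ℝ (B x)]
  [∀ x, TopologicalSpace (B x)] [TopologicalSpace (Bundle.TotalSpace F' B)]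
  [FiberBundle F' B]

theorem map_generated (U : BundleMap E F A F' B)
    {η : ∀ x, ExteriorAlgebra ℝ (Module.Dual ℝ (B x))} (h : η ∈ generated E F' B) :
    (fun x => ExteriorAlgebra.map (U.toFun x).dualMap (η x)) ∈ generated E F A := by
  induction h using Algebra.adjoin_induction with
  | mem φ hφ =>
    rcases hφ with ⟨f, rfl⟩ | ⟨ξ, rfl⟩
    · refine Algebra.subset_adjoin (Or.inl ⟨f, ?_⟩)
      funext x; exact AlgHom.commutes _ _
    · refine Algebra.subset_adjoin (Or.inr ⟨⟨fun x => (U.toFun x).dualMap (ξ.toFun x),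
        fun s => ξ.smooth' (U.onSec s)⟩, ?_⟩)
      funext x; exact ExteriorAlgebra.map_apply_ι _ _
  | algebraMap r =>
    convert Subalgebra.algebraMap_mem (generated E F A) r using 1
    funext x; exact AlgHom.commutes _ _
  | add a b _ _ iha ihb => convert add_mem iha ihb using 1; funext x; exact map_add _ _ _
  | mul a b _ _ iha ihb => convert mul_mem iha ihb using 1; funext x; exact map_mul _ _ _

/-- The pull-back of functions `C^∞(B[1]) → C^∞(A[1])` along the map of graded manifolds
`A[1] → B[1]` induced by the bundle map `U : A → B`. -/
def pullback (U : BundleMap E F A F' B) (φ : Fn E F' B) : Fn E F A :=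
  ⟨fun x => ExteriorAlgebra.map (U.toFun x).dualMap (φ.at x), fun x₀ => by
    obtain ⟨η, hη, e⟩ := φ.2 x₀
    exact ⟨_, map_generated U hη, by filter_upwards [e] with x h; rw [Fn.at, h]⟩⟩

/-- The vector fields `X` on `A[1]` and `X'` on `B[1]` are `U`-related. -/
def VFRelated (U : BundleMap E F A F' B) (X : Module.End ℝ (Fn E F A))
    (X' : Module.End ℝ (Fn E F' B)) : Prop :=
  ∀ φ, X (pullback U φ) = pullback U (X' φ)

/-- The `(1,1)` tensors `T` on `A[1]` and `T'` on `B[1]` are `U`-related. If `U` is an isomorphism,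
this says that the diffeomorphism `A[1] → B[1]` induced by `U` identifies `T` with `T'`. -/
def TensorRelated (U : BundleMap E F A F' B) {p p' : ℤ} (T : Tensor E F A p)
    (T' : Tensor E F' B p') : Prop :=
  ∀ k (X : VF E F A k) (X' : VF E F' B k), VFRelated U X.1 X'.1 →
    VFRelated U (T.toFun k X).1 (T'.toFun k X').1

end Pullback

/-! ### The Lie algebroid de Rham differential -/

section DeRham

variable {E : Type*} [NormedAddCommGroup E] [NormedSpace ℝ E]
  {M : Type*} [TopologicalSpace M] [ChartedSpace E M] [IsManifold 𝓘(ℝ, E) ∞ M]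
  {F : Type*} [NormedAddCommGroup F] [NormedSpace ℝ F]
  {A : M → Type*} [∀ x, AddCommGroup (A x)] [∀ x, Module ℝ (A x)]
  [∀ x, TopologicalSpace (A x)] [TopologicalSpace (Bundle.TotalSpace F A)]
  [FiberBundle F A] [VectorBundle ℝ F A]

/-- `Q` is the Lie algebroid de Rham differential: the derivation of degree `1` with
`(Q f)(a) = ρ(a) f` and `(Q ξ)(a, b) = ρ(a) (ξ b) - ρ(b) (ξ a) - ξ [a, b]`. -/
def IsDeRham (L : LieAlgebroid E F A) (Q : VF E F A 1) : Prop :=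
  (∀ (f : Smooth E M) (a : Sec E F A) (x : M),
    contract (a x) ((Q.1 (Fn.ofSmooth F A f)).at x) =
      algebraMap ℝ _ (dirDeriv f x (L.anchor.toFun x (a x)))) ∧
  ∀ (ξ : CoSec E F A) (a b : Sec E F A) (x : M),
    contract (b x) (contract (a x) ((Q.1 (Fn.ofCoSec ξ)).at x)) =
      algebraMap ℝ _ (dirDeriv (fun y => ξ.toFun y (b y)) x (L.anchor.toFun x (a x))
        - dirDeriv (fun y => ξ.toFun y (a y)) x (L.anchor.toFun x (b x))
        - ξ.toFun x (L.bracket a b x))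

open Classical in
/-- The Lie algebroid de Rham differential `d_A`: the unique vector field of degree `1` on `A[1]`
given on generators by the Koszul formula. -/
def deRham (L : LieAlgebroid E F A) : VF E F A 1 :=
  if h : ∃ Q, IsDeRham L Q then h.choose else 0

end DeRham

end ShiftedBundle

end

open ShiftedBundle

/-!
A vector field on `A[1]` has degree at least `-1`. Those of degree `-1` are the vertical lifts
`a^↑` of sections of `A` (`exists_vert`), those of degree `0` have a vector field on `M` as symbol
(`exists_symbol`), every vector field on `M` occurs (`exists_lift`), and the vector fields of
degrees `0` and `-1` locally generate all of them over the functions (`vf_induction`). That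
derivations have symbols at all rests on Hadamard's lemma (`derivation_eq_zero`).

Hence a tensor `V` of internal degree `-1` kills vertical vector fields, for degree reasons, and is
`U^↑` for a unique bundle map `U : TM → A` (`exists_isCoreLift`, `IsCoreLift.unique`). In all
degrees it is given by the formula `IsLift`, which shows that `ker V = im V` if and only if `U` is
an isomorphism (`IsLift.isIso`, `IsLift.isAlmostTangent`). Any tensor of odd internal degree
satisfies `[V, V] = 0`: the terms of the Frölicher-Nijenhuis bracket cancel in pairs
(`fnCommute_self`).

The differential `d_A` exists (`isDeRham_deRham`) and satisfies Cartan's formulas: `[d_A, a^↑]` has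
symbol `ρ(a)` and `[[d_A, a^↑], b^↑] = [a, b]^↑`. From these, `T = [d_A, U^↑]` acts on `C^∞(M)` as
`ρ ∘ U` on symbols, takes `a^↑` to `(U ρ(a))^↑`, and satisfies
`[a^↑, T X] - T [a^↑, X] = ([a, U Y] - U [ρ(a), Y])^↑` for `X` with symbol `Y`
(`IsDeRhamBracket.hasTriple`). The bracket `[T, V]` is linear over the functions in each argument
and has degree `-1`, so only its values on two vector fields of degree `0` matter. If these have
symbols `z` and `w`, the value is `2 ([U z, U w] - U [z, w]_N)^↑` with `N = ρ ∘ U`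
(`IsDeRhamBracket.fnTensor_zero`). Hence `[[d_A, V], V] = 0` if and only
if `U` intertwines `[-, -]_N` with the bracket of `A` (`IsDeRhamBracket.fnCommute_iff`). As `ρ`
respects brackets, `N` is then a Nijenhuis operator (`isNijenhuis_of_bracket`), so `U` is an
isomorphism `(TM)_N → A`. Conversely, for an isomorphism `U : (TM)_N → A` one has `N = ρ ∘ U`, and
`V = U^↑` is as required.

Finally, the formulas for `[d_A, U^↑]`, applied to the Lie algebroid `(TM)_N` and to the identity
of `TM`, show that `[d_N, id^↑]` is the shifted tangent lift of `N`. The isomorphism `U` takes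
`d_N` to `d_A` (`vfRelated_deRham`) and `id^↑` to `U^↑` (`tensorRelated_of_isLift`), and so the
tangent lift to `[d_A, V]` (`exists_isShiftedTangentLift`).
-/

noncomputable section

namespace ShiftedBundle

set_option linter.unusedSectionVars false

/-! ### Cut-off functions and directional derivatives -/

section Base

variable {E : Type*} [NormedAddCommGroup E] [NormedSpace ℝ E] [FiniteDimensional ℝ E]
  {M : Type*} [TopologicalSpace M] [ChartedSpace E M] [IsManifold 𝓘(ℝ, E) ∞ M] [T2Space M]

/-- Cut-off functions: those equal to `1` near `x₀` reduce local statements to global ones. -/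
theorem exists_bump {x₀ : M} {U : Set M} (hU : U ∈ 𝓝 x₀) :
    ∃ χ : Smooth E M, (∀ᶠ x in 𝓝 x₀, χ x = 1) ∧ tsupport χ ⊆ U := by
  obtain ⟨χ, -, h⟩ := (SmoothBumpFunction.nhds_basis_tsupport (I := 𝓘(ℝ, E)) x₀).mem_iff.1 hU
  exact ⟨⟨χ, χ.contMDiff⟩, χ.eventuallyEq_one, h⟩

theorem exists_extend {x₀ : M} {U : Set M} (hU : U ∈ 𝓝 x₀) {g : M → ℝ}
    (hg : ContMDiffOn 𝓘(ℝ, E) 𝓘(ℝ, ℝ) ∞ g U) :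
    ∃ f : Smooth E M, ∀ᶠ x in 𝓝 x₀, f x = g x := by
  obtain ⟨W, hWU, hW, hxW⟩ := mem_nhds_iff.1 hU
  obtain ⟨χ, h1, hs⟩ := exists_bump (E := E) (hW.mem_nhds hxW)
  refine ⟨⟨fun x => χ x * g x, ?_⟩, ?_⟩
  · refine contMDiff_of_tsupport fun x hx => ?_
    have hx' : x ∈ W := hs (tsupport_mul_subset_left hx)
    exact χ.contMDiff.contMDiffAt.mul ((hg.mono hWU).contMDiffAt (hW.mem_nhds hx'))
  · filter_upwards [h1] with x hx
    simp [hx]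

section DirDeriv

variable {x : M} (v : TM E M x)

omit [FiniteDimensional ℝ E] [IsManifold 𝓘(ℝ, E) ∞ M] [T2Space M]

theorem Smooth.mdiffAt (f : Smooth E M) (x : M) : MDifferentiableAt 𝓘(ℝ, E) 𝓘(ℝ, ℝ) f x :=
  f.contMDiff.contMDiffAt.mdifferentiableAt (by simp)

theorem dirDeriv_congr {f g : M → ℝ} (h : ∀ᶠ y in 𝓝 x, f y = g y) :
    dirDeriv f x v = dirDeriv g x v := by
  have := Filter.EventuallyEq.mfderiv_eq (I := 𝓘(ℝ, E)) (I' := 𝓘(ℝ, ℝ)) h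
  exact congrArg (fun L : E →L[ℝ] ℝ => L v) this

theorem dirDeriv_const (c : ℝ) : dirDeriv (fun _ : M => c) x v = 0 := by
  have := mfderiv_const (I := 𝓘(ℝ, E)) (I' := 𝓘(ℝ, ℝ)) (c := c) (x := x)
  exact congrArg (fun L : E →L[ℝ] ℝ => L v) this

variable {f g : M → ℝ} (hf : MDifferentiableAt 𝓘(ℝ, E) 𝓘(ℝ, ℝ) f x)
  (hg : MDifferentiableAt 𝓘(ℝ, E) 𝓘(ℝ, ℝ) g x)
include hf

theorem dirDeriv_const_mul (c : ℝ) : dirDeriv (fun y => c * f y) x v = c * dirDeriv f x v := by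
  have := const_smul_mfderiv hf c
  exact congrArg (fun L : E →L[ℝ] ℝ => L v) this

include hg

theorem dirDeriv_add : dirDeriv (fun y => f y + g y) x v = dirDeriv f x v + dirDeriv g x v := by
  have := mfderiv_add hf hg
  exact congrArg (fun L : E →L[ℝ] ℝ => L v) this

theorem dirDeriv_sub : dirDeriv (fun y => f y - g y) x v = dirDeriv f x v - dirDeriv g x v := by
  have := mfderiv_sub hf hg
  exact congrArg (fun L : E →L[ℝ] ℝ => L v) this

theorem dirDeriv_mul : dirDeriv (fun y => f y * g y) x v =
    f x * dirDeriv g x v + g x * dirDeriv f x v := by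
  have := (hf.hasMFDerivAt.mul hg.hasMFDerivAt).mfderiv
  exact congrArg (fun L : E →L[ℝ] ℝ => L v) this

omit hf hg

theorem mdiffAt_sum {ι : Type*} (s : Finset ι) {f : ι → M → ℝ}
    (hf : ∀ i ∈ s, MDifferentiableAt 𝓘(ℝ, E) 𝓘(ℝ, ℝ) (f i) x) :
    MDifferentiableAt 𝓘(ℝ, E) 𝓘(ℝ, ℝ) (fun y => ∑ i ∈ s, f i y) x := by
  classical
  induction s using Finset.induction_on with
  | empty => simpa using mdifferentiableAt_const
  | insert a s ha ih =>
    simp only [Finset.sum_insert ha]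
    exact (hf a (by simp)).add (ih fun i hi => hf i (Finset.mem_insert_of_mem hi))

theorem dirDeriv_sum {ι : Type*} (s : Finset ι) {f : ι → M → ℝ}
    (hf : ∀ i ∈ s, MDifferentiableAt 𝓘(ℝ, E) 𝓘(ℝ, ℝ) (f i) x) :
    dirDeriv (fun y => ∑ i ∈ s, f i y) x v = ∑ i ∈ s, dirDeriv (f i) x v := by
  classical
  induction s using Finset.induction_on with
  | empty => simpa using dirDeriv_const v 0
  | insert a s ha ih =>
    have hs : ∀ i ∈ s, MDifferentiableAt 𝓘(ℝ, E) 𝓘(ℝ, ℝ) (f i) x :=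
      fun i hi => hf i (Finset.mem_insert_of_mem hi)
    simp only [Finset.sum_insert ha]
    rw [dirDeriv_add v (hf a (by simp)) (mdiffAt_sum s hs), ih hs]

theorem dirDeriv_vadd (f : M → ℝ) (w : TM E M x) :
    dirDeriv f x (v + w) = dirDeriv f x v + dirDeriv f x w :=
  map_add (mfderiv 𝓘(ℝ, E) 𝓘(ℝ, ℝ) f x) v w

theorem dirDeriv_vsmul (f : M → ℝ) (c : ℝ) : dirDeriv f x (c • v) = c * dirDeriv f x v :=
  map_smul (mfderiv 𝓘(ℝ, E) 𝓘(ℝ, ℝ) f x) c v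

/-- The differential of a function at a point, as a linear form on the tangent space. -/
def dform (f : M → ℝ) (x : M) : Module.Dual ℝ (TM E M x) :=
  { toFun := fun v => dirDeriv f x v
    map_add' := fun v w => dirDeriv_vadd v f w
    map_smul' := fun c v => dirDeriv_vsmul v f c }

end DirDeriv

/-- The derivative `Y f` of a smooth function along a vector field. -/
def lieD (Y : Sec E E (TM E M)) (f : Smooth E M) : Smooth E M :=
  ⟨fun x => dirDeriv f x (Y x), by
    have h1 := (f.contMDiff.contMDiff_tangentMap (m := ∞) (by simp)).comp Y.contMDiff
    exact (contMDiff_snd_tangentBundle_modelSpace ℝ 𝓘(ℝ, ℝ)).comp h1⟩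

theorem lieD_apply (Y : Sec E E (TM E M)) (f : Smooth E M) (x : M) :
    lieD Y f x = dirDeriv f x (Y x) := rfl

end Base

/-! ### Dual local frames of `A` and `A^*` -/

section Frames

variable {E : Type*} [NormedAddCommGroup E] [NormedSpace ℝ E] [FiniteDimensional ℝ E]
  {M : Type*} [TopologicalSpace M] [ChartedSpace E M] [IsManifold 𝓘(ℝ, E) ∞ M] [T2Space M]
  (F : Type*) [NormedAddCommGroup F] [NormedSpace ℝ F] [FiniteDimensional ℝ F]
  (A : M → Type*) [∀ x, AddCommGroup (A x)] [∀ x, Module ℝ (A x)]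
  [∀ x, TopologicalSpace (A x)] [TopologicalSpace (Bundle.TotalSpace F A)]
  [FiberBundle F A] [VectorBundle ℝ F A]

variable (E) in
/-- Global sections `e i` of `A` and `ε i` of `A^*` which form dual frames over an open
neighbourhood `O` of `x₀`. -/
structure Frame (x₀ : M) where
  /-- the open set over which the sections form dual frames -/
  O : Set M
  isOpen : IsOpen O
  mem : x₀ ∈ O
  /-- the sections of `A` -/
  e : Fin (Module.finrank ℝ F) → Sec E F A
  /-- the sections of `A^*` -/
  ε : Fin (Module.finrank ℝ F) → CoSec E F A
  dual : ∀ x ∈ O, ∀ i j, (ε i).toFun x (e j x) = if i = j then 1 else 0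
  sum : ∀ x ∈ O, ∀ v : A x, ∑ i, (ε i).toFun x v • e i x = v

variable [ContMDiffVectorBundle ∞ F A 𝓘(ℝ, E)]

variable {F A} in
theorem exists_extend_section {x₀ : M} {U : Set M} (hU : U ∈ 𝓝 x₀) {s : ∀ x, A x}
    (hs : ContMDiffOn 𝓘(ℝ, E) (𝓘(ℝ, E).prod 𝓘(ℝ, F)) ∞
      (fun x => Bundle.TotalSpace.mk' F x (s x)) U) :
    ∃ t : Sec E F A, ∀ᶠ x in 𝓝 x₀, t x = s x := by
  obtain ⟨W, hWU, hW, hxW⟩ := mem_nhds_iff.1 hU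
  obtain ⟨χ, h1, hsupp⟩ := exists_bump (E := E) (hW.mem_nhds hxW)
  refine ⟨⟨fun x => χ x • s x, ContMDiffOn.smul_section_of_tsupport χ.contMDiff.contMDiffOn hW
    hsupp (hs.mono hWU)⟩, ?_⟩
  filter_upwards [h1] with x hx
  change χ x • s x = s x
  simp [hx]

variable (E) in
theorem exists_frame (x₀ : M) : Nonempty (Frame E F A x₀) := by
  have : ContMDiffVectorBundle 1 F A 𝓘(ℝ, E) := ContMDiffVectorBundle.of_le (n := ∞) (by simp)
  set t := trivializationAt F A x₀
  have hx₀ : x₀ ∈ t.baseSet := FiberBundle.mem_baseSet_trivializationAt F A x₀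
  set b := Module.finBasis ℝ F
  have hn : t.baseSet ∈ 𝓝 x₀ := t.open_baseSet.mem_nhds hx₀
  choose e he using fun i => exists_extend_section hn
    (t.contMDiffOn_localFrame_baseSet (I := 𝓘(ℝ, E)) ∞ b i)
  obtain ⟨χ, h1, hsupp⟩ := exists_bump (E := E) hn
  let ε : Fin (Module.finrank ℝ F) → CoSec E F A := fun i =>
    ⟨fun x => χ x • t.localFrameCoeff 𝓘(ℝ, E) b i x, fun s => by
      refine contMDiff_of_tsupport fun x hx => ?_
      have hx' : x ∈ t.baseSet := hsupp (tsupport_mul_subset_left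
        (f := χ) (g := fun x => t.localFrameCoeff 𝓘(ℝ, E) b i x (s x)) hx)
      exact χ.contMDiff.contMDiffAt.mul
        (contMDiffAt_localFrameCoeff b hx' s.contMDiff.contMDiffAt i)⟩
  have hev : ∀ᶠ x in 𝓝 x₀, x ∈ t.baseSet ∧ χ x = 1 ∧ ∀ i, e i x = t.localFrame b i x :=
    (Filter.eventually_of_mem hn fun _ h => h).and (h1.and (Filter.eventually_all.2 he))
  obtain ⟨O, hO, hOo, hxO⟩ := eventually_nhds_iff.1 hev
  refine ⟨⟨O, hOo, hxO, e, ε, ?_, ?_⟩⟩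
  · intro x hx i j
    obtain ⟨h1, h2, h3⟩ := hO x hx
    change χ x • t.localFrameCoeff 𝓘(ℝ, E) b i x (e j x) = _
    rw [h2, one_smul, h3, t.localFrameCoeff_apply_of_mem_baseSet b h1 (t.localFrame b j) i,
      t.localFrame_apply_of_mem_baseSet b h1, Module.Basis.repr_self, Finsupp.single_apply]
    simp [eq_comm]
  · intro x hx v
    obtain ⟨h1, h2, h3⟩ := hO x hx
    change ∑ i, (χ x • t.localFrameCoeff 𝓘(ℝ, E) b i x v) • e i x = v
    classical
    have hv := t.localFrameCoeff_apply_of_mem_baseSet (I := 𝓘(ℝ, E)) b h1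
      (Function.update (0 : ∀ y, A y) x v)
    simp only [Function.update_self] at hv
    simp_rw [h2, one_smul, h3, t.localFrame_apply_of_mem_baseSet b h1, hv]
    exact (t.basisAt b h1).sum_repr v

end Frames

/-! ### Local coordinates on `M` -/

section Coords

variable {E : Type*} [NormedAddCommGroup E] [NormedSpace ℝ E] [FiniteDimensional ℝ E]
  {M : Type*} [TopologicalSpace M] [ChartedSpace E M] [IsManifold 𝓘(ℝ, E) ∞ M] [T2Space M]

variable (E) in
/-- Smooth functions `q i` and vector fields `D i` on `M` such that the `q i` are coordinates over
an open neighbourhood `O` of `x₀`, with coordinate fields `D i`. -/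
structure Coords (x₀ : M) where
  /-- the coordinate domain -/
  O : Set M
  isOpen : IsOpen O
  mem : x₀ ∈ O
  /-- the coordinates -/
  q : Fin (Module.finrank ℝ E) → Smooth E M
  /-- the coordinate fields -/
  D : Fin (Module.finrank ℝ E) → Sec E E (TM E M)
  dual : ∀ x ∈ O, ∀ i j, dirDeriv (q i) x (D j x) = if i = j then 1 else 0
  sum : ∀ x ∈ O, ∀ v : TM E M x, ∑ i, dirDeriv (q i) x v • D i x = v

variable (E) in
theorem exists_coords (x₀ : M) : Nonempty (Coords E x₀) := by
  set t := trivializationAt E (TM E M) x₀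
  have hx₀ : x₀ ∈ t.baseSet := FiberBundle.mem_baseSet_trivializationAt E (TM E M) x₀
  set b := Module.finBasis ℝ E
  have hn : t.baseSet ∈ 𝓝 x₀ := t.open_baseSet.mem_nhds hx₀
  choose e he using fun i => exists_extend_section hn
    (t.contMDiffOn_localFrame_baseSet (I := 𝓘(ℝ, E)) ∞ b i)
  have hq : ∀ i, ∃ q : Smooth E M, ∀ᶠ x in 𝓝 x₀, q x = b.coord i (extChartAt 𝓘(ℝ, E) x₀ x) := by
    intro i
    refine exists_extend ((isOpen_extChartAt_source (I := 𝓘(ℝ, E)) x₀).mem_nhds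
      (mem_extChartAt_source x₀)) ?_
    have h1 : ContMDiffOn 𝓘(ℝ, E) 𝓘(ℝ, E) ∞ (extChartAt 𝓘(ℝ, E) x₀)
      (extChartAt 𝓘(ℝ, E) x₀).source := by
      rw [extChartAt_source]; exact contMDiffOn_extChartAt
    exact (LinearMap.toContinuousLinearMap (b.coord i)).contMDiff.comp_contMDiffOn h1
  choose q hq using hq
  have hev : ∀ᶠ x in 𝓝 x₀, x ∈ t.baseSet ∧ (∀ i, e i x = t.localFrame b i x) ∧
      ∀ i, ∀ v : TM E M x, dirDeriv (q i) x v = b.coord i (t.continuousLinearMapAt ℝ x v) := by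
    refine (Filter.eventually_of_mem hn fun _ h => h).and ((Filter.eventually_all.2 he).and
      (Filter.eventually_all.2 fun i => ?_))
    filter_upwards [(hq i).eventually_nhds, (isOpen_extChartAt_source (I := 𝓘(ℝ, E)) x₀).mem_nhds
      (mem_extChartAt_source x₀)] with x hx hxs v
    rw [extChartAt_source] at hxs
    rw [dirDeriv_congr v hx, TangentBundle.continuousLinearMapAt_trivializationAt hxs]
    have h1 : MDifferentiableAt 𝓘(ℝ, E) 𝓘(ℝ, E) (extChartAt 𝓘(ℝ, E) x₀) x :=
      mdifferentiableAt_extChartAt hxs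
    have h2 := ((LinearMap.toContinuousLinearMap (b.coord i)).hasMFDerivAt.comp x
      h1.hasMFDerivAt).mfderiv
    exact congrArg (fun L : E →L[ℝ] ℝ => L v) h2
  obtain ⟨O, hO, hOo, hxO⟩ := eventually_nhds_iff.1 hev
  have key : ∀ x (h1 : x ∈ t.baseSet) (v : TM E M x) i,
      b.coord i (t.continuousLinearMapAt ℝ x v) = (t.basisAt b h1).repr v i := by
    intro x h1 v i
    simp [Bundle.Trivialization.basisAt, h1]
  refine ⟨⟨O, hOo, hxO, q, e, ?_, ?_⟩⟩
  · intro x hx i j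
    obtain ⟨h1, h2, h3⟩ := hO x hx
    rw [h3, h2, t.localFrame_apply_of_mem_baseSet b h1, key x h1, Module.Basis.repr_self,
      Finsupp.single_apply]
    simp [eq_comm]
  · intro x hx v
    obtain ⟨h1, h2, h3⟩ := hO x hx
    simp_rw [h3, h2, key x h1, t.localFrame_apply_of_mem_baseSet b h1]
    exact (t.basisAt b h1).sum_repr v

end Coords

/-! ### Hadamard's lemma -/

section Hadamard

open MeasureTheory intervalIntegral

/-- Each differentiation of a radial integral `∫₀¹ t^k f(t y) dt` in `y` raises `k` by one and
replaces `f` by its derivative. -/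
theorem hasFDerivAt_radial_integral {E : Type*} [NormedAddCommGroup E] [NormedSpace ℝ E]
    [FiniteDimensional ℝ E] {G : Type*} [NormedAddCommGroup G] [NormedSpace ℝ G] [CompleteSpace G]
    {f : E → G} (hf : ContDiff ℝ 1 f) (k : ℕ) (y : E) :
    HasFDerivAt (fun y => ∫ t in (0 : ℝ)..1, t ^ k • f (t • y))
      (∫ t in (0 : ℝ)..1, t ^ (k + 1) • fderiv ℝ f (t • y)) y := by
  have hd : Continuous (fderiv ℝ f) := hf.continuous_fderiv (by simp)
  have hc : ∀ z, Continuous fun t : ℝ => t ^ k • f (t • z) := fun z => by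
    have := hf.continuous; fun_prop
  have hc' : Continuous fun p : ℝ × E => p.1 ^ (k + 1) • fderiv ℝ f (p.1 • p.2) := by fun_prop
  obtain ⟨C, hC⟩ := ((isCompact_Icc (a := (0 : ℝ)) (b := 1)).prod
    (isCompact_closedBall y 1)).exists_bound_of_continuousOn hc'.continuousOn
  refine hasFDerivAt_integral_of_dominated_of_fderiv_le (𝕜 := ℝ) (bound := fun _ => C)
    (F' := fun z t => t ^ (k + 1) • fderiv ℝ f (t • z))
    (Metric.closedBall_mem_nhds y one_pos)
    (Filter.Eventually.of_forall fun z => (hc z).aestronglyMeasurable)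
    ((hc y).intervalIntegrable _ _) ?_ ?_ intervalIntegrable_const ?_
  · exact (hc'.comp (by fun_prop : Continuous fun t : ℝ => (t, y))).aestronglyMeasurable
  · refine Filter.Eventually.of_forall fun t ht z hz => hC (t, z) ⟨?_, hz⟩
    rw [Set.uIoc_of_le zero_le_one] at ht
    exact ⟨ht.1.le, ht.2⟩
  · refine Filter.Eventually.of_forall fun t _ z _ => ?_
    have h1 : HasFDerivAt f (fderiv ℝ f (t • z)) (t • z) :=
      (hf.differentiable (by simp) _).hasFDerivAt
    have h2 : HasFDerivAt (fun z : E => t • z) (t • ContinuousLinearMap.id ℝ E) z :=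
      (hasFDerivAt_id z).const_smul t
    convert! (h1.comp z h2).const_smul (t ^ k) using 1
    ext v
    simp [pow_succ, smul_smul]

/-- By induction on the order of differentiability, for all `k` and all targets at once: the
derivative is a radial integral of the derivative of `f`. All spaces are in one universe since the
target becomes `E →L[ℝ] G` in the induction step. -/
theorem contDiff_radial_integral.{u} {E : Type u} [NormedAddCommGroup E] [NormedSpace ℝ E]
    [FiniteDimensional ℝ E] (n : ℕ) : ∀ {G : Type u} [NormedAddCommGroup G] [NormedSpace ℝ G]
    [FiniteDimensional ℝ G] {f : E → G} (_ : ContDiff ℝ ∞ f) (k : ℕ),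
    ContDiff ℝ n (fun y => ∫ t in (0 : ℝ)..1, t ^ k • f (t • y)) := by
  induction n with
  | zero =>
    intro G _ _ _ f hf k
    have : CompleteSpace G := FiniteDimensional.complete ℝ G
    exact contDiff_zero.2 (continuous_iff_continuousAt.2 fun y =>
      (hasFDerivAt_radial_integral (hf.of_le (by exact_mod_cast le_top)) k y).continuousAt)
  | succ n ih =>
    intro G _ _ _ f hf k
    have : CompleteSpace G := FiniteDimensional.complete ℝ G
    have hd := hasFDerivAt_radial_integral (hf.of_le (by exact_mod_cast le_top)) k
    push_cast
    rw [contDiff_succ_iff_fderiv]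
    refine ⟨fun y => (hd y).differentiableAt, fun h => absurd h (WithTop.natCast_ne_top n), ?_⟩
    rw [funext fun y => (hd y).fderiv]
    exact ih (hf.fderiv_right (m := ∞) (by simp)) (k + 1)

/-- Hadamard's lemma: `f y - f 0` is the integral over `[0, 1]` of `t ↦ (d f)(t y) y`. -/
theorem hadamard {E : Type*} [NormedAddCommGroup E] [NormedSpace ℝ E] [FiniteDimensional ℝ E]
    {f : E → ℝ} (hf : ContDiff ℝ ∞ f) :
    ∃ g : E → E →L[ℝ] ℝ, ContDiff ℝ ∞ g ∧ g 0 = fderiv ℝ f 0 ∧ ∀ y, f y = f 0 + g y y := by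
  have hf' : ContDiff ℝ ∞ (fderiv ℝ f) := hf.fderiv_right (by simp)
  refine ⟨fun y => ∫ t in (0 : ℝ)..1, t ^ 0 • fderiv ℝ f (t • y), ?_, ?_, fun y => ?_⟩
  · exact contDiff_infty.2 fun n => contDiff_radial_integral n hf' 0
  · simp
  · have hd : ∀ t : ℝ, HasDerivAt (fun t : ℝ => f (t • y)) (fderiv ℝ f (t • y) y) t := fun t => by
      have h1 : HasFDerivAt f (fderiv ℝ f (t • y)) (t • y) :=
        (hf.differentiable (by simp) _).hasFDerivAt
      have h2 : HasDerivAt (fun t : ℝ => t • y) y t := by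
        simpa using (hasDerivAt_id t).smul_const y
      exact h1.comp_hasDerivAt t h2
    have hcont : Continuous fun t : ℝ => fderiv ℝ f (t • y) := by
      have := hf'.continuous; fun_prop
    have h3 := integral_eq_sub_of_hasDerivAt (a := 0) (b := 1) (fun t _ => hd t)
      ((hcont.clm_apply continuous_const).intervalIntegrable _ _)
    rw [← ContinuousLinearMap.intervalIntegral_apply (hcont.intervalIntegrable _ _)] at h3
    simp only [pow_zero, one_smul]
    rw [h3]
    simp

end Hadamard

/-! ### Derivations of `C^∞(M)` at a point -/

section Derivation

variable {E : Type*} [NormedAddCommGroup E] [NormedSpace ℝ E] [FiniteDimensional ℝ E]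
  {M : Type*} [TopologicalSpace M] [ChartedSpace E M] [IsManifold 𝓘(ℝ, E) ∞ M] [T2Space M]

/-- A smooth function whose differential vanishes at `x` is killed by every derivation at `x`: by
Hadamard's lemma it is, near `x`, a constant plus a sum of products of functions vanishing at `x`.
-/
theorem derivation_eq_zero {x : M} {W : Type*} [AddCommGroup W] [Module ℝ W]
    (D : Smooth E M →ₗ[ℝ] W) (hD : ∀ f g, D (f * g) = f x • D g + g x • D f) {f : Smooth E M}
    (hf : ∀ v : TM E M x, dirDeriv f x v = 0) : D f = 0 := by
  -- constants are killed
  have hone : D 1 = 0 := by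
    have := hD 1 1
    have h1 : (1 : Smooth E M) x = 1 := rfl
    simpa [h1] using this
  have hzero : ∀ f g : Smooth E M, f x = 0 → g x = 0 → D (f * g) = 0 := fun f g h1 h2 => by
    simp [hD, h1, h2]
  have hconst : ∀ c : ℝ, D (algebraMap ℝ _ c) = 0 := fun c => by
    rw [Algebra.algebraMap_eq_smul_one, map_smul, hone, smul_zero]
  -- a derivation at `x` only depends on germs at `x`
  have hloc : ∀ f g : Smooth E M, (∀ᶠ z in 𝓝 x, f z = g z) → D f = D g := fun f g h => by
    obtain ⟨χ, h1, hsupp⟩ := exists_bump (E := E) h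
    have h2 : χ * (f - g) = 0 := by
      ext z
      change χ z * (f z - g z) = 0
      by_cases hz : z ∈ tsupport χ
      · have : f z = g z := hsupp hz
        simp [this]
      · simp [image_eq_zero_of_notMem_tsupport hz]
    have h3 := hD χ (f - g)
    have h4 : (f - g) x = 0 := sub_eq_zero.2 h.self_of_nhds
    rw [h2, h1.self_of_nhds, h4, map_zero, map_sub, one_smul, zero_smul, add_zero] at h3
    exact (sub_eq_zero.1 h3.symm)
  -- the function in a chart, extended to all of `E`
  set φ := extChartAt 𝓘(ℝ, E) x
  have hs : φ.source ∈ 𝓝 x := (isOpen_extChartAt_source (I := 𝓘(ℝ, E)) x).mem_nhds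
    (mem_extChartAt_source x)
  have ht : φ.target ∈ 𝓝 (φ x) := extChartAt_target_mem_nhds x
  have hφ : ContMDiffOn 𝓘(ℝ, E) 𝓘(ℝ, E) ∞ φ φ.source := by
    rw [extChartAt_source]; exact contMDiffOn_extChartAt
  have hφs : ContMDiffOn 𝓘(ℝ, E) 𝓘(ℝ, E) ∞ φ.symm φ.target := contMDiffOn_extChartAt_symm x
  obtain ⟨H, hH⟩ := exists_extend ht (f.contMDiff.comp_contMDiffOn hφs)
  have hH0 : fderiv ℝ H (φ x) = 0 := by
    have e1 : mfderiv 𝓘(ℝ, E) 𝓘(ℝ, ℝ) H (φ x) =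
        mfderiv 𝓘(ℝ, E) 𝓘(ℝ, ℝ) (f ∘ φ.symm) (φ x) := Filter.EventuallyEq.mfderiv_eq hH
    have hx : φ.symm (φ x) = x := extChartAt_to_inv x
    have e2 := mfderiv_comp (φ x) (I := 𝓘(ℝ, E)) (I' := 𝓘(ℝ, E)) (I'' := 𝓘(ℝ, ℝ))
      (g := f) (f := φ.symm) (f.mdiffAt _)
      ((hφs.contMDiffAt ht).mdifferentiableAt (by simp))
    rw [← mfderiv_eq_fderiv, e1, e2]
    ext v
    have e3 : ∀ w : E, mfderiv 𝓘(ℝ, E) 𝓘(ℝ, ℝ) f (φ.symm (φ x)) w = (0 : ℝ) := by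
      rw [hx]; exact hf
    exact e3 _
  have hHd : ContDiff ℝ ∞ fun y => H (y + φ x) :=
    H.contMDiff.contDiff.comp (contDiff_id.add contDiff_const)
  obtain ⟨g, hg, hg0, hgy⟩ := hadamard hHd
  have hg0' : g 0 = 0 := by
    rw [hg0, fderiv_comp_add_right, zero_add, hH0]
  set b := Module.finBasis ℝ E
  have hψ : ContMDiffOn 𝓘(ℝ, E) 𝓘(ℝ, E) ∞ (fun z => φ z - φ x) φ.source := hφ.sub contMDiffOn_const
  -- `f = f x + ∑ p i * q i` near `x`, where the `p i` are the coordinates of the chart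
  choose p hp using fun i => exists_extend hs (g := fun z => b.coord i (φ z - φ x))
    ((LinearMap.toContinuousLinearMap (b.coord i)).contMDiff.comp_contMDiffOn hψ)
  choose q hq using fun i => exists_extend hs (g := fun z => g (φ z - φ x) (b i))
    ((hg.clm_apply (contDiff_const (c := b i))).contMDiff.comp_contMDiffOn hψ)
  have hfe : ∀ᶠ z in 𝓝 x, f z = (algebraMap ℝ _ (f x) + ∑ i, p i * q i : Smooth E M) z := by
    filter_upwards [hs, Filter.eventually_all.2 hp, Filter.eventually_all.2 hq,
      (continuousAt_extChartAt x).eventually hH] with z hz h1 h2 h3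
    have e0 : ((algebraMap ℝ _ (f x) + ∑ i, p i * q i : Smooth E M)) z
        = f x + ∑ i, p i z * q i z := by
      rw [ContMDiffMap.coe_add, Pi.add_apply]
      congr 1
      exact (map_sum (ContMDiffMap.evalRingHom (n := ∞) (I := 𝓘(ℝ, E)) (I' := 𝓘(ℝ, ℝ)) z) _ _)
    have e1 := hgy (φ z - φ x)
    simp only [sub_add_cancel, zero_add] at e1
    rw [h3, hH.self_of_nhds] at e1
    simp only [Function.comp] at e1
    rw [φ.left_inv hz, extChartAt_to_inv] at e1
    rw [e0, e1]
    congr 1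
    simp_rw [h1, h2]
    have hL : ∀ (L : E →L[ℝ] ℝ) (w : E), L w = ∑ i, b.coord i w * L (b i) := fun L w => by
      conv_lhs => rw [← b.sum_repr w, map_sum]
      simp
    exact hL _ _
  rw [hloc _ _ hfe, map_add, hconst, zero_add, map_sum]
  refine Finset.sum_eq_zero fun i _ => hzero _ _ ?_ ?_
  · rw [(hp i).self_of_nhds]; simp
  · rw [(hq i).self_of_nhds]; simp [hg0']

end Derivation

/-! ### Functions on `A[1]` -/

section Functions

variable {E : Type*} [NormedAddCommGroup E] [NormedSpace ℝ E]
  {M : Type*} [TopologicalSpace M] [ChartedSpace E M]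
  {F : Type*} [NormedAddCommGroup F] [NormedSpace ℝ F]
  {A : M → Type*} [∀ x, AddCommGroup (A x)] [∀ x, Module ℝ (A x)]
  [∀ x, TopologicalSpace (A x)] [TopologicalSpace (Bundle.TotalSpace F A)]
  [FiberBundle F A]

theorem Fn.at_add (φ η : Fn E F A) (x : M) : (φ + η).at x = φ.at x + η.at x := rfl
theorem Fn.at_sub (φ η : Fn E F A) (x : M) : (φ - η).at x = φ.at x - η.at x := rfl
theorem Fn.at_mul (φ η : Fn E F A) (x : M) : (φ * η).at x = φ.at x * η.at x := rfl
theorem Fn.at_smul (r : ℝ) (φ : Fn E F A) (x : M) : (r • φ).at x = r • φ.at x := rfl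
theorem Fn.at_zero (x : M) : (0 : Fn E F A).at x = 0 := rfl
theorem Fn.at_one (x : M) : (1 : Fn E F A).at x = 1 := rfl

variable (E F A) in
/-- Evaluation of functions on `A[1]` at a point of `M`. -/
def Fn.evalAt (x : M) : Fn E F A →ₐ[ℝ] ExteriorAlgebra ℝ (Module.Dual ℝ (A x)) where
  toFun φ := φ.at x
  map_one' := rfl
  map_mul' _ _ := rfl
  map_zero' := rfl
  map_add' _ _ := rfl
  commutes' _ := rfl

theorem Fn.at_sum {ι : Type*} (s : Finset ι) (φ : ι → Fn E F A) (x : M) :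
    (∑ i ∈ s, φ i).at x = ∑ i ∈ s, (φ i).at x := map_sum (Fn.evalAt E F A x) _ _

theorem Fn.ofSmooth_at (f : Smooth E M) (x : M) :
    (Fn.ofSmooth F A f).at x = algebraMap ℝ _ (f x) := rfl

theorem Fn.ofSmooth_mul_at (f : Smooth E M) (φ : Fn E F A) (x : M) :
    (Fn.ofSmooth F A f * φ).at x = f x • φ.at x :=
  (Algebra.smul_def (f x) (φ.at x)).symm

theorem Fn.ofCoSec_at (ξ : CoSec E F A) (x : M) :
    (Fn.ofCoSec ξ).at x = ExteriorAlgebra.ι ℝ (ξ.toFun x) := rfl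

theorem algebraMap_mem_grd {W : Type*} [AddCommGroup W] [Module ℝ W] (r : ℝ) :
    algebraMap ℝ (ExteriorAlgebra ℝ W) r ∈ grd W 0 := by
  rw [← Nat.cast_zero, grd_natCast, ExteriorAlgebra.exteriorPower, pow_zero]
  exact Submodule.algebraMap_mem r

theorem ι_mem_grd {W : Type*} [AddCommGroup W] [Module ℝ W] (w : W) :
    ExteriorAlgebra.ι ℝ w ∈ grd W 1 := by
  rw [← Nat.cast_one, grd_natCast, ExteriorAlgebra.exteriorPower, pow_one]
  exact LinearMap.mem_range_self _ _

theorem eq_algebraMap_of_mem_grd_zero {W : Type*} [AddCommGroup W] [Module ℝ W]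
    {a : ExteriorAlgebra ℝ W} (h : a ∈ grd W 0) :
    a = algebraMap ℝ _ (ExteriorAlgebra.algebraMapInv a) := by
  rw [← Nat.cast_zero, grd_natCast, ExteriorAlgebra.exteriorPower, pow_zero] at h
  obtain ⟨r, rfl⟩ := Submodule.mem_one.1 h
  rw [ExteriorAlgebra.algebraMap_leftInverse]

theorem Fn.ofSmooth_mem (f : Smooth E M) : Fn.ofSmooth F A f ∈ FnDeg E F A 0 :=
  fun _ => algebraMap_mem_grd _

theorem Fn.ofCoSec_mem (ξ : CoSec E F A) : Fn.ofCoSec ξ ∈ FnDeg E F A 1 := fun _ => ι_mem_grd _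

theorem eq_zero_of_mem_FnDeg {j : ℤ} (hj : j < 0) {φ : Fn E F A} (h : φ ∈ FnDeg E F A j) :
    φ = 0 := Fn.ext fun x => by
  have := h x
  rwa [grd_neg hj, Submodule.mem_bot] at this

/-- The linear map `f ↦ f` from functions on `M` to functions on `A[1]`. -/
def Fn.ofSmoothₗ : Smooth E M →ₗ[ℝ] Fn E F A where
  toFun f := Fn.ofSmooth F A f
  map_add' f g := Fn.ext fun x => map_add (algebraMap ℝ _) _ _
  map_smul' r f := Fn.ext fun x => by
    rw [Fn.at_smul, Fn.ofSmooth_at, Fn.ofSmooth_at]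
    change algebraMap ℝ _ (r * f x) = _
    rw [map_mul, ← Algebra.smul_def]; rfl

theorem Fn.ofSmooth_mul (f g : Smooth E M) :
    Fn.ofSmooth F A (f * g) = Fn.ofSmooth F A f * Fn.ofSmooth F A g :=
  Fn.ext fun _ => map_mul (algebraMap ℝ _) _ _

/-- A property of polynomial functions on `A[1]` can be checked by multiplying, from the left, with
functions on `M` and with sections of `A^*`. -/
theorem Fn.generated_induction {p : Fn E F A → Prop} (one : p 1)
    (add : ∀ φ η, p φ → p η → p (φ + η))
    (smooth : ∀ f φ, p φ → p (Fn.ofSmooth F A f * φ))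
    (coSec : ∀ ξ φ, p φ → p (Fn.ofCoSec ξ * φ))
    {φ : ∀ x, ExteriorAlgebra ℝ (Module.Dual ℝ (A x))} (h : φ ∈ generated E F A) :
    p ⟨φ, generated_le h⟩ := by
  have smul : ∀ (r : ℝ) φ, p φ → p (r • φ) := fun r φ hφ => by
    convert smooth ⟨fun _ => r, contMDiff_const⟩ φ hφ using 1
    exact Fn.ext fun x => (Fn.ofSmooth_mul_at ⟨fun _ => r, contMDiff_const⟩ φ x).symm
  have key : ∀ ψ ∈ generated E F A, ∃ η : Fn E F A, η.1 = ψ ∧ p η := by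
    intro ψ hψ
    rw [generated, ← Subalgebra.mem_toSubmodule, Algebra.adjoin_eq_span] at hψ
    induction hψ using Submodule.span_induction with
    | mem ψ hψ =>
      induction hψ using Submonoid.closure_induction_left with
      | one => exact ⟨1, rfl, one⟩
      | mul_left g hg ψ _ ih =>
        obtain ⟨η, rfl, hη⟩ := ih
        rcases hg with ⟨f, rfl⟩ | ⟨ξ, rfl⟩
        · exact ⟨_, rfl, smooth f η hη⟩
        · exact ⟨_, rfl, coSec ξ η hη⟩
    | zero => exact ⟨(0 : ℝ) • 1, by rw [zero_smul]; rfl, smul 0 1 one⟩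
    | add a b _ _ ha hb =>
      obtain ⟨η, rfl, h1⟩ := ha
      obtain ⟨θ, rfl, h2⟩ := hb
      exact ⟨η + θ, rfl, add _ _ h1 h2⟩
    | smul r a _ ha =>
      obtain ⟨η, rfl, h1⟩ := ha
      exact ⟨r • η, rfl, smul r _ h1⟩
  obtain ⟨η, e, hη⟩ := key φ h
  have : η = ⟨φ, generated_le h⟩ := Subtype.ext e
  rwa [← this]

/-- The induction principle for a property of functions on `A[1]` which only depends on the germ at
a point `x`. -/
theorem Fn.local_induction {x : M} {p : Fn E F A → Prop}
    (loc : ∀ φ η : Fn E F A, (∀ᶠ y in 𝓝 x, φ.at y = η.at y) → p η → p φ) (one : p 1)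
    (add : ∀ φ η, p φ → p η → p (φ + η))
    (smooth : ∀ f φ, p φ → p (Fn.ofSmooth F A f * φ))
    (coSec : ∀ ξ φ, p φ → p (Fn.ofCoSec ξ * φ)) (φ : Fn E F A) : p φ := by
  obtain ⟨η, hη, e⟩ := φ.2 x
  exact loc _ ⟨η, generated_le hη⟩ e (Fn.generated_induction one add smooth coSec hη)

/-- The component of degree `0` of a function on `A[1]`. -/
def Fn.body (φ : Fn E F A) : Smooth E M :=
  ⟨fun x => ExteriorAlgebra.algebraMapInv (φ.at x), fun x₀ => by
    obtain ⟨η, hη, e⟩ := φ.2 x₀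
    have h : ContMDiff 𝓘(ℝ, E) 𝓘(ℝ, ℝ) ∞ fun x => ExteriorAlgebra.algebraMapInv (η x) := by
      clear e
      induction hη using Algebra.adjoin_induction with
      | mem φ hφ =>
        rcases hφ with ⟨f, rfl⟩ | ⟨ξ, rfl⟩
        · simp only [AlgHom.commutes]
          exact f.contMDiff
        · simp only [ExteriorAlgebra.algebraMapInv, ExteriorAlgebra.lift_ι_apply]
          exact contMDiff_const
      | algebraMap r =>
        simp only [Pi.algebraMap_apply, AlgHom.commutes]
        exact contMDiff_const
      | add a b _ _ iha ihb => simp only [Pi.add_apply, map_add]; exact iha.add ihb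
      | mul a b _ _ iha ihb => simp only [Pi.mul_apply, map_mul]; exact iha.mul ihb
    refine h.contMDiffAt.congr_of_eventuallyEq ?_
    filter_upwards [e] with x hx
    rw [Fn.at, hx]⟩

theorem Fn.ofSmooth_body {φ : Fn E F A} (h : φ ∈ FnDeg E F A 0) :
    Fn.ofSmooth F A φ.body = φ :=
  Fn.ext fun x => (eq_algebraMap_of_mem_grd_zero (h x)).symm

theorem Fn.body_ofSmooth (f : Smooth E M) : (Fn.ofSmooth F A f).body = f := by
  ext x
  exact ExteriorAlgebra.algebraMap_leftInverse _ _

theorem algebraMap_exterior_inj {W : Type*} [AddCommGroup W] [Module ℝ W] {r s : ℝ}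
    (h : algebraMap ℝ (ExteriorAlgebra ℝ W) r = algebraMap ℝ _ s) : r = s :=
  (ExteriorAlgebra.algebraMap_leftInverse W).injective h

/-- The value of a section of `A^*` on a section of `A`. -/
def CoSec.pair (ξ : CoSec E F A) (a : Sec E F A) : Smooth E M := ⟨_, ξ.smooth' a⟩

theorem CoSec.pair_apply (ξ : CoSec E F A) (a : Sec E F A) (x : M) :
    ξ.pair a x = ξ.toFun x (a x) := rfl

end Functions

/-! ### Vector fields on `A[1]` and their symbols -/

section VF

variable {E : Type*} [NormedAddCommGroup E] [NormedSpace ℝ E] [FiniteDimensional ℝ E]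
  {M : Type*} [TopologicalSpace M] [ChartedSpace E M] [IsManifold 𝓘(ℝ, E) ∞ M] [T2Space M]
  {F : Type*} [NormedAddCommGroup F] [NormedSpace ℝ F]
  {A : M → Type*} [∀ x, AddCommGroup (A x)] [∀ x, Module ℝ (A x)]
  [∀ x, TopologicalSpace (A x)] [TopologicalSpace (Bundle.TotalSpace F A)]
  [FiberBundle F A]

theorem vf_smooth_mul {k : ℤ} (X : VF E F A k) (f : Smooth E M) (φ : Fn E F A) :
    X.1 (Fn.ofSmooth F A f * φ) = X.1 (Fn.ofSmooth F A f) * φ + Fn.ofSmooth F A f * X.1 φ := by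
  rw [vf_leibniz X (Fn.ofSmooth_mem f), mul_zero, zpow_zero, one_smul]

theorem vf_coSec_mul {k : ℤ} (X : VF E F A k) (ξ : CoSec E F A) (φ : Fn E F A) :
    X.1 (Fn.ofCoSec ξ * φ) = X.1 (Fn.ofCoSec ξ) * φ
      + (-1 : ℝ) ^ k • (Fn.ofCoSec ξ * X.1 φ) := by
  rw [vf_leibniz X (Fn.ofCoSec_mem ξ), mul_one]

theorem vf_one {k : ℤ} (X : VF E F A k) : X.1 1 = 0 := by
  have h := vf_leibniz X (m := 0) (φ := 1) (fun x => by
    rw [Fn.at_one, ← map_one (algebraMap ℝ _)]; exact algebraMap_mem_grd _) 1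
  simpa using h

theorem smooth_mul_eq_zero {U : Set M} {χ : Smooth E M} (hs : tsupport χ ⊆ U)
    {φ : Fn E F A} (h : ∀ y ∈ U, φ.at y = 0) : Fn.ofSmooth F A χ * φ = 0 := by
  refine Fn.ext fun y => ?_
  rw [Fn.ofSmooth_mul_at, Fn.at_zero]
  by_cases hy : y ∈ tsupport χ
  · rw [h y (hs hy), smul_zero]
  · rw [image_eq_zero_of_notMem_tsupport hy, zero_smul]

/-- Vector fields on `A[1]` are local operators. -/
theorem vf_local {k : ℤ} (X : VF E F A k) {x : M} {φ η : Fn E F A}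
    (h : ∀ᶠ y in 𝓝 x, φ.at y = η.at y) : (X.1 φ).at x = (X.1 η).at x := by
  obtain ⟨χ, h1, hs⟩ := exists_bump (E := E) h
  have h0 : Fn.ofSmooth F A χ * (φ - η) = 0 :=
    smooth_mul_eq_zero hs fun y hy => sub_eq_zero.2 hy
  have h2 := congrArg (fun φ => φ.at x) (vf_smooth_mul X χ (φ - η))
  simp only [h0, map_zero, Fn.at_add, Fn.at_mul, Fn.at_zero, map_sub,
    Fn.at_sub, h.self_of_nhds, sub_self, mul_zero, zero_add] at h2
  rw [Fn.ofSmooth_at, h1.self_of_nhds, map_one, one_mul] at h2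
  exact (sub_eq_zero.1 h2.symm)

/-- Vector fields of the same degree on `A[1]` agree at `x` if they do so on functions on `M` and
on sections of `A^*`. -/
theorem vf_eq_at {k : ℤ} (X X' : VF E F A k) {x : M}
    (hf : ∀ f, (X.1 (Fn.ofSmooth F A f)).at x = (X'.1 (Fn.ofSmooth F A f)).at x)
    (hξ : ∀ ξ, (X.1 (Fn.ofCoSec ξ)).at x = (X'.1 (Fn.ofCoSec ξ)).at x) (φ : Fn E F A) :
    (X.1 φ).at x = (X'.1 φ).at x := by
  induction φ using Fn.local_induction (x := x) with
  | loc φ η h hη => rw [vf_local X h, vf_local X' h, hη]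
  | one => rw [vf_one, vf_one]
  | add φ η h1 h2 => rw [map_add, map_add, Fn.at_add, Fn.at_add, h1, h2]
  | smooth f φ h =>
    rw [vf_smooth_mul, vf_smooth_mul]
    simp only [Fn.at_add, Fn.at_mul, hf, h]
  | coSec ξ φ h =>
    rw [vf_coSec_mul, vf_coSec_mul]
    simp only [Fn.at_add, Fn.at_mul, Fn.at_smul, hξ, h]

theorem vf_ext {k : ℤ} {X X' : VF E F A k}
    (hf : ∀ f, X.1 (Fn.ofSmooth F A f) = X'.1 (Fn.ofSmooth F A f))
    (hξ : ∀ ξ, X.1 (Fn.ofCoSec ξ) = X'.1 (Fn.ofCoSec ξ)) : X = X' :=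
  Subtype.ext (LinearMap.ext fun φ => Fn.ext fun x =>
    vf_eq_at X X' (fun f => by rw [hf]) (fun ξ => by rw [hξ]) φ)

theorem vf_eq_zero_of_lt {k : ℤ} (hk : k < -1) (X : VF E F A k) : X = 0 :=
  vf_ext (fun f => eq_zero_of_mem_FnDeg (by omega) (vf_mem X (Fn.ofSmooth_mem f)))
    (fun ξ => eq_zero_of_mem_FnDeg (by omega) (vf_mem X (Fn.ofCoSec_mem ξ)))

theorem vf_neg_smooth {k : ℤ} (hk : k < 0) (X : VF E F A k) (f : Smooth E M) :
    X.1 (Fn.ofSmooth F A f) = 0 :=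
  eq_zero_of_mem_FnDeg (by omega) (vf_mem X (Fn.ofSmooth_mem f))

/-- The symbol at `x` of an operator on functions on `A[1]`. For a vector field `X` it is the
linear map with `symb X x (d_x f) = (X f)(x)`, see `symb_dform`. It is defined through chosen
coordinates at `x`, of which it is independent for vector fields by `symb_eq_sum`. -/
def symb (X : Module.End ℝ (Fn E F A)) (x : M) :
    Module.Dual ℝ (TM E M x) →ₗ[ℝ] ExteriorAlgebra ℝ (Module.Dual ℝ (A x)) :=
  let c := (exists_coords E x).some
  ∑ i, (LinearMap.applyₗ (c.D i x)).smulRight ((X (Fn.ofSmooth F A (c.q i))).at x)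

/-- At each point a vector field on `A[1]` restricts to a derivation of the functions on `M`, which
only depends on the differential. -/
theorem symb_dform {k : ℤ} (X : VF E F A k) (f : Smooth E M) (x : M) :
    (X.1 (Fn.ofSmooth F A f)).at x = symb X.1 x (dform f x) := by
  set c := (exists_coords E x).some
  have hx : x ∈ c.O := c.mem
  let D : Smooth E M →ₗ[ℝ] ExteriorAlgebra ℝ (Module.Dual ℝ (A x)) :=
    (Fn.evalAt E F A x).toLinearMap ∘ₗ X.1 ∘ₗ Fn.ofSmoothₗ
  have hD : ∀ f g, D (f * g) = f x • D g + g x • D f := fun f g => by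
    change (X.1 (Fn.ofSmooth F A (f * g))).at x = _
    rw [Fn.ofSmooth_mul, vf_smooth_mul, add_comm, Fn.at_add, Fn.ofSmooth_mul_at, Fn.at_mul,
      Fn.ofSmooth_at, ← Algebra.commutes, ← Algebra.smul_def]
    rfl
  have h0 : D (f - ∑ i, dirDeriv f x (c.D i x) • c.q i) = 0 := by
    refine derivation_eq_zero D hD fun v => ?_
    have e : ⇑(f - ∑ i, dirDeriv f x (c.D i x) • c.q i) =
        fun y => f y - ∑ i, dirDeriv f x (c.D i x) * c.q i y := by
      funext y
      rw [ContMDiffMap.coe_sub, Pi.sub_apply]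
      congr 1
      exact map_sum (ContMDiffMap.evalRingHom (n := ∞) (I := 𝓘(ℝ, E)) (I' := 𝓘(ℝ, ℝ)) y) _ _
    have hq : ∀ i ∈ Finset.univ, MDifferentiableAt 𝓘(ℝ, E) 𝓘(ℝ, ℝ)
        (fun y => dirDeriv f x (c.D i x) * c.q i y) x := fun i _ =>
      mdifferentiableAt_const.mul ((c.q i).mdiffAt x)
    rw [e, dirDeriv_sub v (f.mdiffAt x) (mdiffAt_sum _ hq), dirDeriv_sum v _ hq]
    simp_rw [dirDeriv_const_mul v ((c.q _).mdiffAt x)]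
    conv_lhs => rw [← c.sum x hx v]
    rw [sub_eq_zero]
    have : ∀ w : TM E M x, dirDeriv f x w = dform f x w := fun _ => rfl
    rw [this, map_sum]
    refine Finset.sum_congr rfl fun i _ => ?_
    rw [map_smul, smul_eq_mul, mul_comm, c.sum x hx v]
    rfl
  rw [map_sub, sub_eq_zero, map_sum] at h0
  change D f = _
  rw [h0, symb]
  simp only [LinearMap.sum_apply, map_smul]
  rfl

theorem symb_eq_sum {k : ℤ} (X : VF E F A k) {x₀ : M} (c : Coords E x₀) {x : M} (hx : x ∈ c.O)
    (α : Module.Dual ℝ (TM E M x)) :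
    symb X.1 x α = ∑ i, α (c.D i x) • (X.1 (Fn.ofSmooth F A (c.q i))).at x := by
  have h : α = ∑ i, α (c.D i x) • dform (c.q i) x := by
    ext v
    conv_lhs => rw [← c.sum x hx v]
    simp only [map_sum, map_smul, LinearMap.sum_apply, LinearMap.smul_apply, smul_eq_mul]
    exact Finset.sum_congr rfl fun i _ => mul_comm _ _
  conv_lhs => rw [h, map_sum]
  refine Finset.sum_congr rfl fun i _ => ?_
  rw [map_smul, symb_dform]

theorem symb_eq_of_forall {k : ℤ} (X : VF E F A k) {x : M}
    {L : Module.Dual ℝ (TM E M x) →ₗ[ℝ] ExteriorAlgebra ℝ (Module.Dual ℝ (A x))}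
    (h : ∀ f : Smooth E M, (X.1 (Fn.ofSmooth F A f)).at x = L (dform f x)) :
    symb X.1 x = L := by
  obtain ⟨c⟩ := exists_coords E x
  have hx : x ∈ c.O := c.mem
  ext α
  have h' : α = ∑ i, α (c.D i x) • dform (c.q i) x := by
    ext v
    conv_lhs => rw [← c.sum x hx v]
    simp only [map_sum, map_smul, LinearMap.sum_apply, LinearMap.smul_apply, smul_eq_mul]
    exact Finset.sum_congr rfl fun i _ => mul_comm _ _
  rw [h', map_sum, map_sum]
  refine Finset.sum_congr rfl fun i _ => ?_
  rw [map_smul, map_smul, ← symb_dform, h]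

end VF

/-! ### Vector fields of degrees `-1` and `0` -/

section Sections

variable {E : Type*} [NormedAddCommGroup E] [NormedSpace ℝ E] [FiniteDimensional ℝ E]
  {M : Type*} [TopologicalSpace M] [ChartedSpace E M] [IsManifold 𝓘(ℝ, E) ∞ M] [T2Space M]
  {F : Type*} [NormedAddCommGroup F] [NormedSpace ℝ F] [FiniteDimensional ℝ F]
  {A : M → Type*} [∀ x, AddCommGroup (A x)] [∀ x, Module ℝ (A x)]
  [∀ x, TopologicalSpace (A x)] [TopologicalSpace (Bundle.TotalSpace F A)]
  [FiberBundle F A] [VectorBundle ℝ F A]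

theorem contMDiff_of_locally_sec {s : ∀ x, A x}
    (h : ∀ x₀, ∃ t : Sec E F A, ∀ᶠ x in 𝓝 x₀, s x = t x) :
    ContMDiff 𝓘(ℝ, E) (𝓘(ℝ, E).prod 𝓘(ℝ, F)) ∞ fun x => Bundle.TotalSpace.mk' F x (s x) := by
  intro x₀
  obtain ⟨t, ht⟩ := h x₀
  refine t.contMDiff.contMDiffAt.congr_of_eventuallyEq ?_
  filter_upwards [ht] with x hx
  rw [hx]

theorem sec_sum_apply {ι : Type*} (s : Finset ι) (t : ι → Sec E F A) (x : M) :
    (∑ i ∈ s, t i) x = ∑ i ∈ s, t i x := by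
  have := map_sum (ContMDiffSection.coeAddHom 𝓘(ℝ, E) F ∞ A) t s
  have h := congrFun this x
  rw [Finset.sum_apply] at h
  exact h

theorem fsmul_apply (f : Smooth E M) (a : Sec E F A) (x : M) : fsmul f a x = f x • a x := rfl

theorem Frame.coSec_eq {x₀ : M} (fr : Frame E F A x₀) {x : M} (hx : x ∈ fr.O) (ξ : CoSec E F A) :
    ξ.toFun x = ∑ i, ξ.pair (fr.e i) x • (fr.ε i).toFun x := by
  ext v
  conv_lhs => rw [← fr.sum x hx v]
  simp only [map_sum, map_smul, LinearMap.sum_apply, LinearMap.smul_apply, smul_eq_mul]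
  exact Finset.sum_congr rfl fun i _ => mul_comm _ _

theorem Frame.eventually {x₀ : M} (fr : Frame E F A x₀) {x : M} (hx : x ∈ fr.O) :
    ∀ᶠ y in 𝓝 x, y ∈ fr.O := fr.isOpen.mem_nhds hx

theorem Coords.eventually {x₀ : M} (c : Coords E x₀) {x : M} (hx : x ∈ c.O) :
    ∀ᶠ y in 𝓝 x, y ∈ c.O := c.isOpen.mem_nhds hx

/-- The value of a vector field on `A[1]` on a section of `A^*`, in a local frame. -/
theorem vf_coSec {k : ℤ} (X : VF E F A k) {x₀ : M} (fr : Frame E F A x₀) {x : M} (hx : x ∈ fr.O)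
    (ξ : CoSec E F A) : (X.1 (Fn.ofCoSec ξ)).at x =
      ∑ i, ((X.1 (Fn.ofSmooth F A (ξ.pair (fr.e i)))).at x * (Fn.ofCoSec (fr.ε i)).at x
        + ξ.pair (fr.e i) x • (X.1 (Fn.ofCoSec (fr.ε i))).at x) := by
  have h : ∀ᶠ y in 𝓝 x, (Fn.ofCoSec ξ).at y =
      (∑ i, Fn.ofSmooth F A (ξ.pair (fr.e i)) * Fn.ofCoSec (fr.ε i)).at y := by
    filter_upwards [fr.eventually hx] with y hy
    rw [Fn.at_sum, Fn.ofCoSec_at, fr.coSec_eq hy, map_sum]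
    refine Finset.sum_congr rfl fun i _ => ?_
    rw [map_smul, Fn.ofSmooth_mul_at, Fn.ofCoSec_at]
  rw [vf_local X h, map_sum, Fn.at_sum]
  refine Finset.sum_congr rfl fun i _ => ?_
  rw [vf_smooth_mul, Fn.at_add, Fn.ofSmooth_mul_at, Fn.at_mul]

variable [ContMDiffVectorBundle ∞ F A 𝓘(ℝ, E)]

theorem eq_of_coSec_eq {x : M} {v w : A x}
    (h : ∀ ξ : CoSec E F A, ξ.toFun x v = ξ.toFun x w) : v = w := by
  obtain ⟨fr⟩ := exists_frame E F A x
  rw [← fr.sum x fr.mem v, ← fr.sum x fr.mem w]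
  simp only [h]

theorem vert_smooth (a : Sec E F A) (f : Smooth E M) : (vert a).1 (Fn.ofSmooth F A f) = 0 :=
  Fn.ext fun _ => contract_algebraMap _ _

theorem vert_coSec (a : Sec E F A) (ξ : CoSec E F A) :
    (vert a).1 (Fn.ofCoSec ξ) = Fn.ofSmooth F A (ξ.pair a) :=
  Fn.ext fun _ => contract_ι _ _

theorem vert_at (a : Sec E F A) (φ : Fn E F A) (x : M) :
    ((vert a).1 φ).at x = contract (a x) (φ.at x) := rfl

theorem vert_injective {a b : Sec E F A} (h : (vert a).1 = (vert b).1) : a = b := by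
  ext x
  refine eq_of_coSec_eq (E := E) (F := F) fun ξ =>
    algebraMap_exterior_inj (W := Module.Dual ℝ (A x)) ?_
  have := congrArg (fun X : Module.End ℝ (Fn E F A) => (X (Fn.ofCoSec ξ)).at x) h
  simpa only [vert_coSec, Fn.ofSmooth_at, CoSec.pair_apply] using this

/-- Every vector field of degree `-1` on `A[1]` is the vertical lift of a section of `A`. -/
theorem exists_vert (X : VF E F A (-1)) : ∃ a : Sec E F A, X = vert a := by
  have hb : ∀ ξ : CoSec E F A, Fn.ofSmooth F A (X.1 (Fn.ofCoSec ξ)).body = X.1 (Fn.ofCoSec ξ) :=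
    fun ξ => Fn.ofSmooth_body (vf_mem X (Fn.ofCoSec_mem ξ))
  have key : ∀ {x₀ : M} (fr : Frame E F A x₀) {x : M}, x ∈ fr.O → ∀ ξ : CoSec E F A,
      (X.1 (Fn.ofCoSec ξ)).body x =
        ξ.toFun x (∑ i, (X.1 (Fn.ofCoSec (fr.ε i))).body x • fr.e i x) := by
    intro x₀ fr x hx ξ
    refine algebraMap_exterior_inj (W := Module.Dual ℝ (A x)) ?_
    have h := vf_coSec X fr hx ξ
    rw [← hb ξ, Fn.ofSmooth_at] at h
    rw [h, map_sum, map_sum]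
    refine Finset.sum_congr rfl fun i _ => ?_
    rw [vf_neg_smooth (by norm_num) X, Fn.at_zero, zero_mul, zero_add, ← hb, Fn.ofSmooth_at,
      Fn.body_ofSmooth, map_smul, CoSec.pair_apply, smul_eq_mul, map_mul, Algebra.smul_def,
      Algebra.commutes]
  let s : ∀ x, A x := fun x =>
    ∑ i, (X.1 (Fn.ofCoSec ((exists_frame E F A x).some.ε i))).body x
      • (exists_frame E F A x).some.e i x
  have hs : ∀ x (ξ : CoSec E F A), (X.1 (Fn.ofCoSec ξ)).body x = ξ.toFun x (s x) := fun x =>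
    key (exists_frame E F A x).some (Frame.mem _)
  refine ⟨⟨s, contMDiff_of_locally_sec fun x₀ => ?_⟩, ?_⟩
  · obtain ⟨fr⟩ := exists_frame E F A x₀
    refine ⟨∑ i, fsmul (X.1 (Fn.ofCoSec (fr.ε i))).body (fr.e i), ?_⟩
    filter_upwards [fr.eventually fr.mem] with x hx
    rw [sec_sum_apply]
    exact eq_of_coSec_eq (E := E) (F := F) fun ξ => (hs x ξ).symm.trans (key fr hx ξ)
  · refine vf_ext (fun f => ?_) fun ξ => ?_
    · rw [vf_neg_smooth (by norm_num) X, vert_smooth]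
    · rw [vert_coSec, ← hb]
      congr 1
      ext x
      exact hs x ξ

/-- Every vector field of degree `0` on `A[1]` has a symbol. -/
theorem exists_symbol (X : VF E F A 0) : ∃ Y : Sec E E (TM E M), HasSymbol X.1 Y := by
  have hb : ∀ f : Smooth E M, Fn.ofSmooth F A (X.1 (Fn.ofSmooth F A f)).body
      = X.1 (Fn.ofSmooth F A f) := fun f => Fn.ofSmooth_body (vf_mem X (Fn.ofSmooth_mem f))
  have key : ∀ {x₀ : M} (c : Coords E x₀) {x : M}, x ∈ c.O → ∀ f : Smooth E M,
      (X.1 (Fn.ofSmooth F A f)).body x =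
        dirDeriv f x (∑ i, (X.1 (Fn.ofSmooth F A (c.q i))).body x • c.D i x) := by
    intro x₀ c x hx f
    refine algebraMap_exterior_inj (W := Module.Dual ℝ (A x)) ?_
    have h := symb_dform X f x
    rw [symb_eq_sum X c hx, ← hb, Fn.ofSmooth_at] at h
    rw [h]
    change _ = algebraMap ℝ _ (dform f x _)
    rw [map_sum, map_sum]
    refine Finset.sum_congr rfl fun i _ => ?_
    rw [map_smul, smul_eq_mul, map_mul, ← hb, Fn.ofSmooth_at, Fn.body_ofSmooth, Algebra.smul_def,
      Algebra.commutes]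
  let s : ∀ x, TM E M x := fun x =>
    ∑ i, (X.1 (Fn.ofSmooth F A ((exists_coords E x).some.q i))).body x
      • (exists_coords E x).some.D i x
  have hs : ∀ x (f : Smooth E M), (X.1 (Fn.ofSmooth F A f)).body x = dirDeriv f x (s x) := fun x =>
    key (exists_coords E x).some (Coords.mem _)
  refine ⟨⟨s, contMDiff_of_locally_sec fun x₀ => ?_⟩, ?_⟩
  · obtain ⟨c⟩ := exists_coords E x₀
    refine ⟨∑ i, fsmul (X.1 (Fn.ofSmooth F A (c.q i))).body (c.D i), ?_⟩
    filter_upwards [c.eventually c.mem] with x hx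
    rw [sec_sum_apply, ← c.sum x hx (s x)]
    conv_rhs => rw [← c.sum x hx (∑ i, _)]
    refine Finset.sum_congr rfl fun i _ => ?_
    rw [← hs, key c hx]; rfl
  · intro f x
    rw [← hb, Fn.ofSmooth_at, hs]
    rfl

end Sections

/-! ### Gluing vector fields, and lifting them from `M` to `A[1]` -/

section Lift

variable {E : Type*} [NormedAddCommGroup E] [NormedSpace ℝ E] [FiniteDimensional ℝ E]
  {M : Type*} [TopologicalSpace M] [ChartedSpace E M] [IsManifold 𝓘(ℝ, E) ∞ M] [T2Space M]
  {F : Type*} [NormedAddCommGroup F] [NormedSpace ℝ F] [FiniteDimensional ℝ F]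
  {A : M → Type*} [∀ x, AddCommGroup (A x)] [∀ x, Module ℝ (A x)]
  [∀ x, TopologicalSpace (A x)] [TopologicalSpace (Bundle.TotalSpace F A)]
  [FiberBundle F A] [VectorBundle ℝ F A]

/-- The product of a vector field on `A[1]` with a function on `M`, in the same degree. -/
def vfSmul {k : ℤ} (f : Smooth E M) (X : VF E F A k) : VF E F A k :=
  vfCast (zero_add k) (vfMul (Fn.ofSmooth F A f) (Fn.ofSmooth_mem f) X)

theorem vfSmul_apply {k : ℤ} (f : Smooth E M) (X : VF E F A k) (φ : Fn E F A) :
    (vfSmul f X).1 φ = Fn.ofSmooth F A f * X.1 φ := rfl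

theorem vfSmul_at {k : ℤ} (f : Smooth E M) (X : VF E F A k) (φ : Fn E F A) (x : M) :
    ((vfSmul f X).1 φ).at x = f x • (X.1 φ).at x := Fn.ofSmooth_mul_at _ _ _

theorem vf_sum_at {k : ℤ} {ι : Type*} (s : Finset ι) (X : ι → VF E F A k) (φ : Fn E F A) (x : M) :
    ((∑ i ∈ s, X i).1 φ).at x = ∑ i ∈ s, ((X i).1 φ).at x := by
  rw [AddSubmonoidClass.coe_finsetSum, LinearMap.sum_apply, Fn.at_sum]

/-- Vector fields given near each point, and agreeing with each other, can be glued. -/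
theorem exists_glue {k : ℤ} (Y : M → VF E F A k)
    (h : ∀ x₀, ∀ᶠ x in 𝓝 x₀, ∀ φ, ((Y x).1 φ).at x = ((Y x₀).1 φ).at x) :
    ∃ X : VF E F A k, ∀ x φ, (X.1 φ).at x = ((Y x).1 φ).at x := by
  let T : Fn E F A → Fn E F A := fun φ => ⟨fun x => ((Y x).1 φ).at x, fun x₀ => by
    obtain ⟨η, hη, e⟩ := ((Y x₀).1 φ).2 x₀
    exact ⟨η, hη, by filter_upwards [h x₀, e] with x h1 h2; rw [h1, Fn.at, h2]⟩⟩
  have hT : ∀ φ x, (T φ).at x = ((Y x).1 φ).at x := fun _ _ => rfl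
  refine ⟨⟨⟨⟨T, fun φ η => Fn.ext fun x => ?_⟩, fun r φ => Fn.ext fun x => ?_⟩,
    fun m φ hφ x => vf_mem (Y x) hφ x, fun m φ hφ η => Fn.ext fun x => ?_⟩, fun x φ => hT φ x⟩
  · rw [Fn.at_add, hT, hT, hT, map_add, Fn.at_add]
  · rw [RingHom.id_apply, Fn.at_smul, hT, hT, map_smul, Fn.at_smul]
  · change (T (φ * η)).at x = (T φ * η + _ • (φ * T η)).at x
    rw [Fn.at_add, Fn.at_mul, Fn.at_smul, Fn.at_mul, hT, hT, hT, vf_leibniz (Y x) hφ, Fn.at_add,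
      Fn.at_mul, Fn.at_smul, Fn.at_mul]

/-- Vector fields with prescribed values on some functions can be constructed locally: the
prescription is preserved by convex combinations, so a partition of unity applies. -/
theorem exists_vf_of_local [SecondCountableTopology M] {k : ℤ} (S : Set (Fn E F A))
    (G : Fn E F A → ∀ x, ExteriorAlgebra ℝ (Module.Dual ℝ (A x)))
    (h : ∀ x₀, ∃ X : VF E F A k, ∀ᶠ x in 𝓝 x₀, ∀ φ ∈ S, (X.1 φ).at x = G φ x) :
    ∃ X : VF E F A k, ∀ φ ∈ S, ∀ x, (X.1 φ).at x = G φ x := by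
  have : LocallyCompactSpace M := Manifold.locallyCompact_of_finiteDimensional 𝓘(ℝ, E)
  choose Y hY using h
  choose U hU hUo hxU using fun x₀ => eventually_nhds_iff.1 (hY x₀)
  obtain ⟨ρ, hρ⟩ := SmoothPartitionOfUnity.exists_isSubordinate 𝓘(ℝ, E) isClosed_univ U hUo
    fun x _ => Set.mem_iUnion.2 ⟨x, hxU x⟩
  let Z : M → VF E F A k := fun x => ∑ i ∈ ρ.fintsupport x, vfSmul (ρ i) (Y i)
  have hZ : ∀ (s : Finset M) x, ρ.finsupport x ⊆ s → ∀ φ,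
      ((∑ i ∈ s, vfSmul (ρ i) (Y i)).1 φ).at x =
        ∑ i ∈ ρ.finsupport x, ρ i x • ((Y i).1 φ).at x := by
    intro s x hs φ
    rw [vf_sum_at]
    simp only [vfSmul_at]
    refine (Finset.sum_subset hs fun i _ hi => ?_).symm
    have : ρ i x = 0 := by
      rw [ρ.mem_finsupport x, Function.notMem_support] at hi
      exact hi
    rw [this, zero_smul]
  -- `fintsupport` rather than `finsupport`, as it contains the indices that matter near `x`
  obtain ⟨X, hX⟩ := exists_glue Z fun x₀ => by
    filter_upwards [ρ.eventually_finsupport_subset x₀] with x hx φ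
    rw [hZ _ x (ρ.finsupport_subset_fintsupport x), hZ _ x hx]
  refine ⟨X, fun φ hφ x => ?_⟩
  rw [hX, hZ _ x (ρ.finsupport_subset_fintsupport x)]
  have : ∀ i ∈ ρ.finsupport x, ρ i x • ((Y i).1 φ).at x = ρ i x • G φ x := fun i hi => by
    have hx : x ∈ U i := by
      refine hρ i (subset_tsupport _ ?_)
      rwa [ρ.mem_finsupport x] at hi
    rw [hU i x hx φ hφ]
  rw [Finset.sum_congr rfl this, ← Finset.sum_smul, ρ.sum_finsupport x (Set.mem_univ x), one_smul]

theorem map_mem_grd {V W : Type*} [AddCommGroup V] [Module ℝ V] [AddCommGroup W] [Module ℝ W]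
    (g : V →ₗ[ℝ] W) {j : ℤ} {a : ExteriorAlgebra ℝ V} (ha : a ∈ grd V j) :
    ExteriorAlgebra.map g a ∈ grd W j := by
  rcases grd_cases ha with rfl | ⟨n, rfl, h⟩
  · rw [map_zero]; exact zero_mem _
  rw [grd_natCast, ExteriorAlgebra.exteriorPower]
  have h1 : ExteriorAlgebra.map g a ∈
      (LinearMap.range (ExteriorAlgebra.ι ℝ (M := V)) ^ n).map
        (ExteriorAlgebra.map g).toLinearMap := ⟨a, h, rfl⟩
  rw [Submodule.map_pow] at h1
  refine pow_le_pow_left' (?_ : _ ≤ LinearMap.range (ExteriorAlgebra.ι ℝ (M := W))) n h1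
  rintro _ ⟨_, ⟨v, rfl⟩, rfl⟩
  exact ⟨g v, (ExteriorAlgebra.map_apply_ι g v).symm⟩

namespace Frame

variable {x₀ : M} (fr : Frame E F A x₀)

/-- Linear forms on the fibre over `x`, in terms of the frame. -/
def toCoord (x : M) : Module.Dual ℝ (A x) →ₗ[ℝ] (Fin (Module.finrank ℝ F) → ℝ) :=
  LinearMap.pi fun i => LinearMap.applyₗ (fr.e i x)

/-- The linear form on the fibre over `x` with given coefficients. -/
def ofCoord (x : M) : (Fin (Module.finrank ℝ F) → ℝ) →ₗ[ℝ] Module.Dual ℝ (A x) :=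
  ∑ i, (LinearMap.proj i).smulRight ((fr.ε i).toFun x)

theorem ofCoord_apply (x : M) (c : Fin (Module.finrank ℝ F) → ℝ) :
    fr.ofCoord x c = ∑ i, c i • (fr.ε i).toFun x := by simp [ofCoord]

theorem ofCoord_toCoord {x : M} (hx : x ∈ fr.O) : fr.ofCoord x ∘ₗ fr.toCoord x = LinearMap.id := by
  ext ξ v
  rw [LinearMap.comp_apply, ofCoord_apply]
  conv_rhs => rw [LinearMap.id_apply, ← fr.sum x hx v]
  simp only [map_sum, map_smul, LinearMap.sum_apply, LinearMap.smul_apply, smul_eq_mul]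
  exact Finset.sum_congr rfl fun i _ => mul_comm _ _

/-- The value of a function on `A[1]` at `x`, in terms of the frame: an element of a fixed exterior
algebra. -/
def coordAt (x : M) : Fn E F A →ₐ[ℝ] ExteriorAlgebra ℝ (Fin (Module.finrank ℝ F) → ℝ) :=
  (ExteriorAlgebra.map (fr.toCoord x)).comp (Fn.evalAt E F A x)

theorem coordAt_smooth (x : M) (f : Smooth E M) :
    fr.coordAt x (Fn.ofSmooth F A f) = algebraMap ℝ _ (f x) := AlgHom.commutes _ _

theorem coordAt_coSec (x : M) (ξ : CoSec E F A) : fr.coordAt x (Fn.ofCoSec ξ) =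
    ∑ i, ξ.pair (fr.e i) x • ExteriorAlgebra.ι ℝ (Pi.single i 1) := by
  change ExteriorAlgebra.map (fr.toCoord x) (ExteriorAlgebra.ι ℝ (ξ.toFun x)) = _
  rw [ExteriorAlgebra.map_apply_ι]
  simp only [← map_smul, ← map_sum]
  congr 1
  ext j
  simp [toCoord, CoSec.pair_apply, Finset.sum_apply, Pi.single_apply]

/-- The components of a function on `A[1]` with respect to a frame depend smoothly on the point. -/
theorem coordAt_contMDiff (φ : Fn E F A)
    (l : Module.Dual ℝ (ExteriorAlgebra ℝ (Fin (Module.finrank ℝ F) → ℝ))) :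
    ContMDiff 𝓘(ℝ, E) 𝓘(ℝ, ℝ) ∞ fun x => l (fr.coordAt x φ) := by
  intro x
  revert l
  induction φ using Fn.local_induction (x := x) with
  | loc φ η h hη =>
    intro l
    refine (hη l).congr_of_eventuallyEq ?_
    filter_upwards [h] with y hy
    change l (ExteriorAlgebra.map (fr.toCoord y) (φ.at y)) =
      l (ExteriorAlgebra.map (fr.toCoord y) (η.at y))
    rw [hy]
  | one => intro l; simp only [map_one]; exact contMDiffAt_const
  | add φ η h1 h2 => intro l; simp only [map_add]; exact (h1 l).add (h2 l)
  | smooth f φ h =>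
    intro l
    simp only [map_mul, coordAt_smooth, ← Algebra.smul_def, map_smul]
    exact f.contMDiff.contMDiffAt.mul (h l)
  | coSec ξ φ h =>
    intro l
    simp only [map_mul, coordAt_coSec, Finset.sum_mul, map_sum, smul_mul_assoc, map_smul]
    refine contMDiffAt_finsetSum fun i _ => (ξ.pair (fr.e i)).contMDiff.contMDiffAt.mul ?_
    exact h (l ∘ₗ LinearMap.mulLeft ℝ (ExteriorAlgebra.ι ℝ (Pi.single i 1)))

/-- The components of a function on `A[1]` with respect to the frame. -/
def coef (l : Module.Dual ℝ (ExteriorAlgebra ℝ (Fin (Module.finrank ℝ F) → ℝ))) (φ : Fn E F A) :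
    Smooth E M := ⟨_, fr.coordAt_contMDiff φ l⟩

theorem coef_apply (l : Module.Dual ℝ (ExteriorAlgebra ℝ (Fin (Module.finrank ℝ F) → ℝ)))
    (φ : Fn E F A) (x : M) : fr.coef l φ x = l (fr.coordAt x φ) := rfl

theorem map_ofCoord_generated (b : ExteriorAlgebra ℝ (Fin (Module.finrank ℝ F) → ℝ)) :
    (fun x => ExteriorAlgebra.map (fr.ofCoord x) b) ∈ generated E F A := by
  induction b using ExteriorAlgebra.induction with
  | algebraMap r =>
    convert Subalgebra.algebraMap_mem (generated E F A) r using 1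
    funext x; exact AlgHom.commutes _ _
  | ι c =>
    have : (fun x => ExteriorAlgebra.map (fr.ofCoord x) (ExteriorAlgebra.ι ℝ c)) =
        ∑ i, c i • fun x => ExteriorAlgebra.ι ℝ ((fr.ε i).toFun x) := by
      funext x
      rw [ExteriorAlgebra.map_apply_ι, ofCoord_apply, map_sum, Finset.sum_apply]
      exact Finset.sum_congr rfl fun i _ => map_smul _ _ _
    rw [this]
    refine sum_mem fun i _ => Subalgebra.smul_mem _ ?_ _
    exact Algebra.subset_adjoin (Or.inr ⟨fr.ε i, rfl⟩)
  | mul a b ha hb => convert mul_mem ha hb using 1; funext x; exact map_mul _ _ _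
  | add a b ha hb => convert add_mem ha hb using 1; funext x; exact map_add _ _ _

/-- The function on `A[1]` with constant components. -/
def const (b : ExteriorAlgebra ℝ (Fin (Module.finrank ℝ F) → ℝ)) : Fn E F A :=
  ⟨fun x => ExteriorAlgebra.map (fr.ofCoord x) b, generated_le (fr.map_ofCoord_generated b)⟩

/-- The basis of the exterior algebra of coefficients. -/
def basis : Module.Basis (Finset (Fin (Module.finrank ℝ F))) ℝ
    (ExteriorAlgebra ℝ (Fin (Module.finrank ℝ F) → ℝ)) :=
  (Pi.basisFun ℝ (Fin (Module.finrank ℝ F))).ExteriorAlgebra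

variable (Y : Sec E E (TM E M))

/-- The derivative of a function on `A[1]` along a vector field on `M`, in terms of the frame. -/
def dcoord (φ : Fn E F A) (x : M) : ExteriorAlgebra ℝ (Fin (Module.finrank ℝ F) → ℝ) :=
  ∑ s, lieD Y (fr.coef ((basis (F := F)).coord s) φ) x • basis (F := F) s

/-- The componentwise derivative can be computed in any family of constants `b i`, not only in the
basis. -/
theorem dcoord_eq {ι : Type*} (s : Finset ι) (g : ι → Smooth E M)
    (b : ι → ExteriorAlgebra ℝ (Fin (Module.finrank ℝ F) → ℝ)) {φ : Fn E F A}
    (h : ∀ x, fr.coordAt x φ = ∑ i ∈ s, g i x • b i) (x : M) :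
    fr.dcoord Y φ x = ∑ i ∈ s, lieD Y (g i) x • b i := by
  have key : ∀ l : Module.Dual ℝ (ExteriorAlgebra ℝ (Fin (Module.finrank ℝ F) → ℝ)),
      lieD Y (fr.coef l φ) x = l (∑ i ∈ s, lieD Y (g i) x • b i) := by
    intro l
    have e : ⇑(fr.coef l φ) = fun y => ∑ i ∈ s, l (b i) * g i y := by
      funext y
      rw [coef_apply, h, map_sum]
      exact Finset.sum_congr rfl fun i _ => by rw [map_smul, smul_eq_mul, mul_comm]
    have hq : ∀ i ∈ s, MDifferentiableAt 𝓘(ℝ, E) 𝓘(ℝ, ℝ) (fun y => l (b i) * g i y) x :=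
      fun i _ => mdifferentiableAt_const.mul ((g i).mdiffAt x)
    rw [lieD_apply, e, dirDeriv_sum _ _ hq, map_sum]
    refine Finset.sum_congr rfl fun i _ => ?_
    rw [dirDeriv_const_mul _ ((g i).mdiffAt x), map_smul, smul_eq_mul, mul_comm, lieD_apply]
  rw [dcoord]
  simp_rw [key]
  exact (basis (F := F)).sum_repr _

theorem lieD_coef (l : Module.Dual ℝ (ExteriorAlgebra ℝ (Fin (Module.finrank ℝ F) → ℝ)))
    (φ : Fn E F A) (x : M) : lieD Y (fr.coef l φ) x = l (fr.dcoord Y φ x) := by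
  have e : ⇑(fr.coef l φ) = fun y =>
      ∑ s, l (basis (F := F) s) * fr.coef ((basis (F := F)).coord s) φ y := by
    funext y
    rw [coef_apply]
    conv_lhs => rw [← (basis (F := F)).sum_repr (fr.coordAt y φ), map_sum]
    exact Finset.sum_congr rfl fun i _ => by rw [map_smul, smul_eq_mul, mul_comm]; rfl
  have hq : ∀ s ∈ Finset.univ, MDifferentiableAt 𝓘(ℝ, E) 𝓘(ℝ, ℝ) (fun y =>
      l (basis (F := F) s) * fr.coef ((basis (F := F)).coord s) φ y) x :=
    fun i _ => mdifferentiableAt_const.mul (Smooth.mdiffAt _ x)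
  rw [lieD_apply, e, dirDeriv_sum _ _ hq, dcoord, map_sum]
  refine Finset.sum_congr rfl fun i _ => ?_
  rw [dirDeriv_const_mul _ (Smooth.mdiffAt _ x), map_smul, smul_eq_mul, mul_comm, lieD_apply]

theorem coordAt_eq (φ : Fn E F A) (x : M) : fr.coordAt x φ =
    ∑ s, fr.coef ((basis (F := F)).coord s) φ x • basis (F := F) s :=
  ((basis (F := F)).sum_repr _).symm

theorem dcoord_mul (φ η : Fn E F A) (x : M) : fr.dcoord Y (φ * η) x =
    fr.dcoord Y φ x * fr.coordAt x η + fr.coordAt x φ * fr.dcoord Y η x := by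
  have h := fr.dcoord_eq Y (φ := φ * η) Finset.univ
    (fun p : Finset (Fin (Module.finrank ℝ F)) × Finset (Fin (Module.finrank ℝ F)) =>
      fr.coef ((basis (F := F)).coord p.1) φ * fr.coef ((basis (F := F)).coord p.2) η)
    (fun p => basis (F := F) p.1 * basis (F := F) p.2) (fun x => by
      rw [map_mul, coordAt_eq fr φ, coordAt_eq fr η, Finset.sum_mul_sum,
        ← Finset.univ_product_univ, Finset.sum_product]
      refine Finset.sum_congr rfl fun s _ => Finset.sum_congr rfl fun t _ => ?_
      rw [smul_mul_smul_comm]; rfl) x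
  rw [h, coordAt_eq fr φ, coordAt_eq fr η, dcoord, dcoord, Finset.sum_mul_sum, Finset.sum_mul_sum,
    ← Finset.univ_product_univ, Finset.sum_product, ← Finset.sum_add_distrib]
  refine Finset.sum_congr rfl fun s _ => ?_
  rw [← Finset.sum_add_distrib]
  refine Finset.sum_congr rfl fun t _ => ?_
  rw [smul_mul_smul_comm, smul_mul_smul_comm, ← add_smul]
  congr 1
  rw [lieD_apply, lieD_apply, lieD_apply, add_comm, mul_comm (dirDeriv _ x (Y x))]
  exact dirDeriv_mul _ (Smooth.mdiffAt _ x) (Smooth.mdiffAt _ x)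

/-- The components of `φ` against linear forms killing the part of degree `m` vanish identically,
and so do their derivatives. -/
theorem dcoord_mem {m : ℤ} {φ : Fn E F A} (h : φ ∈ FnDeg E F A m) (x : M) :
    fr.dcoord Y φ x ∈ grd (Fin (Module.finrank ℝ F) → ℝ) m := by
  by_contra hn
  obtain ⟨l, hl, hker⟩ := Submodule.exists_le_ker_of_notMem hn
  apply hl
  have e : ⇑(fr.coef l φ) = fun _ => 0 := by
    funext y
    exact hker (map_mem_grd _ (h y))
  rw [← lieD_coef, lieD_apply, e, dirDeriv_const]

/-- The derivation of `C^∞(A[1])` which is, in terms of the frame and up to the cut-off function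
`χ`, the derivative along `Y`. -/
def lift {χ : Smooth E M} (hχ : tsupport χ ⊆ fr.O) : VF E F A 0 := by
  let D : Fn E F A → Fn E F A := fun φ =>
    ∑ s, Fn.ofSmooth F A (χ * lieD Y (fr.coef ((basis (F := F)).coord s) φ)) *
      fr.const (basis (F := F) s)
  have hD : ∀ φ x, (D φ).at x = χ x • ExteriorAlgebra.map (fr.ofCoord x) (fr.dcoord Y φ x) := by
    intro φ x
    rw [Fn.at_sum, dcoord, map_sum, Finset.smul_sum]
    refine Finset.sum_congr rfl fun s _ => ?_
    rw [Fn.ofSmooth_mul_at, map_smul, smul_smul]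
    rfl
  refine ⟨⟨⟨D, fun φ η => ?_⟩, fun r φ => ?_⟩, fun m φ hφ x => ?_, fun m φ hφ η => ?_⟩
  · refine Fn.ext fun x => ?_
    rw [Fn.at_add, hD, hD, hD, ← smul_add, ← map_add]
    congr 2
    refine (basis (F := F)).ext_elem fun s => ?_
    have := fun φ => fr.lieD_coef Y ((basis (F := F)).coord s) φ x
    change (basis (F := F)).coord s _ = (basis (F := F)).coord s _
    rw [map_add, ← this, ← this, ← this]
    have e : ⇑(fr.coef ((basis (F := F)).coord s) (φ + η)) = fun y =>
      fr.coef ((basis (F := F)).coord s) φ y + fr.coef ((basis (F := F)).coord s) η y := by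
      funext y; simp only [coef_apply, map_add]
    rw [lieD_apply, e]
    exact dirDeriv_add _ (Smooth.mdiffAt _ x) (Smooth.mdiffAt _ x)
  · refine Fn.ext fun x => ?_
    rw [RingHom.id_apply, Fn.at_smul, hD, hD, smul_comm r,
      ← map_smul (ExteriorAlgebra.map (fr.ofCoord x)) r]
    congr 2
    refine (basis (F := F)).ext_elem fun s => ?_
    have := fun φ => fr.lieD_coef Y ((basis (F := F)).coord s) φ x
    change (basis (F := F)).coord s _ = (basis (F := F)).coord s _
    rw [map_smul, ← this, ← this]
    have e : ⇑(fr.coef ((basis (F := F)).coord s) (r • φ)) = fun y =>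
      r * fr.coef ((basis (F := F)).coord s) φ y := by
      funext y; simp only [coef_apply, map_smul, smul_eq_mul]
    rw [lieD_apply, e]
    exact dirDeriv_const_mul _ (Smooth.mdiffAt _ x) r
  · change (D φ).at x ∈ _
    rw [hD, add_zero]
    exact Submodule.smul_mem _ _ (map_mem_grd _ (fr.dcoord_mem Y hφ x))
  · refine Fn.ext fun x => ?_
    change (D (φ * η)).at x = (D φ * η + _ • (φ * D η)).at x
    rw [zero_mul, zpow_zero, one_smul, Fn.at_add, Fn.at_mul, Fn.at_mul, hD, hD, hD]
    by_cases hx : x ∈ tsupport χ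
    · have e : ∀ θ : Fn E F A, ExteriorAlgebra.map (fr.ofCoord x) (fr.coordAt x θ) = θ.at x := by
        intro θ
        change ExteriorAlgebra.map (fr.ofCoord x) (ExteriorAlgebra.map (fr.toCoord x) (θ.at x)) = _
        rw [← AlgHom.comp_apply, ExteriorAlgebra.map_comp_map, fr.ofCoord_toCoord (hχ hx),
          ExteriorAlgebra.map_id]
        rfl
      rw [dcoord_mul, map_add, map_mul, map_mul, e, e, smul_add, smul_mul_assoc, mul_smul_comm]
    · rw [image_eq_zero_of_notMem_tsupport hx]
      simp

theorem lift_smooth {χ : Smooth E M} (hχ : tsupport χ ⊆ fr.O) (f : Smooth E M) :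
    (fr.lift Y hχ).1 (Fn.ofSmooth F A f) = Fn.ofSmooth F A (χ * lieD Y f) := by
  refine Fn.ext fun x => ?_
  have h : fr.dcoord Y (Fn.ofSmooth F A f) x = algebraMap ℝ _ (lieD Y f x) := by
    rw [fr.dcoord_eq Y {()} (fun _ => f) (fun _ => 1)]
    · simp [Algebra.algebraMap_eq_smul_one]
    · intro y
      rw [coordAt_smooth]
      simp [Algebra.algebraMap_eq_smul_one]
  have hD : ((fr.lift Y hχ).1 (Fn.ofSmooth F A f)).at x =
      χ x • ExteriorAlgebra.map (fr.ofCoord x) (fr.dcoord Y (Fn.ofSmooth F A f) x) := by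
    change Fn.at (∑ s, Fn.ofSmooth F A (χ * lieD Y (fr.coef ((basis (F := F)).coord s) _)) *
      fr.const (basis (F := F) s)) x = _
    rw [Fn.at_sum, dcoord, map_sum, Finset.smul_sum]
    refine Finset.sum_congr rfl fun s _ => ?_
    rw [Fn.ofSmooth_mul_at, map_smul, smul_smul]
    rfl
  rw [hD, h, AlgHom.commutes, Algebra.smul_def, ← map_mul]
  rfl

end Frame

variable [ContMDiffVectorBundle ∞ F A 𝓘(ℝ, E)]

variable (F A) in
/-- Every vector field on `M` is the symbol of a vector field of degree `0` on `A[1]`. -/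
theorem exists_lift [SecondCountableTopology M] (Y : Sec E E (TM E M)) :
    ∃ X : VF E F A 0, HasSymbol X.1 Y := by
  obtain ⟨X, hX⟩ := exists_vf_of_local (F := F) (A := A) (k := 0)
    (Set.range fun f : Smooth E M => Fn.ofSmooth F A f)
    (fun φ x => (Fn.ofSmooth F A (lieD Y φ.body)).at x) fun x₀ => by
      obtain ⟨fr⟩ := exists_frame E F A x₀
      obtain ⟨χ, h1, hs⟩ := exists_bump (E := E) (fr.isOpen.mem_nhds fr.mem)
      refine ⟨fr.lift Y hs, ?_⟩
      filter_upwards [h1] with x hx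
      rintro _ ⟨f, rfl⟩
      dsimp only
      rw [fr.lift_smooth, Fn.body_ofSmooth, Fn.ofSmooth_at, Fn.ofSmooth_at]
      congr 1
      change χ x * _ = _
      rw [hx, one_mul]
  refine ⟨X, fun f x => ?_⟩
  rw [hX _ ⟨f, rfl⟩ x, Fn.body_ofSmooth]
  rfl

end Lift

/-! ### The anchor of a Lie algebroid respects brackets -/

section Anchor

variable {E : Type*} [NormedAddCommGroup E] [NormedSpace ℝ E] [FiniteDimensional ℝ E]
  {M : Type*} [TopologicalSpace M] [ChartedSpace E M] [IsManifold 𝓘(ℝ, E) ∞ M] [T2Space M]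
  {F : Type*} [NormedAddCommGroup F] [NormedSpace ℝ F] [FiniteDimensional ℝ F]
  {A : M → Type*} [∀ x, AddCommGroup (A x)] [∀ x, Module ℝ (A x)]
  [∀ x, TopologicalSpace (A x)] [TopologicalSpace (Bundle.TotalSpace F A)]
  [FiberBundle F A] [VectorBundle ℝ F A] [ContMDiffVectorBundle ∞ F A 𝓘(ℝ, E)]

variable (E F) in
theorem exists_sec_eq {x : M} (v : A x) : ∃ s : Sec E F A, s x = v := by
  obtain ⟨fr⟩ := exists_frame E F A x
  refine ⟨∑ i, (fr.ε i).toFun x v • fr.e i, ?_⟩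
  rw [sec_sum_apply]
  exact fr.sum x fr.mem v

variable (E F) in
theorem exists_coSec_eq {x : M} (α : Module.Dual ℝ (A x)) :
    ∃ ξ : CoSec E F A, ξ.toFun x = α := by
  obtain ⟨fr⟩ := exists_frame E F A x
  refine ⟨⟨fun y => ∑ i, α (fr.e i x) • (fr.ε i).toFun y, fun s => ?_⟩, ?_⟩
  · simp only [LinearMap.sum_apply, LinearMap.smul_apply]
    exact contMDiff_finsetSum fun i _ => contMDiff_const.mul ((fr.ε i).smooth' s)
  · ext v
    conv_rhs => rw [← fr.sum x fr.mem v]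
    simp only [map_sum, map_smul, LinearMap.sum_apply, LinearMap.smul_apply, smul_eq_mul]
    exact Finset.sum_congr rfl fun i _ => mul_comm _ _

theorem eq_of_dirDeriv_eq {x : M} {v w : TM E M x}
    (h : ∀ f : Smooth E M, dirDeriv f x v = dirDeriv f x w) : v = w := by
  obtain ⟨c⟩ := exists_coords E x
  rw [← c.sum x c.mem v, ← c.sum x c.mem w]
  simp only [h]

theorem sec_eq_of_lieD_eq {X Y : Sec E E (TM E M)} (h : ∀ f, lieD X f = lieD Y f) : X = Y := by
  ext x
  exact eq_of_dirDeriv_eq fun f => DFunLike.congr_fun (h f) x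

theorem LieAlgebroid.bracket_fsmul (L : LieAlgebroid E F A) (a b : Sec E F A) (f : Smooth E M) :
    L.bracket a (fsmul f b) = fsmul f (L.bracket a b) + fsmul (lieD (L.anchor.onSec a) f) b := by
  ext x
  exact L.leibniz f a b x

/-- The anchor of a Lie algebroid respects brackets, as operators on functions: compare the Jacobi
identities for `a, b, c` and for `a, b, f c`. Where the fibre vanishes both sides do. -/
theorem LieAlgebroid.lieD_anchor_bracket (L : LieAlgebroid E F A) (a b : Sec E F A)
    (f : Smooth E M) : lieD (L.anchor.onSec (L.bracket a b)) f =
      lieD (L.anchor.onSec a) (lieD (L.anchor.onSec b) f)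
        - lieD (L.anchor.onSec b) (lieD (L.anchor.onSec a) f) := by
  ext x
  rw [ContMDiffMap.coe_sub, Pi.sub_apply]
  by_cases hA : ∃ v : A x, v ≠ 0
  · obtain ⟨v, hv⟩ := hA
    obtain ⟨c, rfl⟩ := exists_sec_eq E F v
    have h := congrArg (fun s => s x) (L.jacobi a b (fsmul f c))
    simp only [L.bracket_fsmul, L.bracket_add, ContMDiffSection.coe_add, Pi.add_apply,
      fsmul_apply] at h
    have hj := congrArg (fun s => f x • s x) (L.jacobi a b c)
    simp only [ContMDiffSection.coe_add, Pi.add_apply, smul_add] at hj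
    rw [hj] at h
    have h0 : (lieD (L.anchor.onSec a) (lieD (L.anchor.onSec b) f) x
        - lieD (L.anchor.onSec b) (lieD (L.anchor.onSec a) f) x
        - lieD (L.anchor.onSec (L.bracket a b)) f x) • c x = 0 := by
      rw [sub_smul, sub_smul, ← sub_eq_zero.2 h]
      abel
    have := (smul_eq_zero.1 h0).resolve_right hv
    linarith
  · push Not at hA
    have h0 : ∀ (c : Sec E F A) (g : Smooth E M), lieD (L.anchor.onSec c) g x = 0 := by
      intro c g
      change dform g x (L.anchor.toFun x (c x)) = 0
      rw [hA (c x), map_zero, map_zero]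
    rw [h0, h0, h0, sub_zero]

variable (E M) in
/-- The identity of the tangent bundle. -/
def idMap : BundleMap E E (TM E M) E (TM E M) where
  toFun _ := LinearMap.id
  smooth' s := s.contMDiff

theorem idMap_onSec (X : Sec E E (TM E M)) : (idMap E M).onSec X = X := rfl

/-- The Lie bracket of vector fields is the commutator of derivations: this is the compatibility of
the anchor with brackets for the Lie algebroid `(TM)_N` with `N = id`, which is `TM`. -/
theorem lieD_vfBracket (X Y : Sec E E (TM E M)) (f : Smooth E M) :
    lieD (vfBracket X Y) f = lieD X (lieD Y f) - lieD Y (lieD X f) := by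
  have hN : IsNijenhuis (idMap E M) := fun X Y => by simp only [idMap_onSec]; abel
  have h := (nijenhuisAlgebroid (idMap E M) hN).lieD_anchor_bracket X Y f
  have e : nijBracket (idMap E M) X Y = vfBracket X Y := by
    simp only [nijBracket, idMap_onSec]; abel
  change lieD ((idMap E M).onSec (nijBracket (idMap E M) X Y)) f = _ at h
  rw [e] at h
  exact h

/-- The anchor of a Lie algebroid respects brackets. -/
theorem LieAlgebroid.anchor_bracket (L : LieAlgebroid E F A) (a b : Sec E F A) :
    L.anchor.onSec (L.bracket a b) = vfBracket (L.anchor.onSec a) (L.anchor.onSec b) :=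
  sec_eq_of_lieD_eq fun f => by rw [L.lieD_anchor_bracket, lieD_vfBracket]

end Anchor

/-! ### Local generators of the module of vector fields -/

section Generation

variable {E : Type*} [NormedAddCommGroup E] [NormedSpace ℝ E] [FiniteDimensional ℝ E]
  {M : Type*} [TopologicalSpace M] [ChartedSpace E M] [IsManifold 𝓘(ℝ, E) ∞ M] [T2Space M]
  {F : Type*} [NormedAddCommGroup F] [NormedSpace ℝ F] [FiniteDimensional ℝ F]
  {A : M → Type*} [∀ x, AddCommGroup (A x)] [∀ x, Module ℝ (A x)]
  [∀ x, TopologicalSpace (A x)] [TopologicalSpace (Bundle.TotalSpace F A)]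
  [FiberBundle F A] [VectorBundle ℝ F A]

/-- Vector fields of the same degree on `A[1]` agree at `x` if they do so on local coordinates of
`A[1]`. -/
theorem vf_eq_at_of_coords {k : ℤ} (X X' : VF E F A k) {x₀ x₁ x : M} (c : Coords E x₀)
    (fr : Frame E F A x₁) (hc : x ∈ c.O) (hfr : x ∈ fr.O)
    (hq : ∀ i, (X.1 (Fn.ofSmooth F A (c.q i))).at x = (X'.1 (Fn.ofSmooth F A (c.q i))).at x)
    (hε : ∀ i, (X.1 (Fn.ofCoSec (fr.ε i))).at x = (X'.1 (Fn.ofCoSec (fr.ε i))).at x)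
    (φ : Fn E F A) : (X.1 φ).at x = (X'.1 φ).at x := by
  have hf : ∀ f, (X.1 (Fn.ofSmooth F A f)).at x = (X'.1 (Fn.ofSmooth F A f)).at x := fun f => by
    rw [symb_dform, symb_dform, symb_eq_sum X c hc, symb_eq_sum X' c hc]
    simp only [hq]
  refine vf_eq_at X X' hf (fun ξ => ?_) φ
  rw [vf_coSec X fr hfr, vf_coSec X' fr hfr]
  simp only [hf, hε]

theorem vfMul_apply {m k : ℤ} (f : Fn E F A) (hf : f ∈ FnDeg E F A m) (X : VF E F A k)
    (φ : Fn E F A) : (vfMul f hf X).1 φ = f * X.1 φ := rfl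

theorem vfCast_coe {k l : ℤ} (h : k = l) (X : VF E F A k) : (vfCast h X).1 = X.1 := rfl

theorem Fn.mul_smooth_at (φ : Fn E F A) (f : Smooth E M) (x : M) :
    (φ * Fn.ofSmooth F A f).at x = f x • φ.at x := by
  rw [Fn.at_mul, Fn.ofSmooth_at, ← Algebra.commutes, ← Algebra.smul_def]

theorem Tensor.map_vfSmul {p k : ℤ} (T : Tensor E F A p) (f : Smooth E M) (X : VF E F A k) :
    (T.toFun k (vfSmul f X)).1 = (vfSmul f (T.toFun k X)).1 := by
  have h := T.map_mul (Fn.ofSmooth F A f) (Fn.ofSmooth_mem f) X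
  rw [mul_zero, zpow_zero, one_smul] at h
  rw [T.congr (zero_add k).symm (vfSmul f X) (vfMul _ (Fn.ofSmooth_mem f) X) rfl, h]
  rfl

theorem symb_vfMul {m k : ℤ} (f : Fn E F A) (hf : f ∈ FnDeg E F A m) (X : VF E F A k) (x : M)
    (α : Module.Dual ℝ (TM E M x)) :
    symb (vfMul f hf X).1 x α = f.at x * symb X.1 x α :=
  LinearMap.congr_fun (symb_eq_of_forall (vfMul f hf X)
    (L := LinearMap.mulLeft ℝ (f.at x) ∘ₗ symb X.1 x) fun g => by
      rw [vfMul_apply, Fn.at_mul, symb_dform]; rfl) α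

theorem symb_vfSmul {k : ℤ} (f : Smooth E M) (X : VF E F A k) (x : M)
    (α : Module.Dual ℝ (TM E M x)) : symb (vfSmul f X).1 x α = f x • symb X.1 x α :=
  LinearMap.congr_fun (symb_eq_of_forall (vfSmul f X)
    (L := f x • symb X.1 x) fun g => by
      rw [vfSmul_at, symb_dform]; rfl) α

theorem symb_add {k : ℤ} (X Y : VF E F A k) (x : M) :
    symb (X + Y).1 x = symb X.1 x + symb Y.1 x :=
  symb_eq_of_forall (X + Y) fun g => by
    rw [LinearMap.add_apply, ← symb_dform, ← symb_dform]; rfl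

theorem symb_smul {k : ℤ} (r : ℝ) (X : VF E F A k) (x : M) :
    symb (r • X).1 x = r • symb X.1 x :=
  symb_eq_of_forall (r • X) fun g => by
    rw [LinearMap.smul_apply, ← symb_dform]; rfl

theorem symb_of_hasSymbol {X : VF E F A 0} {Y : Sec E E (TM E M)} (h : HasSymbol X.1 Y) (x : M)
    (α : Module.Dual ℝ (TM E M x)) : symb X.1 x α = algebraMap ℝ _ (α (Y x)) :=
  LinearMap.congr_fun (symb_eq_of_forall X
    (L := Algebra.linearMap ℝ _ ∘ₗ LinearMap.applyₗ (Y x)) fun g => h g x) α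

theorem symb_eq_zero {k : ℤ} {X : VF E F A k} {x : M}
    (h : ∀ f, (X.1 (Fn.ofSmooth F A f)).at x = 0) : symb X.1 x = 0 :=
  symb_eq_of_forall X fun f => by rw [h, LinearMap.zero_apply]

variable [ContMDiffVectorBundle ∞ F A 𝓘(ℝ, E)]

/-- The vector fields on `A[1]` are locally generated, as a module over the functions, by those of
degrees `0` and `-1`: with coordinates `q i`, lifts `D i` of the coordinate fields and a frame `e a`
with dual frame `ε a`, one has `X = ∑ X(q i) D i + ∑ (X(ε a) - ∑ X(q i) D i (ε a)) (e a)^↑`. -/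
theorem vf_induction [SecondCountableTopology M] {P : ∀ k, VF E F A k → Prop}
    (add : ∀ k X Y, P k X → P k Y → P k (X + Y))
    (mul : ∀ m k f hf X, P k X → P (m + k) (vfMul f hf X))
    (loc : ∀ k X, (∀ x₀, ∃ χ : Smooth E M, χ x₀ = 1 ∧ P k (vfSmul χ X)) → P k X)
    (zero : ∀ X, P 0 X) (neg : ∀ X, P (-1) X) (k : ℤ) (X : VF E F A k) : P k X := by
  have cast : ∀ {k l : ℤ} (h : k = l) (X : VF E F A k), P k X → P l (vfCast h X) := by
    rintro k _ rfl X h; exact h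
  have sum : ∀ {ι : Type _} (s : Finset ι) (k : ℤ) (Z : ι → VF E F A k) (Y : VF E F A k), P k Y →
      (∀ i ∈ s, P k (Z i)) → P k (Y + ∑ i ∈ s, Z i) := by
    classical
    intro ι s k Z Y hY
    induction s using Finset.induction_on with
    | empty => intro _; simpa using hY
    | insert a s ha ih =>
      intro h
      rw [Finset.sum_insert ha, add_left_comm]
      exact add _ _ _ (h a (by simp)) (ih fun i hi => h i (Finset.mem_insert_of_mem hi))
  refine loc k X fun x₀ => ?_
  obtain ⟨c⟩ := exists_coords E x₀
  obtain ⟨fr⟩ := exists_frame E F A x₀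
  obtain ⟨χ, h1, hs⟩ := exists_bump (E := E)
    (Filter.inter_mem (c.isOpen.mem_nhds c.mem) (fr.isOpen.mem_nhds fr.mem))
  choose D hD using fun i => exists_lift F A (c.D i)
  have hp : ∀ i, Fn.ofSmooth F A χ * X.1 (Fn.ofSmooth F A (c.q i)) ∈ FnDeg E F A k := fun i => by
    have := FnDeg_mul (Fn.ofSmooth_mem χ) (vf_mem X (Fn.ofSmooth_mem (F := F) (A := A) (c.q i)))
    rwa [zero_add, zero_add] at this
  have hg : ∀ a, Fn.ofSmooth F A χ * X.1 (Fn.ofCoSec (fr.ε a))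
      - ∑ i, Fn.ofSmooth F A χ * X.1 (Fn.ofSmooth F A (c.q i)) * (D i).1 (Fn.ofCoSec (fr.ε a))
        ∈ FnDeg E F A (k + 1) := fun a => by
    refine sub_mem ?_ (sum_mem fun i _ => ?_)
    · have := FnDeg_mul (Fn.ofSmooth_mem χ) (vf_mem X (Fn.ofCoSec_mem (fr.ε a)))
      rwa [zero_add, add_comm] at this
    · have := FnDeg_mul (hp i) (vf_mem (D i) (Fn.ofCoSec_mem (fr.ε a)))
      rwa [add_zero] at this
  refine ⟨χ, h1.self_of_nhds, ?_⟩
  have e : vfSmul χ X = (0 : ℝ) • vfSmul χ X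
      + ∑ i, vfCast (add_zero k) (vfMul _ (hp i) (D i))
      + ∑ a, vfCast (by ring) (vfMul _ (hg a) (vert (fr.e a))) := by
    refine Subtype.ext (LinearMap.ext fun φ => Fn.ext fun x => ?_)
    by_cases hx : x ∈ tsupport χ
    · refine vf_eq_at_of_coords _ _ c fr (hs hx).1 (hs hx).2 (fun j => ?_) (fun b => ?_) φ
      · simp only [zero_smul, zero_add, Submodule.coe_add, LinearMap.add_apply, Fn.at_add,
          vf_sum_at, vfCast_coe, vfMul_apply, vert_smooth, mul_zero, Fn.at_zero,
          Finset.sum_const_zero, add_zero, vfSmul_apply]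
        rw [Finset.sum_eq_single j]
        · rw [Fn.at_mul _ ((D j).1 _), hD, c.dual x (hs hx).1]; simp
        · intro i _ hij
          rw [Fn.at_mul _ ((D i).1 _), hD, c.dual x (hs hx).1, if_neg (Ne.symm hij)]; simp
        · simp
      · simp only [zero_smul, zero_add, Submodule.coe_add, LinearMap.add_apply, Fn.at_add,
          vf_sum_at, vfCast_coe, vfMul_apply, vert_coSec, vfSmul_apply]
        rw [Finset.sum_eq_single b (f := fun a => Fn.at (_ * Fn.ofSmooth F A _) x)]
        · rw [Fn.mul_smooth_at, CoSec.pair_apply, fr.dual x (hs hx).2, if_pos rfl, one_smul,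
            Fn.at_sub, Fn.at_sum]
          abel
        · intro i _ hij
          rw [Fn.mul_smooth_at, CoSec.pair_apply, fr.dual x (hs hx).2, if_neg (Ne.symm hij),
            zero_smul]
        · simp
    · have h0 : χ x = 0 := image_eq_zero_of_notMem_tsupport hx
      simp only [zero_smul, zero_add, Submodule.coe_add, LinearMap.add_apply, Fn.at_add,
          vf_sum_at, vfCast_coe, vfMul_apply, vfSmul_apply]
      simp [Fn.at_mul, Fn.at_sub, Fn.at_sum, Fn.ofSmooth_at, h0]
  rw [e]
  -- `0 • vfSmul χ X` starts the two sums; it is a multiple of a vector field of degree `0`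
  have h0 : P k ((0 : ℝ) • vfSmul χ X) := by
    have hz : (0 : Fn E F A) ∈ FnDeg E F A k := zero_mem _
    have := cast (add_zero k) _ (mul k 0 0 hz 0 (zero 0))
    convert this using 1
    refine Subtype.ext (LinearMap.ext fun φ => ?_)
    rw [zero_smul, vfCast_coe, vfMul_apply, zero_mul]; rfl
  exact sum _ _ _ _ (sum _ _ _ _ h0 fun i _ => cast _ _ (mul _ _ _ _ _ (zero _)))
    fun a _ => cast _ _ (mul _ _ _ _ _ (neg _))

end Generation

/-! ### Tensors of internal degree `-1` -/

theorem ιInv_algebraMap {W : Type*} [AddCommGroup W] [Module ℝ W] (r : ℝ) :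
    ExteriorAlgebra.ιInv (algebraMap ℝ (ExteriorAlgebra ℝ W) r) = 0 := by
  let : Module ℝᵐᵒᵖ W := Module.compHom _ ((RingHom.id ℝ).fromOpposite mul_comm)
  have : IsCentralScalar ℝ W := ⟨fun r m => rfl⟩
  change TrivSqZeroExt.snd (ExteriorAlgebra.toTrivSqZeroExt (algebraMap ℝ _ r)) = 0
  rw [AlgHom.commutes]; rfl

section CoreLift

variable {E : Type*} [NormedAddCommGroup E] [NormedSpace ℝ E] [FiniteDimensional ℝ E]
  {M : Type*} [TopologicalSpace M] [ChartedSpace E M] [IsManifold 𝓘(ℝ, E) ∞ M] [T2Space M]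
  [SecondCountableTopology M]
  {F : Type*} [NormedAddCommGroup F] [NormedSpace ℝ F] [FiniteDimensional ℝ F]
  {A : M → Type*} [∀ x, AddCommGroup (A x)] [∀ x, Module ℝ (A x)]
  [∀ x, TopologicalSpace (A x)] [TopologicalSpace (Bundle.TotalSpace F A)]
  [FiberBundle F A] [VectorBundle ℝ F A] [ContMDiffVectorBundle ∞ F A 𝓘(ℝ, E)]

/-- The formula for `V = U^↑` on vector fields of all degrees: `V X` is vertical, and
`(V X) ξ = (-1)^k σ_X(Uᵀ ξ)` for a section `ξ` of `A^*`, where `σ_X` is the symbol of the vector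
field `X` of degree `k`. The sign makes this linear over the functions, as `V` has degree `-1`. -/
def IsLift (U : BundleMap E E (TM E M) F A) (V : Tensor E F A (-1)) : Prop :=
  ∀ k (X : VF E F A k) (x : M),
    (∀ f, ((V.toFun k X).1 (Fn.ofSmooth F A f)).at x = 0) ∧
    ∀ ξ, ((V.toFun k X).1 (Fn.ofCoSec ξ)).at x =
      (-1 : ℝ) ^ k • symb X.1 x (ξ.toFun x ∘ₗ U.toFun x)

theorem vfSmul_at_one {k : ℤ} {χ : Smooth E M} {x : M} (h : χ x = 1) (X : VF E F A k)
    (φ : Fn E F A) : ((vfSmul χ X).1 φ).at x = (X.1 φ).at x := by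
  rw [vfSmul_at, h, one_smul]

theorem Tensor.map_vfSmul_at {p k : ℤ} (T : Tensor E F A p) {χ : Smooth E M} {x : M}
    (h : χ x = 1) (X : VF E F A k) (φ : Fn E F A) :
    ((T.toFun k (vfSmul χ X)).1 φ).at x = ((T.toFun k X).1 φ).at x := by
  rw [T.map_vfSmul, vfSmul_at_one h]

theorem Tensor.neg_one_apply_neg_one (V : Tensor E F A (-1)) (X : VF E F A (-1)) :
    V.toFun (-1) X = 0 := vf_eq_zero_of_lt (by norm_num) _

/-- The vector fields of degree `0` determine a tensor of internal degree `-1`, as those of degree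
`-1`, the other generators, are sent to vector fields of degree `-2`, which vanish. -/
theorem isLift_of_isCoreLift {U : BundleMap E E (TM E M) F A} {V : Tensor E F A (-1)}
    (h : IsCoreLift U V) : IsLift U V := by
  intro k X
  refine vf_induction (P := fun k X => ∀ x,
    (∀ f, ((V.toFun k X).1 (Fn.ofSmooth F A f)).at x = 0) ∧
    ∀ ξ, ((V.toFun k X).1 (Fn.ofCoSec ξ)).at x =
      (-1 : ℝ) ^ k • symb X.1 x (ξ.toFun x ∘ₗ U.toFun x)) ?_ ?_ ?_ ?_ ?_ k X
  · intro k X Y hX hY x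
    simp only [map_add, Submodule.coe_add, LinearMap.add_apply, Fn.at_add, (hX x).1, (hY x).1,
      (hX x).2, (hY x).2, add_zero, implies_true, true_and]
    intro ξ
    rw [← Submodule.coe_add, symb_add, LinearMap.add_apply, smul_add]
  · intro m k f hf X hX x
    simp only [V.map_mul, LinearMap.smul_apply, Fn.at_smul, vfMul_apply, Fn.at_mul, (hX x).1,
      (hX x).2, mul_zero, smul_zero, implies_true, true_and]
    intro ξ
    rw [symb_vfMul, mul_smul_comm, smul_smul, sgn_add]
    congr 2
    rw [neg_one_mul, zpow_neg]
    exact (eq_inv_of_mul_eq_one_left (sgn_mul_self m)).symm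
  · intro k X hX x
    obtain ⟨χ, h1, hχ⟩ := hX x
    refine ⟨fun f => ?_, fun ξ => ?_⟩
    · rw [← V.map_vfSmul_at h1, (hχ x).1]
    · rw [← V.map_vfSmul_at h1, (hχ x).2, symb_vfSmul, h1, one_smul]
  · intro X x
    obtain ⟨Y, hY⟩ := exists_symbol X
    rw [h X Y hY]
    refine ⟨fun f => by rw [vert_smooth, Fn.at_zero], fun ξ => ?_⟩
    rw [vert_coSec, symb_of_hasSymbol hY, zpow_zero, one_smul, Fn.ofSmooth_at]
    rfl
  · intro X x
    rw [V.neg_one_apply_neg_one, symb_eq_zero fun f => by rw [vf_neg_smooth (by norm_num)]; rfl]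
    refine ⟨fun f => rfl, fun ξ => ?_⟩
    rw [LinearMap.zero_apply, smul_zero]; rfl

theorem IsLift.isCoreLift {U : BundleMap E E (TM E M) F A} {V : Tensor E F A (-1)}
    (h : IsLift U V) : IsCoreLift U V := by
  intro X Y hY
  refine congrArg Subtype.val (vf_ext (X := V.toFun 0 X)
    (X' := vfCast (zero_add _).symm (vert (U.onSec Y)))
    (fun f => Fn.ext fun x => ?_) fun ξ => Fn.ext fun x => ?_)
  · rw [(h 0 X x).1, vfCast_coe, vert_smooth, Fn.at_zero]
  · rw [(h 0 X x).2, vfCast_coe, vert_coSec, symb_of_hasSymbol hY, zpow_zero,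
      one_smul, Fn.ofSmooth_at]
    rfl

/-- The value of `U^↑` on `X`. In coordinates it is `(-1)^k ∑ X(q i) (U D i)^↑`, and the result does
not depend on the coordinates. -/
theorem exists_vertical {k : ℤ} (U : BundleMap E E (TM E M) F A) (X : VF E F A k) :
    ∃ Z : VF E F A (k + -1), ∀ x, (∀ f, (Z.1 (Fn.ofSmooth F A f)).at x = 0) ∧
      ∀ ξ, (Z.1 (Fn.ofCoSec ξ)).at x = (-1 : ℝ) ^ k • symb X.1 x (ξ.toFun x ∘ₗ U.toFun x) := by
  have hι := fun x : M => ιInv_algebraMap (W := Module.Dual ℝ (A x))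
  have hι' : ∀ (x : M) (ξ : Module.Dual ℝ (A x)),
      ExteriorAlgebra.ιInv (ExteriorAlgebra.ι ℝ ξ) = ξ := fun x => ExteriorAlgebra.ι_leftInverse
  -- `ιInv` recovers `ξ` from the value of the function on `A[1]` and kills functions on `M`
  obtain ⟨Z, hZ⟩ := exists_vf_of_local (k := k + -1)
    (S := {φ | (∃ f, φ = Fn.ofSmooth F A f) ∨ ∃ ξ, φ = Fn.ofCoSec ξ})
    (G := fun φ x => (-1 : ℝ) ^ k •
      symb X.1 x (ExteriorAlgebra.ιInv (φ.at x) ∘ₗ U.toFun x)) fun x₀ => by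
    obtain ⟨c⟩ := exists_coords E x₀
    refine ⟨∑ i, (-1 : ℝ) ^ k • vfCast (by rw [zero_add]) (vfMul _
      (vf_mem X (Fn.ofSmooth_mem (F := F) (A := A) (c.q i))) (vert (U.onSec (c.D i)))), ?_⟩
    filter_upwards [c.eventually c.mem] with x hx
    rintro _ (⟨f, rfl⟩ | ⟨ξ, rfl⟩)
    · rw [vf_sum_at, Fn.ofSmooth_at, hι, LinearMap.zero_comp, map_zero, smul_zero]
      refine Finset.sum_eq_zero fun i _ => ?_
      rw [Submodule.coe_smul, vfCast_coe, LinearMap.smul_apply, vfMul_apply, vert_smooth, mul_zero,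
        smul_zero, Fn.at_zero]
    · rw [vf_sum_at, Fn.ofCoSec_at, hι', symb_eq_sum X c hx, Finset.smul_sum]
      refine Finset.sum_congr rfl fun i _ => ?_
      rw [Submodule.coe_smul, vfCast_coe, LinearMap.smul_apply, vfMul_apply, vert_coSec,
        Fn.at_smul, Fn.mul_smooth_at]
      rfl
  refine ⟨Z, fun x => ⟨fun f => ?_, fun ξ => ?_⟩⟩
  · rw [hZ _ (Or.inl ⟨f, rfl⟩), Fn.ofSmooth_at, hι, LinearMap.zero_comp, map_zero, smul_zero]
  · rw [hZ _ (Or.inr ⟨ξ, rfl⟩), Fn.ofCoSec_at, hι']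

/-- Existence of the tensor `U^↑`. -/
theorem exists_isLift (U : BundleMap E E (TM E M) F A) : ∃ V : Tensor E F A (-1), IsLift U V := by
  choose Z hZ using fun (k : ℤ) (X : VF E F A k) => exists_vertical U X
  refine ⟨⟨fun k => ⟨⟨Z k, fun X Y => ?_⟩, fun r X => ?_⟩, fun {m k} f hf X => ?_⟩, hZ⟩
  · refine vf_ext (fun f => Fn.ext fun x => ?_) fun ξ => Fn.ext fun x => ?_
    · rw [(hZ k _ x).1, Submodule.coe_add, LinearMap.add_apply, Fn.at_add, (hZ k _ x).1,
        (hZ k _ x).1, add_zero]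
    · rw [(hZ k _ x).2, Submodule.coe_add (Z k X), LinearMap.add_apply, Fn.at_add, (hZ k _ x).2,
        (hZ k _ x).2, symb_add, LinearMap.add_apply, smul_add]
  · refine vf_ext (fun f => Fn.ext fun x => ?_) fun ξ => Fn.ext fun x => ?_
    · rw [(hZ k _ x).1, RingHom.id_apply, Submodule.coe_smul, LinearMap.smul_apply, Fn.at_smul,
        (hZ k _ x).1, smul_zero]
    · rw [(hZ k _ x).2, RingHom.id_apply, Submodule.coe_smul (x := Z k X), LinearMap.smul_apply,
        Fn.at_smul, (hZ k _ x).2, symb_smul, LinearMap.smul_apply, smul_comm]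
  · refine congrArg Subtype.val (vf_ext (X := Z (m + k) (vfMul f hf X))
      (X' := (-1 : ℝ) ^ (-1 * m) • vfCast (by ring) (vfMul f hf (Z k X)))
      (fun g => Fn.ext fun x => ?_) fun ξ => Fn.ext fun x => ?_)
    · rw [(hZ _ _ x).1, Submodule.coe_smul, vfCast_coe, LinearMap.smul_apply, Fn.at_smul,
        vfMul_apply, Fn.at_mul, (hZ _ _ x).1, mul_zero, smul_zero]
    · rw [(hZ _ _ x).2, Submodule.coe_smul, vfCast_coe, LinearMap.smul_apply, Fn.at_smul,
        vfMul_apply, Fn.at_mul, (hZ _ _ x).2, symb_vfMul, mul_smul_comm, smul_smul, sgn_add]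
      congr 2
      rw [neg_one_mul, zpow_neg]
      exact eq_inv_of_mul_eq_one_left (sgn_mul_self m)

/-- A tensor of internal degree `-1` kills the vector fields which kill the functions on `M`: these
are locally combinations of vertical lifts. -/
theorem Tensor.apply_eq_zero_of_vertical (V : Tensor E F A (-1)) {k : ℤ} {Z : VF E F A k}
    (hZ : ∀ f, Z.1 (Fn.ofSmooth F A f) = 0) : V.toFun k Z = 0 := by
  refine Subtype.ext (LinearMap.ext fun φ => Fn.ext fun x₀ => ?_)
  obtain ⟨fr⟩ := exists_frame E F A x₀
  obtain ⟨χ, h1, hs⟩ := exists_bump (E := E) (fr.isOpen.mem_nhds fr.mem)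
  have hp : ∀ i, Fn.ofSmooth F A χ * Z.1 (Fn.ofCoSec (fr.ε i)) ∈ FnDeg E F A (k + 1) := fun i => by
    have := FnDeg_mul (Fn.ofSmooth_mem χ) (vf_mem Z (Fn.ofCoSec_mem (fr.ε i)))
    rwa [zero_add, add_comm] at this
  have e : vfSmul χ Z = ∑ i, vfCast (by ring) (vfMul _ (hp i) (vert (fr.e i))) := by
    refine vf_ext (fun f => ?_) fun ξ => Fn.ext fun x => ?_
    · rw [vfSmul_apply, hZ, mul_zero]
      refine Fn.ext fun x => ?_
      rw [vf_sum_at]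
      exact (Finset.sum_eq_zero fun i _ => by
        rw [vfCast_coe, vfMul_apply, vert_smooth, mul_zero, Fn.at_zero]).symm
    · rw [vfSmul_at, vf_sum_at]
      simp only [vfCast_coe, vfMul_apply, vert_coSec, Fn.mul_smooth_at, Fn.ofSmooth_mul_at]
      by_cases hx : x ∈ tsupport χ
      · rw [vf_coSec Z fr (hs hx), Finset.smul_sum]
        refine Finset.sum_congr rfl fun i _ => ?_
        rw [hZ, Fn.at_zero, zero_mul, zero_add, smul_comm]
      · simp [image_eq_zero_of_notMem_tsupport hx]
  rw [← V.map_vfSmul_at h1.self_of_nhds, e, map_sum, vf_sum_at]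
  refine Finset.sum_eq_zero fun i _ => ?_
  rw [V.congr (by ring) (vfCast _ _) (vfMul _ (hp i) (vert (fr.e i))) rfl, V.map_mul,
    V.neg_one_apply_neg_one, LinearMap.smul_apply, Fn.at_smul, vfMul_apply]
  change _ • Fn.at (_ * 0) x₀ = 0
  rw [mul_zero, Fn.at_zero, smul_zero]

theorem HasSymbol.add {X X' : VF E F A 0} {Y Y' : Sec E E (TM E M)} (h : HasSymbol X.1 Y)
    (h' : HasSymbol X'.1 Y') : HasSymbol (X + X').1 (Y + Y') := fun f x => by
  rw [Submodule.coe_add, LinearMap.add_apply, Fn.at_add, h, h', ← map_add]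
  exact congrArg _ (dirDeriv_vadd (Y x) f (Y' x)).symm

theorem HasSymbol.vfSmul {X : VF E F A 0} {Y : Sec E E (TM E M)} (h : HasSymbol X.1 Y)
    (g : Smooth E M) : HasSymbol (vfSmul g X).1 (fsmul g Y) := fun f x => by
  rw [vfSmul_at, h, fsmul_apply, dirDeriv_vsmul, map_mul, Algebra.smul_def]

end CoreLift

/-! ### Almost tangent structures of internal degree `-1` -/

section AlmostTangent

variable {E : Type*} [NormedAddCommGroup E] [NormedSpace ℝ E] [FiniteDimensional ℝ E]
  {M : Type*} [TopologicalSpace M] [ChartedSpace E M] [IsManifold 𝓘(ℝ, E) ∞ M] [T2Space M]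
  [SecondCountableTopology M]
  {F : Type*} [NormedAddCommGroup F] [NormedSpace ℝ F] [FiniteDimensional ℝ F]
  {A : M → Type*} [∀ x, AddCommGroup (A x)] [∀ x, Module ℝ (A x)]
  [∀ x, TopologicalSpace (A x)] [TopologicalSpace (Bundle.TotalSpace F A)]
  [FiberBundle F A] [VectorBundle ℝ F A] [ContMDiffVectorBundle ∞ F A 𝓘(ℝ, E)]

theorem BundleMap.ext_apply {F' : Type*} [NormedAddCommGroup F'] [NormedSpace ℝ F']
    {B : M → Type*} [∀ x, AddCommGroup (B x)] [∀ x, Module ℝ (B x)]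
    [∀ x, TopologicalSpace (B x)] [TopologicalSpace (Bundle.TotalSpace F' B)]
    [FiberBundle F' B] {U U' : BundleMap E F A F' B}
    (h : ∀ x v, U.toFun x v = U'.toFun x v) : U = U' := by
  cases U; cases U'
  congr
  funext x
  exact LinearMap.ext (h x)

theorem BundleMap.onSec_fsmul {F' : Type*} [NormedAddCommGroup F'] [NormedSpace ℝ F']
    {B : M → Type*} [∀ x, AddCommGroup (B x)] [∀ x, Module ℝ (B x)]
    [∀ x, TopologicalSpace (B x)] [TopologicalSpace (Bundle.TotalSpace F' B)]
    [FiberBundle F' B] [VectorBundle ℝ F' B] (U : BundleMap E F A F' B) (f : Smooth E M)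
    (s : Sec E F A) : U.onSec (fsmul f s) = fsmul f (U.onSec s) := by
  ext x; exact map_smul (U.toFun x) _ _

theorem vert_add (a b : Sec E F A) : vert (a + b) = vert a + vert b := by
  refine vf_ext (fun f => ?_) fun ξ => ?_
  · rw [Submodule.coe_add, LinearMap.add_apply, vert_smooth, vert_smooth, vert_smooth, add_zero]
  · rw [Submodule.coe_add, LinearMap.add_apply, vert_coSec, vert_coSec, vert_coSec]
    refine Fn.ext fun x => ?_
    rw [Fn.at_add, Fn.ofSmooth_at, Fn.ofSmooth_at, Fn.ofSmooth_at, ← map_add]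
    exact congrArg _ (map_add (ξ.toFun x) _ _)

theorem vert_fsmul (f : Smooth E M) (a : Sec E F A) : vert (fsmul f a) = vfSmul f (vert a) := by
  refine vf_ext (fun g => ?_) fun ξ => Fn.ext fun x => ?_
  · rw [vfSmul_apply, vert_smooth, vert_smooth, mul_zero]
  · rw [vfSmul_at, vert_coSec, vert_coSec, Fn.ofSmooth_at, Fn.ofSmooth_at, Algebra.smul_def,
      ← map_mul]
    exact congrArg _ (map_smul (ξ.toFun x) _ _)

theorem vert_sub (a b : Sec E F A) : (vert (a - b)).1 = (vert a).1 - (vert b).1 := by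
  rw [eq_sub_iff_add_eq, ← Submodule.coe_add, ← vert_add, sub_add_cancel]

theorem vert_zero : (vert (0 : Sec E F A)).1 = 0 := by
  rw [← sub_self (0 : Sec E F A), vert_sub, sub_self]

/-- A vector field on `M`, cut off in a coordinate domain, as a combination of the coordinate fields
with global coefficients. -/
theorem Coords.fsmul_eq_sum {x₀ : M} (c : Coords E x₀) {χ : Smooth E M} (hs : tsupport χ ⊆ c.O)
    (Y : Sec E E (TM E M)) : fsmul χ Y = ∑ i, fsmul (χ * lieD Y (c.q i)) (c.D i) := by
  ext x
  rw [sec_sum_apply]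
  by_cases hx : x ∈ tsupport χ
  · simp only [fsmul_apply, ContMDiffMap.coe_mul, Pi.mul_apply, mul_smul, lieD_apply]
    rw [← Finset.smul_sum, c.sum x (hs hx)]
  · simp [fsmul_apply, image_eq_zero_of_notMem_tsupport hx]

/-- Every tensor of internal degree `-1` on `A[1]` comes from a bundle map `TM → A`: on vector
fields of degree `0` it only depends on the symbol and is linear over the functions on `M`. -/
theorem exists_isCoreLift (V : Tensor E F A (-1)) :
    ∃ U : BundleMap E E (TM E M) F A, IsCoreLift U V := by
  choose lift hlift using fun Y => exists_lift (E := E) (M := M) F A Y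
  choose u hu using fun Y => exists_vert (vfCast (zero_add _) (V.toFun 0 (lift Y)))
  have hu' : ∀ X Y, HasSymbol X.1 Y → (V.toFun 0 X).1 = (vert (u Y)).1 := by
    intro X Y h
    have h0 : V.toFun 0 (X - lift Y) = 0 := V.apply_eq_zero_of_vertical fun f => Fn.ext fun x => by
      rw [Submodule.coe_sub, LinearMap.sub_apply, Fn.at_sub, h, hlift, sub_self, Fn.at_zero]
    have h1 := sub_eq_zero.1 ((map_sub (V.toFun 0) X (lift Y)).symm.trans h0)
    rw [h1, ← hu, vfCast_coe]
  have hadd : ∀ Y Y', u (Y + Y') = u Y + u Y' := fun Y Y' => vert_injective <| by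
    rw [← hu' _ _ ((hlift Y).add (hlift Y')), map_add, vert_add, Submodule.coe_add,
      Submodule.coe_add, hu' _ _ (hlift Y), hu' _ _ (hlift Y')]
  have hsmul : ∀ g Y, u (fsmul g Y) = fsmul g (u Y) := fun g Y => vert_injective <| by
    rw [← hu' _ _ ((hlift Y).vfSmul g), V.map_vfSmul, vert_fsmul]
    refine LinearMap.ext fun φ => ?_
    rw [vfSmul_apply, vfSmul_apply, hu' _ _ (hlift Y)]
  -- the `C^∞(M)`-linear map `u` on sections is pointwise
  let U : ∀ x, TM E M x →ₗ[ℝ] A x := fun x =>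
    ∑ i, (dform ((exists_coords E x).some.q i) x).smulRight (u ((exists_coords E x).some.D i) x)
  have key : ∀ Y x, U x (Y x) = u Y x := by
    intro Y x
    set c := (exists_coords E x).some with hc
    obtain ⟨χ, h1, hs⟩ := exists_bump (E := E) (c.isOpen.mem_nhds c.mem)
    have e : u (fsmul χ Y) = ∑ i, u (fsmul (χ * lieD Y (c.q i)) (c.D i)) := by
      rw [c.fsmul_eq_sum hs]
      exact map_sum (AddMonoidHom.mk' u hadd) _ _
    have e' := congrArg (fun s => s x) e
    simp only [hsmul, sec_sum_apply, fsmul_apply, ContMDiffMap.coe_mul, Pi.mul_apply,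
      h1.self_of_nhds, one_mul, one_smul] at e'
    rw [e']
    simp only [U, LinearMap.sum_apply, LinearMap.smulRight_apply, ← hc]
    rfl
  refine ⟨⟨U, fun s => ?_⟩, fun X Y h => ?_⟩
  · simp only [key]
    exact (u s).contMDiff
  · rw [hu' X Y h]
    congr 2
    ext x
    exact (key Y x).symm

theorem IsCoreLift.unique {U U' : BundleMap E E (TM E M) F A} {V : Tensor E F A (-1)}
    (h : IsCoreLift U V) (h' : IsCoreLift U' V) : U' = U := by
  refine BundleMap.ext_apply fun x v => ?_
  obtain ⟨Y, rfl⟩ := exists_sec_eq E E v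
  obtain ⟨X, hX⟩ := exists_lift F A Y
  have := vert_injective ((h' X Y hX).symm.trans (h X Y hX))
  exact congrArg (fun s => s x) this

/-- If `ker U^↑ = im U^↑` then `U` is bijective: `a^↑` is in the kernel, hence in the image, for
every section `a` of `A`, and a vector field of degree `0` in the kernel is in the image, hence has
symbol `0`. -/
theorem IsLift.isIso {U : BundleMap E E (TM E M) F A} {V : Tensor E F A (-1)}
    (h : IsLift U V) (hV : V.IsAlmostTangent) : U.IsIso := by
  have hs : ∀ a : Sec E F A, ∃ Y, U.onSec Y = a := by
    intro a
    obtain ⟨j, Y, hj, hY⟩ := (hV (-1) (vert a)).1 (V.neg_one_apply_neg_one _)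
    obtain rfl : j = 0 := by omega
    obtain ⟨s, hs⟩ := exists_symbol Y
    exact ⟨s, vert_injective ((h.isCoreLift Y s hs).symm.trans hY)⟩
  refine fun x => ⟨(injective_iff_map_eq_zero _).2 fun v hv => ?_, fun v => ?_⟩
  · obtain ⟨W, rfl⟩ := exists_sec_eq E E v
    obtain ⟨fr⟩ := exists_frame E F A x
    obtain ⟨χ, h1, hχ⟩ := exists_bump (E := E) (fr.isOpen.mem_nhds fr.mem)
    choose s hs using fun i => hs (fr.e i)
    -- `U W` vanishes at `x` only, so `W` is corrected by preimages of the frame to a vector field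
    -- `Z` with `U Z = 0` near `x` and the same value at `x`
    set Z := W - ∑ i, fsmul ((fr.ε i).pair (U.onSec W)) (s i) with hZ
    have hZx : Z x = W x := by
      rw [hZ, ContMDiffSection.coe_sub, Pi.sub_apply, sec_sum_apply]
      have : ∀ i, fsmul ((fr.ε i).pair (U.onSec W)) (s i) x = 0 := fun i => by
        rw [fsmul_apply, CoSec.pair_apply]
        change (fr.ε i).toFun x (U.toFun x (W x)) • _ = _
        rw [hv, map_zero, zero_smul]
      simp [this]
    have hUZ : U.onSec (fsmul χ Z) = 0 := by
      ext y
      rw [U.onSec_fsmul, fsmul_apply, hZ, U.onSec_sub]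
      by_cases hy : y ∈ tsupport χ
      · have : U.onSec (∑ i, fsmul ((fr.ε i).pair (U.onSec W)) (s i)) y = U.onSec W y := by
          change U.toFun y ((∑ i, fsmul ((fr.ε i).pair (U.onSec W)) (s i)) y) = _
          rw [sec_sum_apply, map_sum, ← fr.sum y (hχ hy) (U.onSec W y)]
          refine Finset.sum_congr rfl fun i _ => ?_
          rw [fsmul_apply, map_smul, ← hs i]
          rfl
        rw [ContMDiffSection.coe_sub, Pi.sub_apply, this, sub_self, smul_zero]; rfl
      · rw [image_eq_zero_of_notMem_tsupport hy, zero_smul]; rfl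
    obtain ⟨X, hX⟩ := exists_lift F A (fsmul χ Z)
    have hVX : V.toFun 0 X = 0 := Subtype.ext <| by
      rw [h.isCoreLift X _ hX, hUZ, vert_zero]; rfl
    obtain ⟨j, Y, -, hY⟩ := (hV 0 X).1 hVX
    have h0 : fsmul χ Z = 0 := sec_eq_of_lieD_eq fun f => by
      ext y
      refine algebraMap_exterior_inj (W := Module.Dual ℝ (A y)) ?_
      refine (hX f y).symm.trans ?_
      rw [← hY, (h j Y y).1, lieD_apply]
      change _ = algebraMap ℝ _ (dform f y 0)
      rw [map_zero, map_zero]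
    have := congrArg (fun s => s x) h0
    rw [← hZx]
    simpa [fsmul_apply, h1.self_of_nhds] using this
  · obtain ⟨a, rfl⟩ := exists_sec_eq E F v
    obtain ⟨Y, rfl⟩ := hs a
    exact ⟨Y x, rfl⟩

/-- The inverse of a smooth family of isomorphisms is smooth, by Cramer's rule. -/
theorem BundleMap.IsIso.exists_inverse {U : BundleMap E E (TM E M) F A} (hU : U.IsIso) :
    ∃ W : BundleMap E F A E (TM E M), (∀ x v, W.toFun x (U.toFun x v) = v) ∧
      ∀ x v, U.toFun x (W.toFun x v) = v := by
  let e : ∀ x, TM E M x ≃ₗ[ℝ] A x := fun x => LinearEquiv.ofBijective (U.toFun x) (hU x)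
  have he : ∀ x v, e x v = U.toFun x v := fun _ _ => rfl
  refine ⟨⟨fun x => (e x).symm, fun a => contMDiff_of_locally_sec fun x₀ => ?_⟩,
    fun x v => (e x).symm_apply_apply v, fun x v => (e x).apply_symm_apply v⟩
  obtain ⟨fr⟩ := exists_frame E F A x₀
  choose s hs using fun i => exists_sec_eq E E ((e x₀).symm (fr.e i x₀))
  -- the matrix of `U` in the frames `s` and `e`, which is the identity at `x₀`
  let m : Matrix (Fin (Module.finrank ℝ F)) (Fin (Module.finrank ℝ F)) (Smooth E M) :=
    fun i j => (fr.ε i).pair (U.onSec (s j))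
  have hm : m.det x₀ ≠ 0 := by
    have h := (ContMDiffMap.evalRingHom (I := 𝓘(ℝ, E)) (I' := 𝓘(ℝ, ℝ)) (n := ∞) (R := ℝ)
      x₀).map_det m
    have h1 : (ContMDiffMap.evalRingHom (I := 𝓘(ℝ, E)) (I' := 𝓘(ℝ, ℝ)) (n := ∞) (R := ℝ)
      x₀).mapMatrix m = 1 := by
      ext i j
      change (fr.ε i).toFun x₀ (U.toFun x₀ (s j x₀)) = _
      rw [hs, ← he, (e x₀).apply_symm_apply, fr.dual x₀ fr.mem, Matrix.one_apply]
    rw [h1, Matrix.det_one] at h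
    change m.det x₀ = 1 at h
    rw [h]
    exact one_ne_zero
  have hO : IsOpen {x | m.det x ≠ 0} := isOpen_ne_fun m.det.contMDiff.continuous continuous_const
  obtain ⟨g, hg⟩ := exists_extend (E := E) (g := fun x => (m.det x)⁻¹) (hO.mem_nhds hm)
    (fun x hx => (m.det.contMDiff.contMDiffAt.inv₀ hx).contMDiffWithinAt)
  let b : Fin (Module.finrank ℝ F) → Smooth E M := fun i => (fr.ε i).pair a
  refine ⟨∑ j, fsmul (g * m.cramer b j) (s j), ?_⟩
  filter_upwards [hg, hO.mem_nhds hm, fr.eventually fr.mem] with x hgx hx hxO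
  refine (LinearEquiv.symm_apply_eq _).2 ?_
  have hc : ∀ i, (∑ j, (fr.ε i).toFun x (U.toFun x (s j x)) * m.cramer b j x) =
      m.det x * (fr.ε i).toFun x (a x) := by
    intro i
    have h := congrFun (Matrix.mulVec_cramer m b) i
    have h := congrArg (ContMDiffMap.evalRingHom (I := 𝓘(ℝ, E)) (I' := 𝓘(ℝ, ℝ)) (n := ∞) (R := ℝ)
      x) h
    rw [Matrix.mulVec, dotProduct, map_sum] at h
    exact h
  rw [he, sec_sum_apply, map_sum, ← fr.sum x hxO (a x)]
  have hU : ∀ j, U.toFun x (fsmul (g * m.cramer b j) (s j) x) =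
      ∑ i, ((m.det x)⁻¹ * ((fr.ε i).toFun x (U.toFun x (s j x)) * m.cramer b j x)) • fr.e i x := by
    intro j
    conv_lhs => rw [← fr.sum x hxO (U.toFun x _)]
    refine Finset.sum_congr rfl fun i _ => ?_
    rw [fsmul_apply, map_smul, map_smul, ContMDiffMap.coe_mul, Pi.mul_apply, hgx, smul_eq_mul]
    congr 1
    ring
  simp only [hU]
  rw [Finset.sum_comm]
  refine Finset.sum_congr rfl fun i _ => ?_
  rw [← Finset.sum_smul, ← Finset.mul_sum, hc, inv_mul_cancel_left₀ hx]

/-- The tensor `U^↑` of an isomorphism is an almost tangent structure. A vector field `X` in its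
kernel has symbol `0`, and is the value of `U^↑` on any `Y` with `Y f = ± X(d f ∘ U⁻¹)`. -/
theorem IsLift.isAlmostTangent {U : BundleMap E E (TM E M) F A} {V : Tensor E F A (-1)}
    (h : IsLift U V) (hU : U.IsIso) : V.IsAlmostTangent := by
  obtain ⟨W, hWU, hUW⟩ := hU.exists_inverse
  intro k X
  constructor
  · intro hX
    have hXf : ∀ f x, (X.1 (Fn.ofSmooth F A f)).at x = 0 := by
      intro f x
      obtain ⟨ξ, hξ⟩ := exists_coSec_eq E F (dform f x ∘ₗ W.toFun x)
      have h1 := (h k X x).2 ξ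
      rw [hX, hξ, LinearMap.comp_assoc, show W.toFun x ∘ₗ U.toFun x = LinearMap.id from
        LinearMap.ext (hWU x), LinearMap.comp_id, ← symb_dform] at h1
      exact (smul_eq_zero.1 h1.symm).resolve_left (zpow_ne_zero _ (by norm_num))
    let κ : Smooth E M → CoSec E F A := fun f =>
      ⟨fun x => dform f x ∘ₗ W.toFun x, fun s => (lieD (W.onSec s) f).contMDiff⟩
    obtain ⟨Y, hY⟩ := exists_vf_of_local (k := k + 1) (S := {φ | ∃ f, φ = Fn.ofSmooth F A f})
      (G := fun φ x => (-1 : ℝ) ^ (k + 1) • (X.1 (Fn.ofCoSec (κ φ.body))).at x) fun x₀ => by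
      obtain ⟨fr⟩ := exists_frame E F A x₀
      choose D hD using fun i => exists_lift F A (W.onSec (fr.e i))
      refine ⟨∑ i, (-1 : ℝ) ^ (k + 1) • vfCast (by ring) (vfMul _
        (vf_mem X (Fn.ofCoSec_mem (fr.ε i))) (D i)), ?_⟩
      filter_upwards [fr.eventually fr.mem] with x hx
      rintro _ ⟨f, rfl⟩
      rw [vf_sum_at, Fn.body_ofSmooth, vf_coSec X fr hx, Finset.smul_sum]
      refine Finset.sum_congr rfl fun i _ => ?_
      rw [hXf, zero_mul, zero_add, Submodule.coe_smul, vfCast_coe, LinearMap.smul_apply,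
        Fn.at_smul, vfMul_apply, Fn.at_mul, hD, ← Algebra.commutes, ← Algebra.smul_def]
      rfl
    have hYs : ∀ x₀ (fr : Frame E F A x₀), ∀ α, symb Y.1 x₀ α = (-1 : ℝ) ^ (k + 1) •
        ∑ i, α (W.toFun x₀ (fr.e i x₀)) • (X.1 (Fn.ofCoSec (fr.ε i))).at x₀ := by
      intro x fr α
      refine (LinearMap.congr_fun (symb_eq_of_forall Y (L := (-1 : ℝ) ^ (k + 1) •
        ∑ i, (LinearMap.applyₗ (W.toFun x (fr.e i x))).smulRight
          ((X.1 (Fn.ofCoSec (fr.ε i))).at x)) fun f => ?_) α).trans ?_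
      · rw [hY _ ⟨f, rfl⟩, Fn.body_ofSmooth, vf_coSec X fr fr.mem]
        simp only [hXf, zero_mul, zero_add, LinearMap.smul_apply, LinearMap.sum_apply]
        rfl
      · simp only [LinearMap.smul_apply, LinearMap.sum_apply]
        rfl
    refine ⟨k + 1, Y, by ring, congrArg Subtype.val (vf_ext (X := V.toFun (k + 1) Y)
      (X' := vfCast (by ring) X) (fun f => Fn.ext fun x => ?_) fun ξ => Fn.ext fun x => ?_)⟩
    · rw [(h _ Y x).1, vfCast_coe, hXf]
    · obtain ⟨fr⟩ := exists_frame E F A x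
      rw [(h _ Y x).2, hYs x fr, smul_smul, sgn_mul_self, one_smul, vfCast_coe,
        vf_coSec X fr fr.mem]
      refine Finset.sum_congr rfl fun i _ => ?_
      rw [hXf, zero_mul, zero_add, LinearMap.comp_apply, hUW]
      rfl
  · rintro ⟨j, Y, rfl, hY⟩
    have h0 : ∀ x, symb X.1 x = 0 := fun x => symb_eq_zero fun f => by rw [← hY, (h j Y x).1]
    refine vf_ext (fun f => Fn.ext fun x => ?_) fun ξ => Fn.ext fun x => ?_
    · rw [(h _ X x).1]; rfl
    · rw [(h _ X x).2, h0, LinearMap.zero_apply, smul_zero]; rfl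

end AlmostTangent

/-! ### Existence and uniqueness of the de Rham differential -/

/-- Euler's formula `∑ ε^i ∧ (e_i ⌟ η) = j η` for a form `η` of degree `j` and dual bases. -/
theorem sum_ι_mul_contract {V ι : Type*} [AddCommGroup V] [Module ℝ V] [Fintype ι] (e : ι → V)
    (ε : ι → Module.Dual ℝ V) (h : ∀ v, ∑ i, ε i v • e i = v) {j : ℕ}
    {η : ExteriorAlgebra ℝ (Module.Dual ℝ V)} (hη : η ∈ ⋀[ℝ]^j (Module.Dual ℝ V)) :
    ∑ i, ExteriorAlgebra.ι ℝ (ε i) * contract (e i) η = (j : ℝ) • η := by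
  induction hη using Submodule.pow_induction_on_left' with
  | algebraMap r => simp [contract_algebraMap]
  | add x y i hx hy ihx ihy =>
    simp only [map_add, mul_add, Finset.sum_add_distrib, ihx, ihy, smul_add]
  | mem_mul m hm i x hx ih =>
    obtain ⟨ξ, rfl⟩ := hm
    have h1 : ∑ i, ξ (e i) • ExteriorAlgebra.ι ℝ (ε i) = ExteriorAlgebra.ι ℝ ξ := by
      simp only [← map_smul, ← map_sum]
      congr 1
      ext v
      conv_rhs => rw [← h v]
      simp only [map_sum, map_smul, LinearMap.sum_apply, LinearMap.smul_apply, smul_eq_mul]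
      exact Finset.sum_congr rfl fun i _ => mul_comm _ _
    have h2 : ∀ i, ExteriorAlgebra.ι ℝ (ε i) * contract (e i) (ExteriorAlgebra.ι ℝ ξ * x) =
        ξ (e i) • ExteriorAlgebra.ι ℝ (ε i) * x
          + ExteriorAlgebra.ι ℝ ξ * (ExteriorAlgebra.ι ℝ (ε i) * contract (e i) x) := fun i => by
      have : ExteriorAlgebra.ι ℝ (ε i) * ExteriorAlgebra.ι ℝ ξ =
          -(ExteriorAlgebra.ι ℝ ξ * ExteriorAlgebra.ι ℝ (ε i)) :=
        eq_neg_of_add_eq_zero_left (ExteriorAlgebra.ι_add_mul_swap _ _)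
      rw [contract_ι_mul, mul_sub, mul_smul_comm, smul_mul_assoc, ← mul_assoc, this, neg_mul,
        sub_neg_eq_add, mul_assoc]
    simp only [h2, Finset.sum_add_distrib, ← Finset.sum_mul, ← Finset.mul_sum, ih, h1,
      mul_smul_comm]
    push_cast
    rw [add_smul, one_smul, add_comm]

theorem contract_add_left {V : Type*} [AddCommGroup V] [Module ℝ V] (v w : V)
    (η : ExteriorAlgebra ℝ (Module.Dual ℝ V)) :
    contract (v + w) η = contract v η + contract w η := by
  rw [contract, map_add, map_add]; rfl

theorem contract_smul_left {V : Type*} [AddCommGroup V] [Module ℝ V] (r : ℝ) (v : V)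
    (η : ExteriorAlgebra ℝ (Module.Dual ℝ V)) : contract (r • v) η = r • contract v η := by
  rw [contract, map_smul, map_smul]; rfl

section DeRham

variable {E : Type*} [NormedAddCommGroup E] [NormedSpace ℝ E] [FiniteDimensional ℝ E]
  {M : Type*} [TopologicalSpace M] [ChartedSpace E M] [IsManifold 𝓘(ℝ, E) ∞ M] [T2Space M]
  {F : Type*} [NormedAddCommGroup F] [NormedSpace ℝ F] [FiniteDimensional ℝ F]
  {A : M → Type*} [∀ x, AddCommGroup (A x)] [∀ x, Module ℝ (A x)]
  [∀ x, TopologicalSpace (A x)] [TopologicalSpace (Bundle.TotalSpace F A)]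
  [FiberBundle F A] [VectorBundle ℝ F A]

/-- A form of non-zero degree is determined by its contractions, by Euler's formula. -/
theorem Frame.eq_zero_of_contract {x₀ x : M} (fr : Frame E F A x₀) (hx : x ∈ fr.O) {j : ℤ}
    (hj : j ≠ 0) {η : ExteriorAlgebra ℝ (Module.Dual ℝ (A x))}
    (hη : η ∈ grd (Module.Dual ℝ (A x)) j) (h : ∀ a : Sec E F A, contract (a x) η = 0) : η = 0 := by
  rcases grd_cases hη with h0 | ⟨n, rfl, hn⟩
  · exact h0
  have := sum_ι_mul_contract (fun i => fr.e i x) (fun i => (fr.ε i).toFun x) (fr.sum x hx) hn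
  simp only [h, mul_zero, Finset.sum_const_zero] at this
  exact (smul_eq_zero.1 this.symm).resolve_left (by exact_mod_cast hj)

/-- A `C^∞(M)`-linear map on sections, with values in a vector space on which functions act through
their value at `x`, vanishes if it does so on a frame at `x`. -/
theorem Frame.tensorial {x₀ x : M} (fr : Frame E F A x₀) (hx : x ∈ fr.O) {N : Type*}
    [AddCommGroup N] [Module ℝ N] (Φ : Sec E F A → N) (hadd : ∀ a b, Φ (a + b) = Φ a + Φ b)
    (hsmul : ∀ g a, Φ (fsmul g a) = g x • Φ a) (h : ∀ i, Φ (fr.e i) = 0) (a : Sec E F A) :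
    Φ a = 0 := by
  obtain ⟨χ, h1, hs⟩ := exists_bump (E := E) (fr.isOpen.mem_nhds hx)
  have e : fsmul χ a = ∑ i, fsmul (χ * (fr.ε i).pair a) (fr.e i) := by
    ext y
    rw [sec_sum_apply]
    by_cases hy : y ∈ tsupport χ
    · simp only [fsmul_apply, ContMDiffMap.coe_mul, Pi.mul_apply, mul_smul, CoSec.pair_apply]
      rw [← Finset.smul_sum, fr.sum y (hs hy)]
    · simp [fsmul_apply, image_eq_zero_of_notMem_tsupport hy]
  have e' : Φ (fsmul χ a) = ∑ i, Φ (fsmul (χ * (fr.ε i).pair a) (fr.e i)) := by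
    rw [e]
    exact map_sum (AddMonoidHom.mk' Φ hadd) _ _
  rw [hsmul, h1.self_of_nhds, one_smul] at e'
  rw [e']
  exact Finset.sum_eq_zero fun i _ => by rw [hsmul, h, smul_zero]

/-- The value on `a` and `b` of the de Rham differential of a section `ξ` of `A^*`, by the Koszul
formula. -/
def koszul (L : LieAlgebroid E F A) (ξ : CoSec E F A) (a b : Sec E F A) : Smooth E M :=
  lieD (L.anchor.onSec a) (ξ.pair b) - lieD (L.anchor.onSec b) (ξ.pair a) - ξ.pair (L.bracket a b)

theorem koszul_apply (L : LieAlgebroid E F A) (ξ : CoSec E F A) (a b : Sec E F A) (x : M) :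
    koszul L ξ a b x = dirDeriv (ξ.pair b) x (L.anchor.toFun x (a x))
      - dirDeriv (ξ.pair a) x (L.anchor.toFun x (b x)) - ξ.toFun x (L.bracket a b x) := rfl

theorem koszul_skew (L : LieAlgebroid E F A) (ξ : CoSec E F A) (a b : Sec E F A) (x : M) :
    koszul L ξ a b x = -koszul L ξ b a x := by
  rw [koszul_apply, koszul_apply, L.bracket_skew a b, ContMDiffSection.coe_neg, Pi.neg_apply,
    map_neg]
  ring

theorem CoSec.pair_add (ξ : CoSec E F A) (a b : Sec E F A) :
    ξ.pair (a + b) = ξ.pair a + ξ.pair b := by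
  ext x; exact map_add (ξ.toFun x) _ _

theorem CoSec.pair_fsmul (ξ : CoSec E F A) (f : Smooth E M) (a : Sec E F A) :
    ξ.pair (fsmul f a) = f * ξ.pair a := by
  ext x; exact map_smul (ξ.toFun x) _ _

theorem koszul_add (L : LieAlgebroid E F A) (ξ : CoSec E F A) (a b c : Sec E F A) (x : M) :
    koszul L ξ a (b + c) x = koszul L ξ a b x + koszul L ξ a c x := by
  rw [koszul_apply, koszul_apply, koszul_apply, L.bracket_add, ξ.pair_add]
  change dirDeriv (fun y => ξ.pair b y + ξ.pair c y) _ _ - _ - _ = _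
  rw [dirDeriv_add _ ((ξ.pair b).mdiffAt x) ((ξ.pair c).mdiffAt x), ContMDiffSection.coe_add,
    ContMDiffSection.coe_add, Pi.add_apply, Pi.add_apply, map_add, map_add, dirDeriv_vadd]
  ring

theorem koszul_fsmul (L : LieAlgebroid E F A) (ξ : CoSec E F A) (f : Smooth E M)
    (a b : Sec E F A) (x : M) : koszul L ξ a (fsmul f b) x = f x * koszul L ξ a b x := by
  rw [koszul_apply, koszul_apply, ξ.pair_fsmul, L.leibniz]
  change dirDeriv (fun y => f y * ξ.pair b y) _ _ - _ - _ = _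
  rw [dirDeriv_mul _ (f.mdiffAt x) ((ξ.pair b).mdiffAt x), fsmul_apply, map_smul, map_add, map_smul,
    map_smul, dirDeriv_vsmul, smul_eq_mul, smul_eq_mul, CoSec.pair_apply]
  ring

/-- The defining property of the de Rham differential, at a point. -/
def IsDeRhamAt (L : LieAlgebroid E F A) (Q : VF E F A 1) (x : M) : Prop :=
  (∀ (f : Smooth E M) (a : Sec E F A), contract (a x) ((Q.1 (Fn.ofSmooth F A f)).at x) =
      algebraMap ℝ _ (dirDeriv f x (L.anchor.toFun x (a x)))) ∧
  ∀ (ξ : CoSec E F A) (a b : Sec E F A),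
    contract (b x) (contract (a x) ((Q.1 (Fn.ofCoSec ξ)).at x)) =
      algebraMap ℝ _ (koszul L ξ a b x)

variable [ContMDiffVectorBundle ∞ F A 𝓘(ℝ, E)]

/-- Uniqueness of the de Rham differential, at a point. -/
theorem IsDeRhamAt.eq {L : LieAlgebroid E F A} {Q Q' : VF E F A 1} {x : M}
    (h : IsDeRhamAt L Q x) (h' : IsDeRhamAt L Q' x) (φ : Fn E F A) :
    (Q.1 φ).at x = (Q'.1 φ).at x := by
  obtain ⟨fr⟩ := exists_frame E F A x
  refine vf_eq_at Q Q' (fun f => ?_) (fun ξ => ?_) φ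
  · refine sub_eq_zero.1 (fr.eq_zero_of_contract fr.mem (j := 0 + 1) (by norm_num)
      (sub_mem (vf_mem Q (Fn.ofSmooth_mem f) x) (vf_mem Q' (Fn.ofSmooth_mem f) x)) fun a => ?_)
    rw [map_sub, h.1, h'.1, sub_self]
  · have hm := sub_mem (vf_mem Q (Fn.ofCoSec_mem ξ) x) (vf_mem Q' (Fn.ofCoSec_mem ξ) x)
    refine sub_eq_zero.1 (fr.eq_zero_of_contract fr.mem (j := 1 + 1) (by norm_num) hm fun a =>
      fr.eq_zero_of_contract fr.mem (j := 1 + 1 - 1) (by norm_num) (contract_mem _ hm) fun b => ?_)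
    rw [map_sub, map_sub, h.2, h'.2, sub_self]

/-- It suffices to check the Koszul formula on a frame. -/
theorem isDeRhamAt_of_frame {L : LieAlgebroid E F A} {Q : VF E F A 1} {x₀ x : M}
    (fr : Frame E F A x₀) (hx : x ∈ fr.O)
    (hf : ∀ (f : Smooth E M) (a : Sec E F A), contract (a x) ((Q.1 (Fn.ofSmooth F A f)).at x) =
      algebraMap ℝ _ (dirDeriv f x (L.anchor.toFun x (a x))))
    (hε : ∀ i k l, contract (fr.e l x) (contract (fr.e k x) ((Q.1 (Fn.ofCoSec (fr.ε i))).at x)) =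
      algebraMap ℝ _ (-(fr.ε i).toFun x (L.bracket (fr.e k) (fr.e l) x))) :
    IsDeRhamAt L Q x := by
  refine ⟨hf, fun ξ a b => ?_⟩
  rw [← sub_eq_zero]
  refine fr.tensorial hx (fun b => contract (b x) (contract (a x) ((Q.1 (Fn.ofCoSec ξ)).at x))
    - algebraMap ℝ _ (koszul L ξ a b x)) (fun b c => ?_) (fun g b => ?_) (fun l => ?_) b
  · rw [koszul_add, ContMDiffSection.coe_add, Pi.add_apply, contract_add_left, map_add]; abel
  · rw [koszul_fsmul, fsmul_apply, contract_smul_left, map_mul, smul_sub, ← Algebra.smul_def]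
  refine fr.tensorial hx (fun a => contract (fr.e l x) (contract (a x)
    ((Q.1 (Fn.ofCoSec ξ)).at x)) - algebraMap ℝ _ (koszul L ξ a (fr.e l) x))
    (fun b c => ?_) (fun g b => ?_) (fun k => ?_) a
  · rw [koszul_skew, koszul_add, ContMDiffSection.coe_add, Pi.add_apply, contract_add_left,
      map_add, koszul_skew L ξ b, koszul_skew L ξ c, neg_add, map_add]
    abel
  · rw [koszul_skew, koszul_fsmul, fsmul_apply, contract_smul_left, map_smul, koszul_skew L ξ b,
      smul_sub, ← mul_neg, map_mul, ← Algebra.smul_def]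
  rw [sub_eq_zero, vf_coSec Q fr hx, map_sum, map_sum]
  have hterm : ∀ i, contract (fr.e l x) (contract (fr.e k x)
      ((Q.1 (Fn.ofSmooth F A (ξ.pair (fr.e i)))).at x * (Fn.ofCoSec (fr.ε i)).at x
        + ξ.pair (fr.e i) x • (Q.1 (Fn.ofCoSec (fr.ε i))).at x)) =
      algebraMap ℝ _ (dirDeriv (ξ.pair (fr.e i)) x (L.anchor.toFun x (fr.e k x))
          * (if i = l then 1 else 0)
        - dirDeriv (ξ.pair (fr.e i)) x (L.anchor.toFun x (fr.e l x)) * (if i = k then 1 else 0)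
        - (fr.ε i).toFun x (L.bracket (fr.e k) (fr.e l) x) * ξ.toFun x (fr.e i x)) := by
    intro i
    have h1 := vf_mem Q (Fn.ofSmooth_mem (F := F) (A := A) (ξ.pair (fr.e i))) x
    rw [map_add, map_add, contract_mul_of_grd _ h1, hf, map_smul, map_smul, hε, Fn.ofCoSec_at,
      contract_ι, fr.dual x hx, ← Algebra.smul_def, map_add, map_smul, map_smul, contract_ι,
      fr.dual x hx, ← Algebra.commutes, ← Algebra.smul_def, map_smul, hf]
    simp only [Algebra.algebraMap_eq_smul_one, smul_smul, ← add_smul]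
    congr 1
    norm_num [CoSec.pair_apply]
    split_ifs <;> ring
  simp only [hterm]
  rw [← map_sum]
  congr 1
  simp only [Finset.sum_sub_distrib, mul_ite, mul_one, mul_zero, Finset.sum_ite_eq',
    Finset.mem_univ, if_true]
  rw [koszul_apply]
  congr 1
  conv_rhs => rw [← fr.sum x hx (L.bracket (fr.e k) (fr.e l) x)]
  simp only [map_sum, map_smul, smul_eq_mul]

variable [SecondCountableTopology M]

/-- The vector field of degree `1` with `Q f = ∑ ε^i X_i(f)` and prescribed values on a frame. -/
theorem Frame.exists_vf {x₀ : M} (fr : Frame E F A x₀)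
    (X : Fin (Module.finrank ℝ F) → VF E F A 0) (η : Fin (Module.finrank ℝ F) → Fn E F A)
    (hη : ∀ c, η c ∈ FnDeg E F A 2) : ∃ Q : VF E F A 1, ∀ x ∈ fr.O,
      (∀ f, (Q.1 (Fn.ofSmooth F A f)).at x = ∑ i, ExteriorAlgebra.ι ℝ ((fr.ε i).toFun x) *
        ((X i).1 (Fn.ofSmooth F A f)).at x) ∧
      ∀ c, (Q.1 (Fn.ofCoSec (fr.ε c))).at x = (η c).at x := by
  let Q₀ : VF E F A 1 := ∑ i, vfCast (add_zero 1)
    (vfMul _ (Fn.ofCoSec_mem (fr.ε i)) (X i))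
  have hQ₀ : ∀ c, η c - Q₀.1 (Fn.ofCoSec (fr.ε c)) ∈ FnDeg E F A 2 := fun c => by
    have h := vf_mem Q₀ (Fn.ofCoSec_mem (fr.ε c))
    rw [one_add_one_eq_two] at h
    exact sub_mem (hη c) h
  have hQ : ∀ φ x, (Q₀.1 φ).at x = ∑ i, ExteriorAlgebra.ι ℝ ((fr.ε i).toFun x) *
      ((X i).1 φ).at x := fun φ x => vf_sum_at _ _ _ _
  clear_value Q₀
  have hc : (2 + -1 : ℤ) = 1 := by norm_num
  refine ⟨Q₀ + ∑ c, vfCast hc (vfMul _ (hQ₀ c) (vert (fr.e c))), fun x hx =>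
    ⟨fun f => ?_, fun b => ?_⟩⟩
  · rw [Submodule.coe_add, LinearMap.add_apply, Fn.at_add, hQ, vf_sum_at]
    refine add_eq_left.2 (Finset.sum_eq_zero fun c _ => ?_)
    rw [vfCast_coe, vfMul_apply, vert_smooth, mul_zero, Fn.at_zero]
  · rw [Submodule.coe_add, LinearMap.add_apply, Fn.at_add, vf_sum_at, Finset.sum_eq_single b]
    · rw [vfCast_coe, vfMul_apply, vert_coSec, Fn.mul_smooth_at, CoSec.pair_apply, fr.dual x hx,
        if_pos rfl, one_smul, Fn.at_sub]
      abel
    · intro c _ hcb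
      rw [vfCast_coe, vfMul_apply, vert_coSec, Fn.mul_smooth_at, CoSec.pair_apply, fr.dual x hx,
        if_neg (Ne.symm hcb), zero_smul]
    · simp

/-- Existence of the de Rham differential, locally: on a frame,
`d ε^c = -1/2 ∑ ε^c([e_i, e_j]) ε^i ε^j`. -/
theorem exists_isDeRhamAt (L : LieAlgebroid E F A) (x₀ : M) :
    ∃ Q : VF E F A 1, ∀ᶠ x in 𝓝 x₀, IsDeRhamAt L Q x := by
  obtain ⟨fr⟩ := exists_frame E F A x₀
  choose D hD using fun i => exists_lift F A (L.anchor.onSec (fr.e i))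
  let η : Fin (Module.finrank ℝ F) → Fn E F A := fun c => (-(1 / 2) : ℝ) • ∑ i, ∑ j,
    Fn.ofSmooth F A ((fr.ε c).pair (L.bracket (fr.e i) (fr.e j))) *
      (Fn.ofCoSec (fr.ε i) * Fn.ofCoSec (fr.ε j))
  have hη : ∀ c, η c ∈ FnDeg E F A 2 := fun c =>
    Submodule.smul_mem _ _ (sum_mem fun i _ => sum_mem fun j _ => by
      have h := FnDeg_mul (Fn.ofSmooth_mem ((fr.ε c).pair (L.bracket (fr.e i) (fr.e j))))
        (FnDeg_mul (Fn.ofCoSec_mem (fr.ε i)) (Fn.ofCoSec_mem (fr.ε j)))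
      rwa [zero_add, one_add_one_eq_two] at h)
  obtain ⟨Q, hQ⟩ := fr.exists_vf D η hη
  refine ⟨Q, ?_⟩
  filter_upwards [fr.eventually fr.mem] with x hx
  refine isDeRhamAt_of_frame fr hx (fun f a => ?_) fun b k l => ?_
  · rw [(hQ x hx).1, map_sum]
    conv_rhs => rw [← fr.sum x hx (a x)]
    change _ = algebraMap ℝ _ (dform f x _)
    simp only [map_sum, map_smul]
    refine Finset.sum_congr rfl fun i _ => ?_
    rw [hD, ← Algebra.commutes, ← Algebra.smul_def, map_smul, contract_ι, Algebra.smul_def,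
      ← map_mul, mul_comm]
    rfl
  · rw [(hQ x hx).2]
    simp only [η, Fn.at_smul, Fn.at_sum, Fn.ofSmooth_mul_at]
    simp only [Fn.at_mul, Fn.ofCoSec_at, map_smul, map_sum]
    have hc : ∀ i j, contract (fr.e l x) (contract (fr.e k x)
        (ExteriorAlgebra.ι ℝ ((fr.ε i).toFun x) * ExteriorAlgebra.ι ℝ ((fr.ε j).toFun x))) =
        algebraMap ℝ _ ((if i = k then 1 else 0) * (if j = l then 1 else 0)
          - (if i = l then 1 else 0) * (if j = k then 1 else 0)) := by
      intro i j
      rw [contract_ι_mul, contract_ι, map_sub, map_smul, contract_ι, contract_ι_mul,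
        contract_algebraMap, mul_zero, sub_zero]
      simp only [fr.dual x hx, Algebra.algebraMap_eq_smul_one, smul_smul, ← sub_smul]
    simp only [hc, Algebra.algebraMap_eq_smul_one, smul_smul, ← Finset.sum_smul]
    congr 1
    simp only [CoSec.pair_apply, mul_sub, Finset.sum_sub_distrib]
    have h1 : ∀ (B : Fin (Module.finrank ℝ F) → Fin (Module.finrank ℝ F) → ℝ) (k l),
        (∑ i, ∑ j, B i j * ((if i = k then 1 else 0) * (if j = l then 1 else 0))) = B k l := by
      intro B k l
      rw [Finset.sum_eq_single k, Finset.sum_eq_single l]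
      · simp
      · intro j _ hj; simp [hj]
      · simp
      · intro j _ hj; simp [hj]
      · simp
    rw [h1 fun i j => (fr.ε b).toFun x (L.bracket (fr.e i) (fr.e j) x),
      h1 fun i j => (fr.ε b).toFun x (L.bracket (fr.e i) (fr.e j) x),
      L.bracket_skew (fr.e l), ContMDiffSection.coe_neg, Pi.neg_apply, map_neg]
    ring

/-- The vector field `deRham L` has the defining property of `d_A`, as a vector field with this
property exists: local solutions agree by uniqueness, and can be glued. -/
theorem isDeRham_deRham (L : LieAlgebroid E F A) : IsDeRham L (deRham L) := by
  have h : ∃ Q, IsDeRham L Q := by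
    choose Y hY using exists_isDeRhamAt L
    obtain ⟨Q, hQ⟩ := exists_glue Y fun x₀ => by
      filter_upwards [hY x₀] with x hx
      exact (hY x).self_of_nhds.eq hx
    refine ⟨Q, fun f a x => ?_, fun ξ a b x => ?_⟩
    · rw [hQ, (hY x).self_of_nhds.1]
    · rw [hQ, (hY x).self_of_nhds.2]; rfl
  rw [deRham, dif_pos h]
  exact h.choose_spec

end DeRham

/-! ### Cartan's formula and the tensor `[d_A, V]` -/

section Cartan

variable {E : Type*} [NormedAddCommGroup E] [NormedSpace ℝ E] [FiniteDimensional ℝ E]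
  {M : Type*} [TopologicalSpace M] [ChartedSpace E M] [IsManifold 𝓘(ℝ, E) ∞ M] [T2Space M]
  {F : Type*} [NormedAddCommGroup F] [NormedSpace ℝ F] [FiniteDimensional ℝ F]
  {A : M → Type*} [∀ x, AddCommGroup (A x)] [∀ x, Module ℝ (A x)]
  [∀ x, TopologicalSpace (A x)] [TopologicalSpace (Bundle.TotalSpace F A)]
  [FiberBundle F A] [VectorBundle ℝ F A] [ContMDiffVectorBundle ∞ F A 𝓘(ℝ, E)]

theorem exists_dform_eq {x : M} (α : Module.Dual ℝ (TM E M x)) :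
    ∃ f : Smooth E M, dform f x = α := by
  obtain ⟨c⟩ := exists_coords E x
  refine ⟨⟨fun y => ∑ i, α (c.D i x) * c.q i y,
    contMDiff_finsetSum fun i _ => contMDiff_const.mul (c.q i).contMDiff⟩, ?_⟩
  ext v
  change dirDeriv (fun y => ∑ i, α (c.D i x) * c.q i y) x v = _
  rw [dirDeriv_sum (f := fun i y => α (c.D i x) * c.q i y) _ _ fun i _ =>
    (mdifferentiableAt_const.mul ((c.q i).mdiffAt x))]
  conv_rhs => rw [← c.sum x c.mem v]
  rw [map_sum]
  refine Finset.sum_congr rfl fun i _ => ?_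
  rw [dirDeriv_const_mul _ ((c.q i).mdiffAt x), map_smul, smul_eq_mul, mul_comm]

theorem vfBr_apply {k l : ℤ} (X : VF E F A k) (Y : VF E F A l) (φ : Fn E F A) :
    (vfBr X Y).1 φ = X.1 (Y.1 φ) - (-1 : ℝ) ^ (k * l) • Y.1 (X.1 φ) := rfl

theorem vfBr_skew {k l : ℤ} (X : VF E F A k) (Y : VF E F A l) :
    (vfBr X Y).1 = (-(-1 : ℝ) ^ (k * l)) • (vfBr Y X).1 := by
  refine LinearMap.ext fun φ => ?_
  rw [LinearMap.smul_apply, vfBr_apply, vfBr_apply, mul_comm l k, smul_sub, smul_smul, neg_mul,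
    sgn_mul_self, neg_smul, neg_smul, one_smul]
  abel

theorem End.neg_one_smul (X : Module.End ℝ (Fn E F A)) : (-1 : ℝ) • X = -X :=
  LinearMap.ext fun φ => by
    rw [LinearMap.smul_apply, neg_smul, one_smul]; rfl

theorem HasSymbol.apply {X : Module.End ℝ (Fn E F A)} {Y : Sec E E (TM E M)} (h : HasSymbol X Y)
    (f : Smooth E M) : X (Fn.ofSmooth F A f) = Fn.ofSmooth F A (lieD Y f) :=
  Fn.ext fun x => h f x

variable {L : LieAlgebroid E F A} {Q : VF E F A 1}

/-- The Lie derivative `[d_A, a^↑]` has symbol `ρ(a)`. -/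
theorem IsDeRham.hasSymbol (hQ : IsDeRham L Q) (a : Sec E F A) :
    HasSymbol (vfBr Q (vert a)).1 (L.anchor.onSec a) := by
  intro f x
  rw [vfBr_apply, vert_smooth, map_zero, Fn.at_sub, Fn.at_zero, Fn.at_smul, vert_at, hQ.1]
  norm_num
  rfl

/-- Cartan's formula `[[d_A, a^↑], b^↑] = [a, b]^↑`. -/
theorem IsDeRham.vfBr_vfBr_vert (hQ : IsDeRham L Q) (a b : Sec E F A) :
    (vfBr (vfBr Q (vert a)) (vert b)).1 = (vert (L.bracket a b)).1 := by
  refine congrArg Subtype.val (vf_ext (X := vfBr (vfBr Q (vert a)) (vert b))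
    (X' := vfCast (by norm_num) (vert (L.bracket a b))) (fun f => ?_) fun ξ => Fn.ext fun x => ?_)
  · rw [vfBr_apply, (hQ.hasSymbol a).apply, vert_smooth, vert_smooth, map_zero, vfCast_coe,
      vert_smooth, smul_zero, sub_zero]
  · rw [vfBr_apply, vert_coSec, (hQ.hasSymbol a).apply, vfBr_apply, vert_coSec, vfCast_coe,
      vert_coSec, Fn.at_sub, Fn.at_smul, vert_at, Fn.at_sub, Fn.at_smul, map_sub, map_smul, vert_at,
      hQ.1, hQ.2, Fn.ofSmooth_at, Fn.ofSmooth_at]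
    norm_num
    simp only [← map_sub]
    congr 1
    change dirDeriv (ξ.pair b) x (L.anchor.toFun x (a x)) -
      (dirDeriv (ξ.pair a) x (L.anchor.toFun x (b x)) - (ξ.toFun x (L.bracket a b x) -
        (dirDeriv (ξ.pair b) x (L.anchor.toFun x (a x))
          - dirDeriv (ξ.pair a) x (L.anchor.toFun x (b x))))) = ξ.toFun x (L.bracket a b x)
    ring

variable [SecondCountableTopology M]
  {U : BundleMap E E (TM E M) F A} {V : Tensor E F A (-1)} {T : Tensor E F A 0}

theorem vert_neg (a : Sec E F A) : (vert (-a)).1 = -(vert a).1 := by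
  have h : vert (-a) = vert (0 - a) := by rw [zero_sub]
  rw [h, vert_sub, vert_zero, zero_sub]

theorem fnVec_apply (Q : VF E F A 1) (V : Tensor E F A (-1)) (k : ℤ) (X : VF E F A k) :
    ((fnVec Q V).toFun k X).1 = (vfBr Q (V.toFun k X)).1 + (V.toFun _ (vfBr Q X)).1 := by
  change (vfBr Q (V.toFun k X)).1 - (-1 : ℝ) ^ ((1 : ℤ) * -1) • (V.toFun _ (vfBr Q X)).1 = _
  have : (-1 : ℝ) ^ ((1 : ℤ) * -1) = -1 := by norm_num
  rw [this, End.neg_one_smul, sub_neg_eq_add]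

/-- `T = [d_A, V]`, for a tensor `T` of internal degree `0`. The tensor `fnVec d_A V` has internal
degree `1 + -1`, which is not `0` by definition. -/
def IsDeRhamBracket (Q : VF E F A 1) (V : Tensor E F A (-1)) (T : Tensor E F A 0) : Prop :=
  ∀ k (X : VF E F A k), (T.toFun k X).1 = (vfBr Q (V.toFun k X)).1 + (V.toFun _ (vfBr Q X)).1

theorem IsLift.apply_smooth (hV : IsLift U V) {k : ℤ} (X : VF E F A k) (f : Smooth E M) :
    (V.toFun k X).1 (Fn.ofSmooth F A f) = 0 := Fn.ext fun x => (hV k X x).1 f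

theorem IsLift.apply_hasSymbol (hV : IsLift U V) {k : ℤ} (hk : k = 0) (X : VF E F A k)
    {Y : Sec E E (TM E M)} (h : HasSymbol X.1 Y) : (V.toFun k X).1 = (vert (U.onSec Y)).1 := by
  subst hk
  exact hV.isCoreLift X Y h

theorem IsDeRhamBracket.hasSymbol (hT : IsDeRhamBracket Q V T) (hQ : IsDeRham L Q)
    (hV : IsLift U V) {X : VF E F A 0} {Y : Sec E E (TM E M)} (h : HasSymbol X.1 Y) :
    HasSymbol (T.toFun 0 X).1 (L.anchor.onSec (U.onSec Y)) := by
  intro f x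
  have h1 : V.toFun 0 X = vfCast (zero_add _).symm (vert (U.onSec Y)) :=
    Subtype.ext (hV.isCoreLift X Y h)
  rw [hT, LinearMap.add_apply, hV.apply_smooth, add_zero, h1, vfBr_cast]
  exact hQ.hasSymbol _ f x

/-- `[d_A, V](a^↑) = V [d_A, a^↑]`, as `V` kills `a^↑`. -/
theorem IsDeRhamBracket.apply_vert (hT : IsDeRhamBracket Q V T) (hQ : IsDeRham L Q)
    (hV : IsLift U V) (a : Sec E F A) :
    (T.toFun (-1) (vert a)).1 = (vert (U.onSec (L.anchor.onSec a))).1 := by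
  rw [hT, V.neg_one_apply_neg_one, hV.apply_hasSymbol (by norm_num) _ (hQ.hasSymbol a)]
  refine add_eq_right.2 (LinearMap.ext fun φ => ?_)
  rw [vfBr_apply]
  change Q.1 0 - _ • (0 : Fn E F A) = 0
  rw [map_zero, smul_zero, sub_zero]

/-- The symbol of `[d_A, X]`, contracted with `a`, where `c` is the section with `[a^↑, X] = c^↑`.
-/
theorem IsDeRham.contract_symb (hQ : IsDeRham L Q) {X : VF E F A 0} {Y : Sec E E (TM E M)}
    (h : HasSymbol X.1 Y) {a c : Sec E F A} (hc : (vfBr (vert a) X).1 = (vert c).1) (x : M)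
    (α : Module.Dual ℝ (TM E M x)) :
    contract (a x) (symb (vfBr Q X).1 x α) = algebraMap ℝ _
      (α (vfBracket (L.anchor.onSec a) Y x) - α (L.anchor.toFun x (c x))) := by
  obtain ⟨f, rfl⟩ := exists_dform_eq α
  have h1 : (vert a).1 (X.1 (Q.1 (Fn.ofSmooth F A f))) =
      X.1 ((vert a).1 (Q.1 (Fn.ofSmooth F A f))) + (vert c).1 (Q.1 (Fn.ofSmooth F A f)) := by
    rw [← hc, vfBr_apply]
    norm_num
  have h2 : ∀ (f : Smooth E M) (b : Sec E F A), (vert b).1 (Q.1 (Fn.ofSmooth F A f)) =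
      Fn.ofSmooth F A (lieD (L.anchor.onSec b) f) := fun f b => Fn.ext fun y => hQ.1 f b y
  rw [← symb_dform, vfBr_apply, h.apply, mul_zero, zpow_zero, one_smul, Fn.at_sub, map_sub,
    ← vert_at, ← vert_at, h1, h2, h2, h.apply, h2, Fn.at_add, Fn.ofSmooth_at,
    Fn.ofSmooth_at, Fn.ofSmooth_at, ← map_add, ← map_sub]
  congr 1
  have h3 := DFunLike.congr_fun (lieD_vfBracket (L.anchor.onSec a) Y f) x
  rw [ContMDiffMap.coe_sub, Pi.sub_apply] at h3
  change lieD (L.anchor.onSec a) (lieD Y f) x - (_ + lieD (L.anchor.onSec c) f x) =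
    lieD (vfBracket (L.anchor.onSec a) Y) f x - lieD (L.anchor.onSec c) f x
  rw [h3]
  ring

/-- The commutator of `[d_A, V](X)` with `a^↑`. The summand `[d_A, V X]` contributes `[a, U Y]` by
Cartan's formula, and the summand `V [d_A, X]` contributes the rest, by the formula for the symbol
of `[d_A, X]`. -/
theorem IsDeRhamBracket.vfBr_vert (hT : IsDeRhamBracket Q V T) (hQ : IsDeRham L Q)
    (hV : IsLift U V) {X : VF E F A 0} {Y : Sec E E (TM E M)} (h : HasSymbol X.1 Y)
    (a : Sec E F A) : (vfBr (vert a) (T.toFun 0 X)).1 =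
      (vert (L.bracket a (U.onSec Y) - U.onSec (vfBracket (L.anchor.onSec a) Y))).1
        + (T.toFun _ (vfBr (vert a) X)).1 := by
  obtain ⟨c, hc⟩ := exists_vert (vfCast (add_zero (-1)) (vfBr (vert a) X))
  have hc : (vfBr (vert a) X).1 = (vert c).1 := congrArg Subtype.val hc
  rw [T.congr (add_zero (-1)) (vfBr (vert a) X) (vert c) hc, hT.apply_vert hQ hV]
  have hX : T.toFun 0 X = vfCast (by norm_num) (vfBr Q (vert (U.onSec Y)))
      + vfCast (by norm_num) (V.toFun _ (vfBr Q X)) := by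
    refine Subtype.ext ((hT 0 X).trans ?_)
    have h1 : V.toFun 0 X = vfCast (zero_add _).symm (vert (U.onSec Y)) :=
      Subtype.ext (hV.isCoreLift X Y h)
    rw [h1, vfBr_cast]
    rfl
  have h2 : (vfBr (vert a) (vfBr Q (vert (U.onSec Y)))).1 =
      (vert (L.bracket a (U.onSec Y))).1 := by
    rw [vfBr_skew, hQ.vfBr_vfBr_vert, L.bracket_skew a, vert_neg,
      ← End.neg_one_smul]
    norm_num
  rw [hX, vfBr_add, Submodule.coe_add, vfBr_cast, vfBr_cast, h2, vert_sub, sub_add, sub_eq_add_neg]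
  refine congrArg _ ?_
  rw [neg_sub, ← vert_sub]
  refine congrArg Subtype.val (vf_ext (X := vfBr (vert a) (V.toFun _ (vfBr Q X)))
    (X' := vfCast (by norm_num) (vert _)) (fun f => ?_) fun ξ => Fn.ext fun x => ?_)
  · rw [vfBr_apply, hV.apply_smooth, map_zero, vert_smooth, map_zero, smul_zero, sub_zero,
      vfCast_coe, vert_smooth]
  · rw [vfBr_apply, vert_coSec, hV.apply_smooth, smul_zero, sub_zero, vfCast_coe, vert_coSec,
      vert_at, (hV _ _ x).2, map_smul, hQ.contract_symb h hc]
    norm_num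
    rw [← map_sub, Fn.ofSmooth_at]
    congr 1
    change _ = ξ.toFun x (U.toFun x (L.anchor.toFun x (c x)) -
      U.toFun x (vfBracket (L.anchor.onSec a) Y x))
    rw [map_sub]

/-- The tensor `[d_A, U^↑]` is given by the triple
`([a, U Y] - U [ρ(a), Y], U ∘ ρ, ρ ∘ U)`. -/
theorem IsDeRhamBracket.hasTriple (hT : IsDeRhamBracket Q V T) (hQ : IsDeRham L Q)
    (hV : IsLift U V) :
    HasTriple (fun a Y => L.bracket a (U.onSec Y) - U.onSec (vfBracket (L.anchor.onSec a) Y))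
      (U.comp L.anchor) (L.anchor.comp U) T := by
  refine ⟨fun X Y h => hT.hasSymbol hQ hV h, fun a => hT.apply_vert hQ hV a, fun a X Y h => ?_⟩
  change (vfBr (vert a) (T.toFun 0 X)).1 - (-1 : ℝ) ^ ((-1 : ℤ) * 0) •
    (T.toFun _ (vfBr (vert a) X)).1 = _
  rw [hT.vfBr_vert hQ hV h, mul_zero, zpow_zero, one_smul, add_sub_cancel_right]

end Cartan

/-! ### The Frölicher-Nijenhuis bracket of `[d_A, V]` and `V` -/

theorem sgn_congr {a b : ℤ} (h : Even (a - b)) : (-1 : ℝ) ^ a = (-1 : ℝ) ^ b := by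
  rw [← sub_add_cancel a b, sgn_add, h.neg_one_zpow, one_mul]

section Commute

variable {E : Type*} [NormedAddCommGroup E] [NormedSpace ℝ E] [FiniteDimensional ℝ E]
  {M : Type*} [TopologicalSpace M] [ChartedSpace E M] [IsManifold 𝓘(ℝ, E) ∞ M] [T2Space M]
  [SecondCountableTopology M]
  {F : Type*} [NormedAddCommGroup F] [NormedSpace ℝ F] [FiniteDimensional ℝ F]
  {A : M → Type*} [∀ x, AddCommGroup (A x)] [∀ x, Module ℝ (A x)]
  [∀ x, TopologicalSpace (A x)] [TopologicalSpace (Bundle.TotalSpace F A)]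
  [FiberBundle F A] [VectorBundle ℝ F A] [ContMDiffVectorBundle ∞ F A 𝓘(ℝ, E)]

theorem vfBr_congr {k k' l l' : ℤ} (hk : k = k') (hl : l = l') {X : VF E F A k} {X' : VF E F A k'}
    {Y : VF E F A l} {Y' : VF E F A l'} (hX : X.1 = X'.1) (hY : Y.1 = Y'.1) :
    (vfBr X Y).1 = (vfBr X' Y').1 := by
  subst hk hl
  rw [Subtype.ext hX, Subtype.ext hY]

theorem HasSymbol.vfBr {k l : ℤ} (hk : k = 0) (hl : l = 0) {X : VF E F A k} {Y : VF E F A l}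
    {z w : Sec E E (TM E M)} (hX : HasSymbol X.1 z) (hY : HasSymbol Y.1 w) :
    HasSymbol (vfBr X Y).1 (vfBracket z w) := by
  subst hk hl
  intro f x
  rw [vfBr_apply, hX.apply, hY.apply, hX.apply, hY.apply, mul_zero, zpow_zero, one_smul, Fn.at_sub,
    Fn.ofSmooth_at, Fn.ofSmooth_at, ← map_sub, ← lieD_apply, lieD_vfBracket]
  rfl

section DegreeZero

variable {L : LieAlgebroid E F A} {Q : VF E F A 1}
  {U : BundleMap E E (TM E M) F A} {V : Tensor E F A (-1)} {T : Tensor E F A 0}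

theorem IsDeRhamBracket.hasSymbol_of_eq (hT : IsDeRhamBracket Q V T) (hQ : IsDeRham L Q)
    (hV : IsLift U V) {k : ℤ} (hk : k = 0) {X : VF E F A k} {Y : Sec E E (TM E M)}
    (h : HasSymbol X.1 Y) : HasSymbol (T.toFun k X).1 (L.anchor.onSec (U.onSec Y)) := by
  subst hk
  exact hT.hasSymbol hQ hV h

theorem IsDeRhamBracket.apply_of_eq_vert (hT : IsDeRhamBracket Q V T) (hQ : IsDeRham L Q)
    (hV : IsLift U V) {k : ℤ} (hk : k = -1) {X : VF E F A k} {a : Sec E F A}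
    (h : X.1 = (vert a).1) : (T.toFun k X).1 = (vert (U.onSec (L.anchor.onSec a))).1 := by
  rw [T.congr hk X (vert a) h, hT.apply_vert hQ hV]

/-- The Frölicher-Nijenhuis bracket `[[d_A, U^↑], U^↑]` on vector fields of degree `0`: it measures
the failure of `U` to intertwine `[-, -]_N`, for `N = ρ ∘ U`, with the bracket of `A`. -/
theorem IsDeRhamBracket.fnTensor_zero (hT : IsDeRhamBracket Q V T) (hQ : IsDeRham L Q)
    (hV : IsLift U V) {X Y : VF E F A 0} {z w : Sec E E (TM E M)} (hX : HasSymbol X.1 z)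
    (hY : HasSymbol Y.1 w) : fnTensor T V 0 0 X Y =
      (2 : ℝ) • (vert (L.bracket (U.onSec z) (U.onSec w)
        - U.onSec (nijBracket (L.anchor.comp U) z w))).1 := by
  have h0 : (0 + -1 : ℤ) = -1 := zero_add _
  have hVX := hV.isCoreLift X z hX
  have hVY := hV.isCoreLift Y w hY
  have hTX := hT.hasSymbol hQ hV hX
  have hTY := hT.hasSymbol hQ hV hY
  have hXY : HasSymbol (vfBr X Y).1 (vfBracket z w) := hX.vfBr rfl rfl hY
  -- the terms `T [V Y, X]` produced by `e1` cancel those of the Frölicher-Nijenhuis bracket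
  have e1 : ∀ {X Y : VF E F A 0} {z w : Sec E E (TM E M)}, HasSymbol X.1 z →
      (V.toFun 0 Y).1 = (vert (U.onSec w)).1 → (vfBr (T.toFun 0 X) (V.toFun 0 Y)).1 =
      (-1 : ℝ) • ((vert (L.bracket (U.onSec w) (U.onSec z)
        - U.onSec (vfBracket (L.anchor.onSec (U.onSec w)) z))).1
        + (T.toFun _ (vfBr (V.toFun 0 Y) X)).1) := by
    intro X Y z w hX hVY
    rw [T.congr (by norm_num) (vfBr (V.toFun 0 Y) X) _ (vfBr_congr h0 rfl hVY rfl),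
      ← hT.vfBr_vert hQ hV hX, vfBr_congr rfl h0 rfl hVY, vfBr_skew]
    norm_num
  have e3 : (V.toFun _ (vfBr (T.toFun 0 X) Y)).1 =
      (vert (U.onSec (vfBracket (L.anchor.onSec (U.onSec z)) w))).1 :=
    hV.apply_hasSymbol (by norm_num) _ (hTX.vfBr (by norm_num) rfl hY)
  have e4 : (V.toFun _ (vfBr (T.toFun 0 Y) X)).1 =
      (vert (U.onSec (vfBracket (L.anchor.onSec (U.onSec w)) z))).1 :=
    hV.apply_hasSymbol (by norm_num) _ (hTY.vfBr (by norm_num) rfl hX)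
  have e7 : (T.toFun _ (V.toFun _ (vfBr X Y))).1 =
      (vert (U.onSec (L.anchor.onSec (U.onSec (vfBracket z w))))).1 :=
    (hT.apply_of_eq_vert hQ hV (by norm_num) (hV.apply_hasSymbol (by norm_num) _ hXY))
  have e8 : (V.toFun _ (T.toFun _ (vfBr X Y))).1 =
      (vert (U.onSec (L.anchor.onSec (U.onSec (vfBracket z w))))).1 :=
    hV.apply_hasSymbol (by norm_num) _ (hT.hasSymbol_of_eq hQ hV (by norm_num) hXY)
  have hn : nijBracket (L.anchor.comp U) z w = vfBracket (L.anchor.onSec (U.onSec z)) w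
      - vfBracket (L.anchor.onSec (U.onSec w)) z
      - L.anchor.onSec (U.onSec (vfBracket z w)) := by
    rw [vfBracket_skew (L.anchor.onSec (U.onSec w)) z, sub_neg_eq_add]
    rfl
  rw [fnTensor, e1 hX hVY, e1 hY hVX, e3, e4, e7, e8, hn, L.bracket_skew (U.onSec w)]
  simp only [U.onSec_sub, vert_sub, vert_neg, mul_zero, zero_mul, zpow_zero, add_zero]
  module

end DegreeZero

theorem Tensor.congr_smul {p k l : ℤ} (T : Tensor E F A p) (h : k = l) (X : VF E F A k)
    (Y : VF E F A l) (r : ℝ) (e : X.1 = r • Y.1) : (T.toFun k X).1 = r • (T.toFun l Y).1 := by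
  subst h
  rw [show X = r • Y from Subtype.ext e, map_smul]
  rfl

/-- The graded antisymmetry of the Frölicher-Nijenhuis bracket. -/
theorem fnTensor_swap {p s : ℤ} (T : Tensor E F A p) (S : Tensor E F A s) (k l : ℤ)
    (X : VF E F A k) (Y : VF E F A l) :
    fnTensor T S k l X Y = (-(-1 : ℝ) ^ (k * l)) • fnTensor T S l k Y X := by
  have e1 := S.congr_smul (add_comm k l) _ (vfBr Y X) _ (vfBr_skew X Y)
  have e2 := T.congr_smul (by ring) (S.toFun _ (vfBr X Y)) (S.toFun _ (vfBr Y X)) _ e1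
  have e3 := T.congr_smul (add_comm k l) _ (vfBr Y X) _ (vfBr_skew X Y)
  have e4 := S.congr_smul (by ring) (T.toFun _ (vfBr X Y)) (T.toFun _ (vfBr Y X)) _ e3
  rw [fnTensor, fnTensor, e2, e4]
  have h1 : (-1 : ℝ) ^ (s * k) = (-1 : ℝ) ^ (k * l) * (-1 : ℝ) ^ (k * (s + l)) := by
    rw [← sgn_add]; exact sgn_congr ⟨-(k * l), by ring⟩
  have h2 : (-1 : ℝ) ^ (l * (s + k)) = (-1 : ℝ) ^ (k * l) * (-1 : ℝ) ^ (s * l) := by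
    rw [← sgn_add]; exact sgn_congr ⟨0, by ring⟩
  rw [h1, h2, sgn_add (p * s) (k * l), sgn_add (p * s) (l * k), mul_comm l k]
  have h3 := sgn_mul_self (k * l)
  generalize (-1 : ℝ) ^ (k * l) = u at *
  have h4 : ∀ Z : Module.End ℝ (Fn E F A), u • u • Z = Z := fun Z => by
    rw [smul_smul, h3, one_smul]
  simp only [smul_add, smul_sub, neg_smul, mul_smul, h4, smul_comm u ((-1 : ℝ) ^ (p * s))]
  module

/-- The Frölicher-Nijenhuis bracket, with the graded antisymmetry of the commutator used to move
`Y` to the right. -/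
theorem fnTensor_eq {p s : ℤ} (T : Tensor E F A p) (S : Tensor E F A s) (k l : ℤ)
    (X : VF E F A k) (Y : VF E F A l) : fnTensor T S k l X Y =
      (-1 : ℝ) ^ (s * k) • (vfBr (T.toFun k X) (S.toFun l Y)).1
      + (-1 : ℝ) ^ (p * (k + s)) • (vfBr (S.toFun k X) (T.toFun l Y)).1
      - (-1 : ℝ) ^ (p * s) • (S.toFun _ (vfBr (T.toFun k X) Y)).1
      - (-1 : ℝ) ^ (p * (k + s)) • (S.toFun _ (vfBr X (T.toFun l Y))).1
      - (T.toFun _ (vfBr (S.toFun k X) Y)).1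
      - (-1 : ℝ) ^ (s * k) • (T.toFun _ (vfBr X (S.toFun l Y))).1
      + (T.toFun _ (S.toFun _ (vfBr X Y))).1
      + (-1 : ℝ) ^ (p * s) • (S.toFun _ (T.toFun _ (vfBr X Y))).1 := by
  have e1 := vfBr_skew (T.toFun l Y) (S.toFun k X)
  have e2 := S.congr_smul (add_comm (l + p) k) _ (vfBr X (T.toFun l Y)) _ (vfBr_skew _ _)
  have e3 := T.congr_smul (add_comm (l + s) k) _ (vfBr X (S.toFun l Y)) _ (vfBr_skew _ _)
  rw [fnTensor, e1, e2, e3]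
  simp only [smul_smul, mul_neg, ← sgn_add]
  rw [sgn_congr (a := l * (s + k) + (l + p) * (k + s)) (b := p * (k + s))
      ⟨l * (s + k), by ring⟩,
    sgn_congr (a := p * s + k * l + (l + p) * k) (b := p * (k + s)) ⟨k * l, by ring⟩,
    sgn_congr (a := k * l + (l + s) * k) (b := s * k) ⟨k * l, by ring⟩]
  simp only [neg_smul, sub_neg_eq_add, ← sub_eq_add_neg]

/-- A tensor of odd internal degree commutes with itself, as the terms of the Frölicher-Nijenhuis
bracket cancel in pairs. -/
theorem fnCommute_self (V : Tensor E F A (-1)) : FnCommute V V := by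
  intro k l X Y
  rw [fnTensor_eq, sgn_congr (a := -1 * (k + -1)) (b := -1 * k + 1) ⟨0, by ring⟩, sgn_add]
  norm_num
  module

theorem vfBr_of_eq_smul {k l l' m : ℤ} (X : VF E F A k) {Y : VF E F A l} {Y' : VF E F A l'}
    (hl : l' = m + l) {f : Fn E F A} (hf : f ∈ FnDeg E F A m) {r : ℝ}
    (e : Y'.1 = r • (LinearMap.mulLeft ℝ f ∘ₗ Y.1)) : (vfBr X Y').1 =
      r • (LinearMap.mulLeft ℝ (X.1 f) ∘ₗ Y.1)
        + (r * (-1 : ℝ) ^ (k * m)) • (LinearMap.mulLeft ℝ f ∘ₗ (vfBr X Y).1) := by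
  subst hl
  rw [show Y' = r • vfMul f hf Y from Subtype.ext e, vfBr_smul, Submodule.coe_smul, vfBr_mul,
    smul_add, mul_smul]
  rfl

theorem Tensor.of_eq_add {p n l w j m : ℤ} (T : Tensor E F A p) {Z : VF E F A n} {Y : VF E F A l}
    {W : VF E F A w} (hl : n = j + l) (hw : n = m + w) {g f : Fn E F A} (hg : g ∈ FnDeg E F A j)
    (hf : f ∈ FnDeg E F A m) {r s : ℝ} (e : Z.1 = r • (LinearMap.mulLeft ℝ g ∘ₗ Y.1)
      + s • (LinearMap.mulLeft ℝ f ∘ₗ W.1)) : (T.toFun n Z).1 =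
      (r * (-1 : ℝ) ^ (p * j)) • (LinearMap.mulLeft ℝ g ∘ₗ (T.toFun l Y).1)
      + (s * (-1 : ℝ) ^ (p * m)) • (LinearMap.mulLeft ℝ f ∘ₗ (T.toFun w W).1) := by
  have h : Z = r • vfCast hl.symm (vfMul g hg Y) + s • vfCast hw.symm (vfMul f hf W) :=
    Subtype.ext e
  rw [h, map_add, map_smul, map_smul, Submodule.coe_add, Submodule.coe_smul, Submodule.coe_smul,
    T.congr hl (vfCast _ _) (vfMul g hg Y) rfl, T.congr hw (vfCast _ _) (vfMul f hf W) rfl,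
    T.map_mul, T.map_mul, smul_smul, smul_smul]
  rfl

/-- The Frölicher-Nijenhuis bracket is linear over the functions in its second argument. -/
theorem fnTensor_vfMul (T : Tensor E F A 0) (S : Tensor E F A (-1)) (k : ℤ) {l m : ℤ}
    (X : VF E F A k) {f : Fn E F A} (hf : f ∈ FnDeg E F A m) (Y : VF E F A l) :
    fnTensor T S k (m + l) X (vfMul f hf Y) =
      (-1 : ℝ) ^ (k * m + m) • (LinearMap.mulLeft ℝ f ∘ₗ fnTensor T S k l X Y) := by
  have hS := S.map_mul f hf Y
  have hT := T.map_mul f hf Y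
  have e0 := vfBr_mul X Y hf
  have b1 := vfBr_of_eq_smul (T.toFun k X) (by ring) hf hS
  have b2 := vfBr_of_eq_smul (S.toFun k X) (by ring) hf hT
  have b3 := S.of_eq_add (by ring) (by ring) (vf_mem (T.toFun k X) hf) hf
    (vfBr_of_eq_smul (Y' := vfMul f hf Y) (T.toFun k X) rfl hf (one_smul ℝ _).symm)
  have b4 := S.of_eq_add (by ring) (by ring) (vf_mem X hf) hf
    (vfBr_of_eq_smul X (by ring) hf hT)
  have b5 := T.of_eq_add (by ring) (by ring) (vf_mem (S.toFun k X) hf) hf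
    (vfBr_of_eq_smul (Y' := vfMul f hf Y) (S.toFun k X) rfl hf (one_smul ℝ _).symm)
  have b6 := T.of_eq_add (by ring) (by ring) (vf_mem X hf) hf
    (vfBr_of_eq_smul X (by ring) hf hS)
  have b7 := S.of_eq_add (by ring) (by ring) (vf_mem X hf) hf
    (vfBr_of_eq_smul (Y' := vfMul f hf Y) X rfl hf (one_smul ℝ _).symm)
  have b8 := T.of_eq_add (by ring) (by ring) (vf_mem X hf) hf
    (vfBr_of_eq_smul (Y' := vfMul f hf Y) X rfl hf (one_smul ℝ _).symm)
  have c7 := T.of_eq_add (by ring) (by ring) (vf_mem X hf) hf b7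
  have c8 := S.of_eq_add (by ring) (by ring) (vf_mem X hf) hf b8
  rw [fnTensor_eq, fnTensor_eq, b1, b2, b3, b4, b5, b6, c7, c8]
  have h1 : (-1 : ℝ) ^ (-1 * m) = (-1 : ℝ) ^ m := sgn_congr ⟨-m, by ring⟩
  have h2 : (-1 : ℝ) ^ (-1 * k) = (-1 : ℝ) ^ k := sgn_congr ⟨-k, by ring⟩
  have h3 : (-1 : ℝ) ^ (-1 * (m + k)) = (-1 : ℝ) ^ k * (-1 : ℝ) ^ m := by
    rw [← sgn_add]; exact sgn_congr ⟨-(m + k), by ring⟩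
  have h4 : (-1 : ℝ) ^ ((k + -1) * m) = (-1 : ℝ) ^ (k * m) * (-1 : ℝ) ^ m := by
    rw [← sgn_add]; exact sgn_congr ⟨-m, by ring⟩
  simp only [zero_mul, zpow_zero, one_mul, one_smul, mul_one, h1, h2, h3, h4, sgn_add,
    LinearMap.comp_add, LinearMap.comp_sub, LinearMap.comp_smul, add_zero]
  module

theorem fnTensor_cast {p s : ℤ} (T : Tensor E F A p) (S : Tensor E F A s) {k l l' : ℤ}
    (h : l = l') (X : VF E F A k) (Y : VF E F A l) :
    fnTensor T S k l' X (vfCast h Y) = fnTensor T S k l X Y := by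
  subst h; rfl

theorem fnTensor_add {p s : ℤ} (T : Tensor E F A p) (S : Tensor E F A s) {k l : ℤ}
    (X : VF E F A k) (Y Z : VF E F A l) :
    fnTensor T S k l X (Y + Z) = fnTensor T S k l X Y + fnTensor T S k l X Z := by
  simp only [fnTensor_eq, map_add, vfBr_add, Submodule.coe_add]
  module

/-- The value of the bracket has degree `k + l - 1`, and vector fields of degree less than `-1`
vanish. -/
theorem fnTensor_eq_zero_of_lt (T : Tensor E F A 0) (S : Tensor E F A (-1)) {k l : ℤ}
    (h : k + l < 0) (X : VF E F A k) (Y : VF E F A l) : fnTensor T S k l X Y = 0 := by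
  have h0 : ∀ (n : ℤ) (Z : VF E F A n), n < -1 → Z.1 = 0 := fun n Z hn => by
    rw [vf_eq_zero_of_lt hn Z]; rfl
  rw [fnTensor, h0 _ (vfBr (T.toFun k X) (S.toFun l Y)) (by omega),
    h0 _ (vfBr (T.toFun l Y) (S.toFun k X)) (by omega),
    h0 _ (S.toFun _ (vfBr (T.toFun k X) Y)) (by omega),
    h0 _ (S.toFun _ (vfBr (T.toFun l Y) X)) (by omega),
    h0 _ (T.toFun _ (vfBr (S.toFun k X) Y)) (by omega),
    h0 _ (T.toFun _ (vfBr (S.toFun l Y) X)) (by omega),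
    h0 _ (T.toFun _ (S.toFun _ (vfBr X Y))) (by omega),
    h0 _ (S.toFun _ (T.toFun _ (vfBr X Y))) (by omega)]
  simp only [smul_zero, sub_zero, add_zero]

/-- If the Frölicher-Nijenhuis bracket vanishes on the generators of the module of vector fields in
the second argument, it vanishes. -/
theorem fnTensor_eq_zero (T : Tensor E F A 0) (S : Tensor E F A (-1)) {j : ℤ} (Z : VF E F A j)
    (h0 : ∀ X, fnTensor T S j 0 Z X = 0) (h1 : ∀ X, fnTensor T S j (-1) Z X = 0) (k : ℤ)
    (X : VF E F A k) : fnTensor T S j k Z X = 0 := by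
  refine vf_induction (P := fun k X => fnTensor T S j k Z X = 0) ?_ ?_ ?_ h0 h1 k X
  · intro k X Y hX hY
    rw [fnTensor_add, hX, hY, add_zero]
  · intro m k f hf X hX
    rw [fnTensor_vfMul, hX, LinearMap.comp_zero, smul_zero]
  · intro k X h
    refine LinearMap.ext fun φ => Fn.ext fun x => ?_
    obtain ⟨χ, h1, hχ⟩ := h x
    rw [vfSmul, fnTensor_cast, fnTensor_vfMul, mul_zero, add_zero, zpow_zero, one_smul] at hχ
    have h2 := congrArg (fun R : Module.End ℝ (Fn E F A) => (R φ).at x) hχ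
    change (Fn.ofSmooth F A χ * fnTensor T S j k Z X φ).at x = 0 at h2
    rw [Fn.ofSmooth_mul_at, h1, one_smul] at h2
    exact h2

variable {L : LieAlgebroid E F A} {Q : VF E F A 1}
  {U : BundleMap E E (TM E M) F A} {V : Tensor E F A (-1)} {T : Tensor E F A 0}

/-- The tensors `[d_A, U^↑]` and `U^↑` commute if and only if `U` intertwines the bracket
`[-, -]_N`, for `N = ρ ∘ U`, with the bracket of `A`. -/
theorem IsDeRhamBracket.fnCommute_iff (hT : IsDeRhamBracket Q V T) (hQ : IsDeRham L Q)
    (hV : IsLift U V) : FnCommute T V ↔ ∀ z w, U.onSec (nijBracket (L.anchor.comp U) z w) =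
      L.bracket (U.onSec z) (U.onSec w) := by
  constructor
  · intro h z w
    obtain ⟨X, hX⟩ := exists_lift F A z
    obtain ⟨Y, hY⟩ := exists_lift F A w
    have h1 := h 0 0 X Y
    rw [hT.fnTensor_zero hQ hV hX hY] at h1
    have h2 : (vert (L.bracket (U.onSec z) (U.onSec w)
        - U.onSec (nijBracket (L.anchor.comp U) z w))).1 = (vert (0 : Sec E F A)).1 := by
      rw [vert_zero]
      exact (smul_eq_zero.1 h1).resolve_left two_ne_zero
    exact (sub_eq_zero.1 (vert_injective h2)).symm
  · intro h
    have h00 : ∀ X Y : VF E F A 0, fnTensor T V 0 0 X Y = 0 := fun X Y => by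
      obtain ⟨z, hz⟩ := exists_symbol X
      obtain ⟨w, hw⟩ := exists_symbol Y
      rw [hT.fnTensor_zero hQ hV hz hw, h, sub_self, vert_zero, smul_zero]
    have h0 : ∀ (X : VF E F A 0) l Y, fnTensor T V 0 l X Y = 0 := fun X =>
      fnTensor_eq_zero T V X (h00 X) fun Y => fnTensor_eq_zero_of_lt T V (by norm_num) X Y
    have h1 : ∀ (X : VF E F A (-1)) l Y, fnTensor T V (-1) l X Y = 0 := fun X =>
      fnTensor_eq_zero T V X (fun Y => fnTensor_eq_zero_of_lt T V (by norm_num) X Y) fun Y =>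
        fnTensor_eq_zero_of_lt T V (by norm_num) X Y
    intro k l X Y
    rw [fnTensor_swap, fnTensor_eq_zero T V Y (fun X => ?_) (fun X => ?_) k X, smul_zero]
    · rw [fnTensor_swap, h0, smul_zero]
    · rw [fnTensor_swap, h1, smul_zero]

/-- Change of the internal degree along an equality, without a cast in the values. -/
theorem Tensor.exists_cast {p p' : ℤ} (h : p = p') (T : Tensor E F A p) :
    ∃ T' : Tensor E F A p', (∀ k X, (T'.toFun k X).1 = (T.toFun k X).1) ∧
      ∀ {s} (S : Tensor E F A s), FnCommute T' S ↔ FnCommute T S := by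
  subst h
  exact ⟨T, fun _ _ => rfl, fun _ => Iff.rfl⟩

/-- The tensor `[d_A, V]`, as a tensor of internal degree `0`. -/
theorem exists_isDeRhamBracket (Q : VF E F A 1) (V : Tensor E F A (-1)) :
    ∃ T : Tensor E F A 0, IsDeRhamBracket Q V T ∧ (FnCommute T V ↔ FnCommute (fnVec Q V) V) := by
  obtain ⟨T, h1, h2⟩ := (fnVec Q V).exists_cast (p' := 0) (by norm_num)
  exact ⟨T, fun k X => (h1 k X).trans (fnVec_apply Q V k X), h2 V⟩

end Commute

/-! ### Related vector fields and tensors on `T[1]M` and `A[1]` -/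

/-- Contraction is natural: `v ⌟ g^* η = g^* (g v ⌟ η)`. -/
theorem contract_map {V W : Type*} [AddCommGroup V] [Module ℝ V] [AddCommGroup W] [Module ℝ W]
    (g : V →ₗ[ℝ] W) (v : V) (η : ExteriorAlgebra ℝ (Module.Dual ℝ W)) :
    contract v (ExteriorAlgebra.map g.dualMap η) =
      ExteriorAlgebra.map g.dualMap (contract (g v) η) := by
  induction η using CliffordAlgebra.left_induction
    (Q := (0 : QuadraticForm ℝ (Module.Dual ℝ W))) with
  | algebraMap r =>
    have h : ExteriorAlgebra.map g.dualMap (algebraMap ℝ _ r) = algebraMap ℝ _ r :=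
      AlgHom.commutes _ _
    exact (congrArg _ h).trans ((contract_algebraMap v r).trans
      ((congrArg _ (contract_algebraMap (g v) r)).trans (map_zero _)).symm)
  | add x y hx hy => rw [map_add, map_add, hx, hy, map_add, map_add]
  | ι_mul x ξ hx =>
    have h : ExteriorAlgebra.map g.dualMap (ExteriorAlgebra.ι ℝ ξ * x) =
        ExteriorAlgebra.ι ℝ (g.dualMap ξ) * ExteriorAlgebra.map g.dualMap x := by
      rw [map_mul, ExteriorAlgebra.map_apply_ι]
    refine (congrArg _ h).trans ?_
    refine Eq.trans ?_ (congrArg _ (contract_ι_mul (g v) ξ x)).symm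
    rw [contract_ι_mul, hx, map_sub, map_smul, map_mul, ExteriorAlgebra.map_apply_ι]
    rfl

section Related

variable {E : Type*} [NormedAddCommGroup E] [NormedSpace ℝ E] [FiniteDimensional ℝ E]
  {M : Type*} [TopologicalSpace M] [ChartedSpace E M] [IsManifold 𝓘(ℝ, E) ∞ M] [T2Space M]
  [SecondCountableTopology M]
  {F : Type*} [NormedAddCommGroup F] [NormedSpace ℝ F] [FiniteDimensional ℝ F]
  {A : M → Type*} [∀ x, AddCommGroup (A x)] [∀ x, Module ℝ (A x)]
  [∀ x, TopologicalSpace (A x)] [TopologicalSpace (Bundle.TotalSpace F A)]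
  [FiberBundle F A] [VectorBundle ℝ F A] [ContMDiffVectorBundle ∞ F A 𝓘(ℝ, E)]
  {U : BundleMap E E (TM E M) F A}

/-- The pull-back of a section of `A^*` along a bundle map `TM → A`. -/
def CoSec.pull (U : BundleMap E E (TM E M) F A) (ξ : CoSec E F A) : CoSec E E (TM E M) :=
  ⟨fun x => ξ.toFun x ∘ₗ U.toFun x, fun s => ξ.smooth' (U.onSec s)⟩

theorem pullback_at (φ : Fn E F A) (x : M) :
    (pullback U φ).at x = ExteriorAlgebra.map (U.toFun x).dualMap (φ.at x) := rfl

theorem pullback_ofSmooth (f : Smooth E M) :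
    pullback U (Fn.ofSmooth F A f) = Fn.ofSmooth E (TM E M) f :=
  Fn.ext fun _ => AlgHom.commutes _ _

theorem pullback_ofCoSec (ξ : CoSec E F A) :
    pullback U (Fn.ofCoSec ξ) = Fn.ofCoSec (ξ.pull U) :=
  Fn.ext fun _ => ExteriorAlgebra.map_apply_ι _ _

theorem pullback_mul (φ η : Fn E F A) : pullback U (φ * η) = pullback U φ * pullback U η :=
  Fn.ext fun _ => map_mul _ _ _

theorem pullback_add (φ η : Fn E F A) : pullback U (φ + η) = pullback U φ + pullback U η :=
  Fn.ext fun _ => map_add _ _ _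

theorem pullback_smul (r : ℝ) (φ : Fn E F A) : pullback U (r • φ) = r • pullback U φ :=
  Fn.ext fun x => map_smul (ExteriorAlgebra.map (U.toFun x).dualMap) r (φ.at x)

theorem pullback_sub (φ η : Fn E F A) : pullback U (φ - η) = pullback U φ - pullback U η :=
  Fn.ext fun _ => map_sub _ _ _

theorem pullback_one : pullback U (1 : Fn E F A) = 1 := Fn.ext fun _ => map_one _

/-- Vector fields are related if they are so on the generators of the algebra of functions. -/
theorem vfRelated_of_generators {k : ℤ} {X : VF E E (TM E M) k} {X' : VF E F A k}
    (hf : ∀ f, X.1 (Fn.ofSmooth E (TM E M) f) = pullback U (X'.1 (Fn.ofSmooth F A f)))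
    (hξ : ∀ ξ : CoSec E F A, X.1 (Fn.ofCoSec (ξ.pull U)) = pullback U (X'.1 (Fn.ofCoSec ξ))) :
    VFRelated U X.1 X'.1 := by
  refine fun φ => Fn.ext fun x => ?_
  induction φ using Fn.local_induction (x := x) with
  | loc φ η h hη =>
    have h' : ∀ᶠ y in 𝓝 x, (pullback U φ).at y = (pullback U η).at y := by
      filter_upwards [h] with y hy
      rw [pullback_at, pullback_at, hy]
    rw [vf_local X h', hη, pullback_at, pullback_at, vf_local X' h]
  | one => rw [pullback_one, vf_one, vf_one, pullback_at, Fn.at_zero, Fn.at_zero, map_zero]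
  | add φ η hφ hη =>
    rw [pullback_add, map_add, map_add, pullback_add, Fn.at_add, Fn.at_add, hφ, hη]
  | smooth f φ hφ =>
    rw [pullback_mul, pullback_ofSmooth, vf_smooth_mul, vf_smooth_mul, pullback_add, pullback_mul,
      pullback_mul, hf, pullback_ofSmooth, Fn.at_add, Fn.at_add, Fn.at_mul (Fn.ofSmooth _ _ _),
      Fn.at_mul (Fn.ofSmooth _ _ _), hφ]
  | coSec ξ φ hφ =>
    rw [pullback_mul, pullback_ofCoSec, vf_coSec_mul, vf_coSec_mul, pullback_add, pullback_mul,
      pullback_smul, pullback_mul, hξ, pullback_ofCoSec, Fn.at_add, Fn.at_add, Fn.at_smul,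
      Fn.at_smul, Fn.at_mul (Fn.ofCoSec _), Fn.at_mul (Fn.ofCoSec _), hφ]

theorem VFRelated.vfBr {k l : ℤ} {X : VF E E (TM E M) k} {X' : VF E F A k}
    {Y : VF E E (TM E M) l} {Y' : VF E F A l} (h : VFRelated U X.1 X'.1)
    (h' : VFRelated U Y.1 Y'.1) : VFRelated U (vfBr X Y).1 (vfBr X' Y').1 := by
  intro φ
  rw [vfBr_apply, vfBr_apply, h', h, h, h', pullback_sub, pullback_smul]

theorem symb_of_vfRelated {k : ℤ} {X : VF E E (TM E M) k} {X' : VF E F A k}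
    (h : VFRelated U X.1 X'.1) (x : M) (α : Module.Dual ℝ (TM E M x)) :
    symb X.1 x α = ExteriorAlgebra.map (U.toFun x).dualMap (symb X'.1 x α) := by
  obtain ⟨f, rfl⟩ := exists_dform_eq α
  rw [← symb_dform, ← symb_dform, ← pullback_at, ← h, pullback_ofSmooth]

/-- The identification of `T[1]M` with `A[1]` induced by `U` takes `id^↑` to `U^↑`. -/
theorem tensorRelated_of_isLift {V' : Tensor E E (TM E M) (-1)} {V : Tensor E F A (-1)}
    (hV' : IsLift (idMap E M) V') (hV : IsLift U V) : TensorRelated U V' V := by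
  intro k X X' h
  refine vfRelated_of_generators (fun f => ?_) fun ξ => Fn.ext fun x => ?_
  · rw [hV'.apply_smooth, hV.apply_smooth]
    exact Fn.ext fun x => (map_zero _).symm
  · rw [(hV' k X x).2, pullback_at, (hV k X' x).2, map_smul, ← symb_of_vfRelated h]
    rfl

/-- A morphism of Lie algebroids intertwines the de Rham differentials. -/
theorem vfRelated_deRham {L' : LieAlgebroid E E (TM E M)} {L : LieAlgebroid E F A}
    {Q' : VF E E (TM E M) 1} {Q : VF E F A 1} (hQ' : IsDeRham L' Q') (hQ : IsDeRham L Q)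
    (hρ : ∀ x v, L.anchor.toFun x (U.toFun x v) = L'.anchor.toFun x v)
    (hb : ∀ a b, U.onSec (L'.bracket a b) = L.bracket (U.onSec a) (U.onSec b)) :
    VFRelated U Q'.1 Q.1 := by
  refine vfRelated_of_generators (fun f => Fn.ext fun x => ?_) fun ξ => Fn.ext fun x => ?_ <;>
    obtain ⟨fr⟩ := exists_frame E E (TM E M) x
  · refine sub_eq_zero.1 (fr.eq_zero_of_contract fr.mem (j := 0 + 1) (by norm_num)
      (sub_mem (vf_mem Q' (Fn.ofSmooth_mem f) x)
        (map_mem_grd _ (vf_mem Q (Fn.ofSmooth_mem f) x))) fun a => ?_)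
    have h := hQ.1 f (U.onSec a) x
    change contract (U.toFun x (a x)) _ = algebraMap ℝ _
      (dirDeriv f x (L.anchor.toFun x (U.toFun x (a x)))) at h
    rw [map_sub, hQ'.1, pullback_at, contract_map, h, AlgHom.commutes, hρ, sub_self]
  · have hm := sub_mem (vf_mem Q' (Fn.ofCoSec_mem (ξ.pull U)) x)
      (map_mem_grd (U.toFun x).dualMap (vf_mem Q (Fn.ofCoSec_mem ξ) x))
    refine sub_eq_zero.1 (fr.eq_zero_of_contract fr.mem (j := 1 + 1) (by norm_num) hm fun a =>
      fr.eq_zero_of_contract fr.mem (j := 1 + 1 - 1) (by norm_num) (contract_mem _ hm) fun b => ?_)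
    have h := hQ.2 ξ (U.onSec a) (U.onSec b) x
    rw [← hb] at h
    change contract (U.toFun x (b x)) (contract (U.toFun x (a x)) _) = algebraMap ℝ _
      (dirDeriv (fun y => ξ.toFun y (U.toFun y (b y))) x (L.anchor.toFun x (U.toFun x (a x)))
        - dirDeriv (fun y => ξ.toFun y (U.toFun y (a y))) x (L.anchor.toFun x (U.toFun x (b x)))
        - ξ.toFun x (U.toFun x (L'.bracket a b x))) at h
    rw [map_sub, map_sub, hQ'.2, pullback_at, contract_map, contract_map, h, AlgHom.commutes, hρ,
      hρ]
    exact sub_self _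

/-- The anchor respects brackets, so a bundle map `U` which intertwines the brackets `[-, -]_N`, for
`N = ρ ∘ U`, makes the Nijenhuis torsion of `N` vanish. -/
theorem isNijenhuis_of_bracket (L : LieAlgebroid E F A)
    (hb : ∀ z w, U.onSec (nijBracket (L.anchor.comp U) z w) =
      L.bracket (U.onSec z) (U.onSec w)) : IsNijenhuis (L.anchor.comp U) := by
  intro X Y
  have h : (L.anchor.comp U).onSec (nijBracket (L.anchor.comp U) X Y) =
      vfBracket ((L.anchor.comp U).onSec X) ((L.anchor.comp U).onSec Y) := by
    change L.anchor.onSec (U.onSec (nijBracket (L.anchor.comp U) X Y)) = _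
    rw [hb, L.anchor_bracket]
    rfl
  rw [← h, nijBracket, BundleMap.onSec_sub, BundleMap.onSec_add]
  abel

/-- For a bundle map `U : TM → A` which intertwines the brackets `[-, -]_N`, for `N = ρ ∘ U`, the
tensor `[d_A, U^↑]` corresponds to the shifted tangent lift of `N`. The latter is `[d_N, id^↑]`, for
`d_N` the de Rham differential of `(TM)_N`. -/
theorem exists_isShiftedTangentLift (L : LieAlgebroid E F A)
    (hN : IsNijenhuis (L.anchor.comp U)) {V : Tensor E F A (-1)} (hV : IsLift U V)
    (hb : ∀ z w, U.onSec (nijBracket (L.anchor.comp U) z w) =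
      L.bracket (U.onSec z) (U.onSec w)) :
    ∃ T : Tensor E E (TM E M) 0, IsShiftedTangentLift (L.anchor.comp U) T ∧
      TensorRelated U T (fnVec (deRham L) V) := by
  set L' := nijenhuisAlgebroid (L.anchor.comp U) hN
  have hQ' := isDeRham_deRham L'
  have hQ := isDeRham_deRham L
  obtain ⟨V', hV'⟩ := exists_isLift (idMap E M)
  obtain ⟨T, hT, -⟩ := exists_isDeRhamBracket (deRham L') V'
  have hQQ := vfRelated_deRham (U := U) hQ' hQ (fun _ _ => rfl) hb
  have hVV := tensorRelated_of_isLift hV' hV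
  refine ⟨T, ?_, fun k X X' h φ => ?_⟩
  · have h := hT.hasTriple hQ' hV'
    have e : (fun a Y => L'.bracket a ((idMap E M).onSec Y)
        - (idMap E M).onSec (vfBracket (L'.anchor.onSec a) Y)) = fun Z Y =>
        vfBracket Z ((L.anchor.comp U).onSec Y) - (L.anchor.comp U).onSec (vfBracket Z Y) := by
      funext Z Y
      change vfBracket ((L.anchor.comp U).onSec Z) Y + vfBracket Z ((L.anchor.comp U).onSec Y)
        - (L.anchor.comp U).onSec (vfBracket Z Y) - vfBracket ((L.anchor.comp U).onSec Z) Y = _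
      abel
    rw [e] at h
    exact h
  · rw [hT, fnVec_apply, LinearMap.add_apply, LinearMap.add_apply, pullback_add,
      hQQ.vfBr (hVV k X X' h), hVV _ _ _ (hQQ.vfBr h)]

end Related

end ShiftedBundle

end

theorem theorem1
    {E : Type*} [NormedAddCommGroup E] [NormedSpace ℝ E] [FiniteDimensional ℝ E]
    {M : Type*} [TopologicalSpace M] [ChartedSpace E M] [IsManifold 𝓘(ℝ, E) ∞ M]
    [T2Space M] [SecondCountableTopology M]
    {F : Type*} [NormedAddCommGroup F] [NormedSpace ℝ F] [FiniteDimensional ℝ F]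
    {A : M → Type*} [∀ x, AddCommGroup (A x)] [∀ x, Module ℝ (A x)]
    [∀ x, TopologicalSpace (A x)] [TopologicalSpace (Bundle.TotalSpace F A)]
    [FiberBundle F A] [VectorBundle ℝ F A] [ContMDiffVectorBundle ∞ F A 𝓘(ℝ, E)]
    (L : LieAlgebroid E F A) :
    -- the equivalence
    ((∃ (N : BundleMap E E (TM E M) E (TM E M)) (hN : IsNijenhuis N)
        (U : BundleMap E E (TM E M) F A), IsLieAlgebroidIso (nijenhuisAlgebroid N hN) L U) ↔
      ∃ V : Tensor E F A (-1), V.IsAlmostTangent ∧ FnCommute (fnVec (deRham L) V) V) ∧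
    -- an almost tangent structure of internal degree `-1` is necessarily integrable
    (∀ V : Tensor E F A (-1), V.IsAlmostTangent → FnCommute V V) ∧
    -- the isomorphism `U`, the Nijenhuis operator `N = ρ ∘ U` and its shifted tangent lift
    ∀ V : Tensor E F A (-1), V.IsAlmostTangent → FnCommute (fnVec (deRham L) V) V →
      ∃ U : BundleMap E E (TM E M) F A,
        U.IsIso ∧ IsCoreLift U V ∧ (∀ U', IsCoreLift U' V → U' = U) ∧
        (∃ hN : IsNijenhuis (L.anchor.comp U),
          IsLieAlgebroidIso (nijenhuisAlgebroid (L.anchor.comp U) hN) L U) ∧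
        ∃ T : Tensor E E (TM E M) 0, IsShiftedTangentLift (L.anchor.comp U) T ∧
          TensorRelated U T (fnVec (deRham L) V) := by
  have part3 : ∀ V : Tensor E F A (-1), V.IsAlmostTangent → FnCommute (fnVec (deRham L) V) V →
      ∃ U : BundleMap E E (TM E M) F A,
        U.IsIso ∧ IsCoreLift U V ∧ (∀ U', IsCoreLift U' V → U' = U) ∧
        (∃ hN : IsNijenhuis (L.anchor.comp U),
          IsLieAlgebroidIso (nijenhuisAlgebroid (L.anchor.comp U) hN) L U) ∧
        ∃ T : Tensor E E (TM E M) 0, IsShiftedTangentLift (L.anchor.comp U) T ∧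
          TensorRelated U T (fnVec (deRham L) V) := by
    intro V hV hQV
    obtain ⟨U, hU⟩ := exists_isCoreLift V
    have hL := isLift_of_isCoreLift hU
    have hiso := hL.isIso hV
    obtain ⟨T, hT, hTV⟩ := exists_isDeRhamBracket (deRham L) V
    have hb := (hT.fnCommute_iff (isDeRham_deRham L) hL).1 (hTV.2 hQV)
    have hN := isNijenhuis_of_bracket L hb
    exact ⟨U, hiso, hU, fun U' hU' => hU.unique hU', ⟨hN, hiso, fun _ _ => rfl, hb⟩,
      exists_isShiftedTangentLift L hN hL hb⟩
  refine ⟨⟨?_, ?_⟩, fun V _ => fnCommute_self V, part3⟩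
  · rintro ⟨N, hN, U, hU, hρ, hb⟩
    obtain ⟨V, hV⟩ := exists_isLift U
    obtain ⟨T, hT, hTV⟩ := exists_isDeRhamBracket (deRham L) V
    have e : L.anchor.comp U = N := BundleMap.ext_apply hρ
    refine ⟨V, hV.isAlmostTangent hU, hTV.1 ((hT.fnCommute_iff (isDeRham_deRham L) hV).2 ?_)⟩
    rw [e]
    exact hb
  · rintro ⟨V, hV, hQV⟩
    obtain ⟨U, -, -, -, ⟨hN, hU⟩, -⟩ := part3 V hV hQV
    exact ⟨_, hN, U, hU⟩
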